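/- **Setting.** Let $\sigma_*:\mathbb R\to\mathbb R$ be measurable and $\rho>0$. For $d,\ell\in\mathbb N$ let $\xi\sim\mathcal N(0,I_d)$, $x_1,\dots,x_{\ell+1}\sim\mathcal N(0,I_d/d)$ and $\epsilon_1,\dots,\epsilon_\ell\sim\mathcal N(0,\rho)$ be independent, let $y_i=\sigma_*(\xi^Tx_i)+\epsilon_i$ for $i\le\ell$, and let $$H_Z=x_{\ell+1}\begin{bmatrix}\frac d\ell\sum_{i\le\ell}y_ix_i^T & \frac1\ell\sum_{i\le\ell}y_i^2\end{bmatrix}\in\mathbb R^{d\times(d+1)} .$$ Assume that $\mathrm{vec}(H_Z)$ has finite second moments, so that $\mathrm{Cov}(\mathrm{vec}(H_Z))$ (over the randomness of $\xi$, the $x_i$ and the $\epsilon_i$) exists. Let $F\in\mathbb R^{d(d+1)\times m}$ be independent of $\xi$, of the $x_i$ and of the $\epsilon_i$, with i.i.d. entries $\mathcal N\bigl(0,1/\mathrm{tr}(\mathrm{Cov}(\mathrm{vec}(H_Z)))\bigr)$. **Statement.** Let $d\to\infty$ along a strictly increasing sequence of dimensions, with $\ell=\ell_d$ such that $\ell/d\to\tau\in(0,\infty)$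 (for instance $\ell/d$ constant), and let $m=m_d$ be arbitrary (constant or growing). Then, conditionally on the task vectors $\xi=\xi_d$, the pair $(F^T\mathrm{vec}(H_Z),\,\xi^Tx_{\ell+1})$ becomes jointly Gaussian with zero mean and some covariance. That is: for every $k$ and every choice of $k$ distinct columns $f_{i_1},\dots,f_{i_k}$ of $F$ (the choice may depend on $d$), there is a deterministic positive semidefinite $(k+1)\times(k+1)$ matrix $\Sigma$ with unit diagonal such that 1. for almost every realization of the task vectors $(\xi_d)_d$, the conditional law of $(f_{i_1}^T\mathrm{vec}(H_Z),\dots,f_{i_k}^T\mathrm{vec}(H_Z),\,\xi^Tx_{\ell+1})$ given $\xi$, over the randomness of $F$, the $x_i$ and the $\epsilon_i$, converges weakly to $\mathcal N(0,\Sigma)$; 2. for almost every realization of the task vectors and of the weight matrices $(\xi_d,F_d)_d$, the conditional law of the same vector given $\xi$ and $F$, over the randomness of the $x_i$ and the $\epsilon_i$ only, converges weakly to $\mathcal N(0,\Sigma)$. Here all $\xi_d$ and $F_d$ live on one probability space; no assumption is made on their dependence across different $d$. -/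

import Mathlib

open MeasureTheory ProbabilityTheory Filter
open scoped NNReal Topology Matrix

namespace ICL

noncomputable section

/-- The law `N(0, I_d)` of the task vector `ξ`. -/
def taskLaw (d : ℕ) : Measure (Fin d → ℝ) :=
  Measure.pi fun _ => gaussianReal 0 1

/-- The law `N(0, I_d / d)` of a single input vector. -/
def inputLaw (d : ℕ) : Measure (Fin d → ℝ) :=
  Measure.pi fun _ => gaussianReal 0 ((d : ℝ≥0)⁻¹)

/-- The joint law of the inputs `x_1, …, x_ℓ, x_{ℓ+1}` and of the label noises `ε_1, …, ε_ℓ`: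
all independent, `x_i ∼ N(0, I_d / d)` and `ε_i ∼ N(0, ρ)`. It does not depend on `ξ`. -/
def promptLaw (d ℓ : ℕ) (ρ : ℝ≥0) : Measure ((Fin (ℓ + 1) → Fin d → ℝ) × (Fin ℓ → ℝ)) :=
  (Measure.pi fun _ => inputLaw d).prod (Measure.pi fun _ => gaussianReal 0 ρ)

instance (d : ℕ) : IsProbabilityMeasure (taskLaw d) := by
  unfold taskLaw; infer_instance

instance (d : ℕ) : IsProbabilityMeasure (inputLaw d) := by
  unfold inputLaw; infer_instance

instance (d ℓ : ℕ) (ρ : ℝ≥0) : IsProbabilityMeasure (promptLaw d ℓ ρ) := by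
  unfold promptLaw; infer_instance

/-- The context labels `y_i = σ_*(ξᵀ x_i) + ε_i`, `1 ≤ i ≤ ℓ`. -/
def labels {d ℓ : ℕ} (σs : ℝ → ℝ) (ξ : Fin d → ℝ)
    (z : (Fin (ℓ + 1) → Fin d → ℝ) × (Fin ℓ → ℝ)) : Fin ℓ → ℝ :=
  fun i => σs (ξ ⬝ᵥ z.1 i.castSucc) + z.2 i

/-- The query input `x_{ℓ+1}`. -/
def query {d ℓ : ℕ} (z : (Fin (ℓ + 1) → Fin d → ℝ) × (Fin ℓ → ℝ)) : Fin d → ℝ :=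
  z.1 (Fin.last ℓ)

/-- The row vector `[ (d/ℓ) ∑_{i ≤ ℓ} y_i x_iᵀ , (1/ℓ) ∑_{i ≤ ℓ} y_i² ]` of length `d + 1`. -/
def contextRow {d ℓ : ℕ} (σs : ℝ → ℝ) (ξ : Fin d → ℝ)
    (z : (Fin (ℓ + 1) → Fin d → ℝ) × (Fin ℓ → ℝ)) : Fin (d + 1) → ℝ :=
  Fin.snoc (α := fun _ => ℝ)
    (fun j => ((d : ℝ) / ℓ) * ∑ i : Fin ℓ, labels σs ξ z i * z.1 i.castSucc j)
    ((1 / (ℓ : ℝ)) * ∑ i : Fin ℓ, labels σs ξ z i ^ 2)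

/-- The attention feature matrix `H_Z = x_{ℓ+1} [ (d/ℓ) ∑ y_i x_iᵀ , (1/ℓ) ∑ y_i² ]`. -/
def featureMatrix {d ℓ : ℕ} (σs : ℝ → ℝ) (ξ : Fin d → ℝ)
    (z : (Fin (ℓ + 1) → Fin d → ℝ) × (Fin ℓ → ℝ)) : Matrix (Fin d) (Fin (d + 1)) ℝ :=
  Matrix.vecMulVec (query z) (contextRow σs ξ z)

/-- `vec(H_Z)`; its `d (d + 1)` coordinates are indexed by (column, row) pairs. -/
def vecH {d ℓ : ℕ} (σs : ℝ → ℝ) (ξ : Fin d → ℝ)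
    (z : (Fin (ℓ + 1) → Fin d → ℝ) × (Fin ℓ → ℝ)) : Fin (d + 1) × Fin d → ℝ :=
  (featureMatrix σs ξ z).vec

/-- The covariance matrix `Cov(vec(H_Z))`, over all the randomness of `Z`: the task vector, the
inputs and the noises. -/
def featureCov (d ℓ : ℕ) (ρ : ℝ≥0) (σs : ℝ → ℝ) :
    Matrix (Fin (d + 1) × Fin d) (Fin (d + 1) × Fin d) ℝ :=
  Matrix.of fun p q =>
    covariance (fun w : (Fin d → ℝ) × ((Fin (ℓ + 1) → Fin d → ℝ) × (Fin ℓ → ℝ)) =>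
        vecH σs w.1 w.2 p)
      (fun w => vecH σs w.1 w.2 q) ((taskLaw d).prod (promptLaw d ℓ ρ))

/-- The law of the `d (d + 1) × m` random matrix `F`: i.i.d. entries
`N(0, 1 / tr Cov(vec(H_Z)))`. -/
def weightLaw (d ℓ m : ℕ) (ρ : ℝ≥0) (σs : ℝ → ℝ) :
    Measure (Fin (d + 1) × Fin d → Fin m → ℝ) :=
  Measure.pi fun _ => Measure.pi fun _ =>
    gaussianReal 0 (Real.toNNReal (1 / (featureCov d ℓ ρ σs).trace))

instance (d ℓ m : ℕ) (ρ : ℝ≥0) (σs : ℝ → ℝ) : IsProbabilityMeasure (weightLaw d ℓ m ρ σs) := by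
  unfold weightLaw; infer_instance

/-- The vector `Fᵀ vec(H_Z) ∈ ℝ^m`. -/
def hidden {d ℓ m : ℕ} (σs : ℝ → ℝ) (F : Fin (d + 1) × Fin d → Fin m → ℝ) (ξ : Fin d → ℝ)
    (z : (Fin (ℓ + 1) → Fin d → ℝ) × (Fin ℓ → ℝ)) : Fin m → ℝ :=
  (Matrix.of F)ᵀ *ᵥ vecH σs ξ z

/-- The pair `(Fᵀ vec(H_Z), ξᵀ x_{ℓ+1})`, restricted in its first component to the `k` hidden
coordinates selected by `c`. -/
def jointVector {d ℓ m k : ℕ} (σs : ℝ → ℝ) (c : Fin k ↪ Fin m)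
    (F : Fin (d + 1) × Fin d → Fin m → ℝ) (ξ : Fin d → ℝ)
    (z : (Fin (ℓ + 1) → Fin d → ℝ) × (Fin ℓ → ℝ)) : EuclideanSpace ℝ (Fin k ⊕ Unit) :=
  WithLp.toLp 2 (Sum.elim (fun i => hidden σs F ξ z (c i)) (fun _ => ξ ⬝ᵥ query z))

end

end ICL

/-! ### Gaussian vectors: linear images and orthogonal splitting -/

section GaussianLaws

open Complex

/-! The matrix `H_Z` has rank one, `H_Z = q rᵀ`, with `q = x_{ℓ+1}` the query and `r` the context
row. Hence `f_aᵀ vec(H_Z) = g_a · q`, where `g_a` is the contraction of the column `f_a` with `r`,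
and the vector under study is the image of `q ∼ N(0, I_d / d)` under the directions `g_1, …, g_k,
ξ`. These directions are independent of `q`, so given them the vector is exactly Gaussian, with
covariance the Gram matrix of the directions divided by `d`. It therefore suffices that this Gram
matrix converges in probability to a constant matrix (`tendstoInDistribution_of_gram`). The limit is
the identity, which is the witness for `Σ`.

Given `r` and `ξ`, each `g_a` is a Gaussian vector with variance `R = |r|² / tr Cov(vec(H_Z))` per
coordinate. By the fourth moments of chi-square and Gaussian variables, `|g_a|² / d - R` and `ξ ·
g_a / d` have fourth moments `O(d⁻²)` once `R` and `|ξ|² / d` are truncated at `2`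
(`exists_lintegral_gramDefect_le`). The off-diagonal entries follow by polarization. The rate `d⁻²`
is summable along a strictly increasing sequence of dimensions, so Borel–Cantelli gives the
statement for almost every `(ξ_d, F_d)` with no assumption on the dependence across `d`.

It remains to see that `R → 1` in probability. Since `q` is centered, independent of `r`, and `E|q|²
= 1`, the trace is `E|r|²`. So `|r|² / d`, for task vectors with `|ξ|² / d → 1`, and `E|r|² / d`
must have the same positive limit. Splitting every `x_i` along `ξ` and orthogonally to `ξ` turns
`|r|²` into averages of i.i.d. functions of `(ξ · x_i, ε_i)` (`map_rowOfContext_sq`), and a weak law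
of large numbers gives the limit `rowLimit` (`tendstoInProb_rowOfContext_sq`).

The delicate point is the limit of `E|r|² / d` (`tendsto_trace_div`), since `σ_*` is only measurable
and finite second moments of `H_Z` are all that is known. They give a finite mean, over `ξ`, of the
fourth moment of a label. The law of `|ξ|² / d` in dimension `d` is dominated by `C √d` times that
in a fixed dimension `d₀` (`exists_lintegral_normSq_le`), so this mean grows at most like `√d`. As
`P(| |ξ|² / d - 1 | ≥ η) = O(d⁻²)`, atypical norms contribute nothing in the limit. -/

theorem measure_ext_of_integral_cexp_dotProduct {ι : Type*} [Fintype ι] {μ ν : Measure (ι → ℝ)}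
    [IsFiniteMeasure μ] [IsFiniteMeasure ν]
    (h : ∀ t : ι → ℝ, ∫ x, cexp ((t ⬝ᵥ x : ℝ) * I) ∂μ = ∫ x, cexp ((t ⬝ᵥ x : ℝ) * I) ∂ν) :
    μ = ν := by
  classical
  refine Measure.ext_of_charFunDual ?_
  ext L
  rw [charFunDual_apply, charFunDual_apply]
  -- A continuous linear functional on `ι → ℝ` is the dot product with its values on the standard
  -- basis, so the dual characteristic function is the one in the hypothesis.
  have hL : ∀ x : ι → ℝ, L x = (fun i => L (Pi.single i 1)) ⬝ᵥ x := by
    intro x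
    conv_lhs => rw [← Finset.univ_sum_single x, map_sum]
    refine Finset.sum_congr rfl fun i _ => ?_
    have : (Pi.single i (x i) : ι → ℝ) = x i • Pi.single i 1 := by
      funext j; simp only [Pi.smul_apply, smul_eq_mul, Pi.single_apply, mul_ite, mul_one, mul_zero]
    rw [this, map_smul, smul_eq_mul, mul_comm]
  have := h fun i => L (Pi.single i 1)
  simp only [← hL] at this
  exact this

/-- The law of a vector of independent `N(0, v)` variables. -/
noncomputable abbrev isoGaussian (ι : Type*) [Fintype ι] (v : ℝ≥0) : Measure (ι → ℝ) :=
  Measure.pi fun _ => gaussianReal 0 v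

variable {ι κ : Type*} [Fintype ι] [Fintype κ]

theorem integral_cexp_gaussianReal (v : ℝ≥0) (t : ℝ) :
    ∫ x, cexp ((t * x : ℝ) * I) ∂(gaussianReal 0 v) = cexp (-((v * t ^ 2 / 2 : ℝ) : ℂ)) := by
  have := charFun_gaussianReal (μ := 0) (v := v) t
  rw [charFun_apply_real] at this
  simp only [ofReal_mul, this]
  congr 1
  push_cast
  ring

theorem integral_cexp_isoGaussian (v : ℝ≥0) (t : ι → ℝ) :
    ∫ x, cexp ((t ⬝ᵥ x : ℝ) * I) ∂(isoGaussian ι v) = cexp (-((v * (t ⬝ᵥ t) / 2 : ℝ) : ℂ)) := by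
  have h : ∀ x : ι → ℝ, cexp ((t ⬝ᵥ x : ℝ) * I) = ∏ i, cexp ((t i * x i : ℝ) * I) := by
    intro x
    rw [← Complex.exp_sum, dotProduct, ofReal_sum, Finset.sum_mul]
  simp_rw [h]
  rw [integral_fintype_prod_eq_prod (f := fun i x => cexp ((t i * x : ℝ) * I))]
  simp_rw [integral_cexp_gaussianReal]
  rw [← Complex.exp_sum]
  congr 1
  rw [dotProduct, Finset.mul_sum, Finset.sum_div, Finset.sum_neg_distrib, ofReal_sum]
  congr 1
  refine Finset.sum_congr rfl fun i _ => ?_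
  rw [sq]

theorem isoGaussian_map_dotProduct (v w : ℝ≥0) (t : ι → ℝ) (hw : (w : ℝ) = v * (t ⬝ᵥ t)) :
    (isoGaussian ι v).map (fun x => t ⬝ᵥ x) = gaussianReal 0 w := by
  have hm : Measurable fun x : ι → ℝ => t ⬝ᵥ x := by unfold dotProduct; fun_prop
  have := Measure.isProbabilityMeasure_map (μ := isoGaussian ι v) hm.aemeasurable
  refine Measure.ext_of_charFun ?_
  ext s
  rw [charFun_apply_real, charFun_gaussianReal, integral_map hm.aemeasurable (by fun_prop)]
  have := integral_cexp_isoGaussian v (s • t)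
  simp only [smul_dotProduct, smul_eq_mul, ofReal_mul] at this
  rw [this, dotProduct_smul, smul_eq_mul]
  congr 1
  have hw' : (w : ℂ) = v * ((t ⬝ᵥ t : ℝ) : ℂ) := by exact_mod_cast hw
  rw [hw']
  push_cast
  ring

theorem isoGaussian_map_smul (v w : ℝ≥0) (c : ℝ) (hw : (w : ℝ) = v * c ^ 2) :
    (isoGaussian ι v).map (fun x => c • x) = isoGaussian ι w := by
  have hm : Measurable fun x : ι → ℝ => c • x := by fun_prop
  have := Measure.isProbabilityMeasure_map (μ := isoGaussian ι v) hm.aemeasurable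
  refine measure_ext_of_integral_cexp_dotProduct fun t => ?_
  have hm2 : Measurable fun x : ι → ℝ => t ⬝ᵥ x := by unfold dotProduct; fun_prop
  rw [integral_map hm.aemeasurable (by fun_prop), integral_cexp_isoGaussian]
  have := integral_cexp_isoGaussian v (c • t)
  simp only [smul_dotProduct, dotProduct_smul, smul_eq_mul] at this ⊢
  rw [this, hw]
  congr 3
  ring

theorem pi_isoGaussian_map_sum_smul (v w : ℝ≥0) (y : κ → ℝ) (hw : (w : ℝ) = v * ∑ k, y k ^ 2) :
    (Measure.pi fun _ : κ => isoGaussian ι v).map (fun X => ∑ k, y k • X k) =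
      isoGaussian ι w := by
  have hm : Measurable fun X : κ → ι → ℝ => ∑ k, y k • X k := by fun_prop
  have := Measure.isProbabilityMeasure_map (μ := Measure.pi fun _ : κ => isoGaussian ι v)
    hm.aemeasurable
  refine measure_ext_of_integral_cexp_dotProduct fun t => ?_
  have hm2 : Measurable fun x : ι → ℝ => t ⬝ᵥ x := by unfold dotProduct; fun_prop
  rw [integral_map hm.aemeasurable (by fun_prop), integral_cexp_isoGaussian]
  have h : ∀ X : κ → ι → ℝ, cexp ((t ⬝ᵥ (∑ k, y k • X k) : ℝ) * I)
      = ∏ k, cexp (((y k • t) ⬝ᵥ X k : ℝ) * I) := by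
    intro X
    rw [← Complex.exp_sum, dotProduct_sum, ofReal_sum, Finset.sum_mul]
    simp [smul_dotProduct, dotProduct_smul]
  simp_rw [h]
  rw [integral_fintype_prod_eq_prod (f := fun k x => cexp (((y k • t) ⬝ᵥ x : ℝ) * I))]
  simp_rw [integral_cexp_isoGaussian]
  rw [← Complex.exp_sum, hw]
  congr 1
  rw [Finset.sum_neg_distrib, ← ofReal_sum]
  congr 2
  simp only [smul_dotProduct, dotProduct_smul, smul_eq_mul]
  rw [Finset.mul_sum, Finset.sum_mul, Finset.sum_div]
  refine Finset.sum_congr rfl fun i _ => ?_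
  ring

/-- An isotropic Gaussian vector is the sum of an independent component along `ξ` and of the
projection of an independent copy onto the complement of `ξ`. -/
theorem isoGaussian_eq_map_split (v w : ℝ≥0) (ξ : ι → ℝ) (hξ : ξ ⬝ᵥ ξ ≠ 0)
    (hw : (w : ℝ) = v * (ξ ⬝ᵥ ξ)) :
    ((gaussianReal 0 w).prod (isoGaussian ι v)).map
      (fun p => (p.1 / (ξ ⬝ᵥ ξ)) • ξ + (p.2 - ((ξ ⬝ᵥ p.2) / (ξ ⬝ᵥ ξ)) • ξ)) =
      isoGaussian ι v := by
  have hm1 : Measurable fun p : ℝ × (ι → ℝ) => ξ ⬝ᵥ p.2 := by unfold dotProduct; fun_prop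
  have hm : Measurable fun p : ℝ × (ι → ℝ) =>
      (p.1 / (ξ ⬝ᵥ ξ)) • ξ + (p.2 - ((ξ ⬝ᵥ p.2) / (ξ ⬝ᵥ ξ)) • ξ) := by fun_prop
  have := Measure.isProbabilityMeasure_map (μ := (gaussianReal 0 w).prod (isoGaussian ι v))
    hm.aemeasurable
  refine measure_ext_of_integral_cexp_dotProduct fun t => ?_
  have hm2 : Measurable fun x : ι → ℝ => t ⬝ᵥ x := by unfold dotProduct; fun_prop
  rw [integral_map hm.aemeasurable (by fun_prop), integral_cexp_isoGaussian]
  have h : ∀ p : ℝ × (ι → ℝ),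
      cexp ((t ⬝ᵥ ((p.1 / (ξ ⬝ᵥ ξ)) • ξ + (p.2 - ((ξ ⬝ᵥ p.2) / (ξ ⬝ᵥ ξ)) • ξ)) : ℝ) * I) =
      cexp (((t ⬝ᵥ ξ / (ξ ⬝ᵥ ξ)) * p.1 : ℝ) * I) *
        cexp (((t - (t ⬝ᵥ ξ / (ξ ⬝ᵥ ξ)) • ξ) ⬝ᵥ p.2 : ℝ) * I) := by
    intro p
    rw [← Complex.exp_add, ← add_mul, ← ofReal_add]
    congr 3
    simp only [dotProduct_add, dotProduct_sub, sub_dotProduct, smul_dotProduct, dotProduct_smul,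
      smul_eq_mul]
    ring
  simp_rw [h]
  rw [integral_prod_mul (fun u : ℝ => cexp (((t ⬝ᵥ ξ / (ξ ⬝ᵥ ξ)) * u : ℝ) * I))
    (fun x : ι → ℝ => cexp (((t - (t ⬝ᵥ ξ / (ξ ⬝ᵥ ξ)) • ξ) ⬝ᵥ x : ℝ) * I)),
    integral_cexp_gaussianReal, integral_cexp_isoGaussian, ← Complex.exp_add, ← neg_add,
    ← ofReal_add, hw]
  -- Pythagoras: the two exponents are the squared lengths of the components of `t` along `ξ` and
  -- orthogonal to `ξ`, times `v / 2`.
  congr 3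
  simp only [dotProduct_sub, sub_dotProduct, smul_dotProduct, dotProduct_smul,
      smul_eq_mul, dotProduct_comm ξ t]
  field_simp
  ring

/-- Contracting a Gaussian weight array with fixed vectors `r` and `t` gives an isotropic Gaussian
vector. -/
theorem pi_pi_gaussian_map_contract {m : Type*} [Fintype m] (v w : ℝ≥0) (r : κ → ℝ) (t : m → ℝ)
    (hw : (w : ℝ) = v * ((t ⬝ᵥ t) * (r ⬝ᵥ r))) :
    (Measure.pi fun _ : κ × ι => isoGaussian m v).map
      (fun F i => ∑ j, r j * (t ⬝ᵥ F (j, i))) = isoGaussian ι w := by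
  have hm : Measurable fun (F : κ × ι → m → ℝ) (i : ι) => ∑ j, r j * (t ⬝ᵥ F (j, i)) := by
    unfold dotProduct; fun_prop
  have := Measure.isProbabilityMeasure_map (μ := Measure.pi fun _ : κ × ι => isoGaussian m v)
    hm.aemeasurable
  refine measure_ext_of_integral_cexp_dotProduct fun s => ?_
  have hm2 : Measurable fun x : ι → ℝ => s ⬝ᵥ x := by unfold dotProduct; fun_prop
  rw [integral_map hm.aemeasurable (by fun_prop), integral_cexp_isoGaussian]
  have h : ∀ F : κ × ι → m → ℝ, cexp ((s ⬝ᵥ (fun i => ∑ j, r j * (t ⬝ᵥ F (j, i))) : ℝ) * I)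
      = ∏ p : κ × ι, cexp ((((r p.1 * s p.2) • t) ⬝ᵥ F p : ℝ) * I) := by
    intro F
    rw [← Complex.exp_sum, ← Finset.sum_mul, ← ofReal_sum, Fintype.sum_prod_type_right]
    congr 3
    rw [dotProduct]
    refine Finset.sum_congr rfl fun i _ => ?_
    rw [Finset.mul_sum]
    refine Finset.sum_congr rfl fun j _ => ?_
    rw [smul_dotProduct, smul_eq_mul]
    ring
  simp_rw [h]
  rw [integral_fintype_prod_eq_prod
    (f := fun (p : κ × ι) x => cexp ((((r p.1 * s p.2) • t) ⬝ᵥ x : ℝ) * I))]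
  simp_rw [integral_cexp_isoGaussian]
  rw [← Complex.exp_sum, hw, Finset.sum_neg_distrib, ← ofReal_sum]
  congr 3
  rw [← Finset.sum_div, Fintype.sum_prod_type]
  simp only [smul_dotProduct, dotProduct_smul, smul_eq_mul]
  congr 1
  have : ∑ x, ∑ x_1, (v : ℝ) * (r x * s x_1 * (r x * s x_1 * t ⬝ᵥ t)) =
      v * (t ⬝ᵥ t) * ((∑ x, r x * r x) * ∑ x, s x * s x) := by
    rw [Finset.sum_mul_sum, Finset.mul_sum]
    refine Finset.sum_congr rfl fun i _ => ?_
    rw [Finset.mul_sum]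
    refine Finset.sum_congr rfl fun j _ => ?_
    ring
  rw [this, dotProduct, dotProduct, dotProduct]
  ring

end GaussianLaws

/-! ### Moments of i.i.d. sums and of Gaussian variables -/

section Moments

variable {α : Type*} [MeasurableSpace α] {μ : Measure α} [IsProbabilityMeasure μ] {f : α → ℝ}

theorem integrable_pow_of_integrable_pow_four (hf : AEStronglyMeasurable f μ)
    (h4 : Integrable (fun x => f x ^ 4) μ) {i : ℕ} (hi : i ≤ 4) :
    Integrable (fun x => f x ^ i) μ := by
  refine ((integrable_const (1 : ℝ)).add h4).mono' (hf.pow i) (ae_of_all _ fun x => ?_)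
  have h0 : 0 ≤ |f x| := abs_nonneg _
  have hx : f x ^ 4 = |f x| ^ 4 := by rw [← abs_pow, abs_of_nonneg (by positivity)]
  simp only [Pi.add_apply, Real.norm_eq_abs, abs_pow]
  rw [hx]
  rcases le_total |f x| 1 with h | h
  · have := pow_le_one₀ h0 h (n := i)
    have := pow_nonneg h0 4
    linarith
  · have := pow_le_pow_right₀ h hi
    linarith

/-- First and second moments of a sum of i.i.d. variables. -/
theorem moments_two_sum_pi (hf : Measurable f) (h2 : Integrable (fun x => f x ^ 2) μ) (n : ℕ) :
    Integrable (fun x : Fin n → α => (∑ i, f (x i)) ^ 2) (Measure.pi fun _ => μ) ∧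
    ∫ x : Fin n → α, ∑ i, f (x i) ∂(Measure.pi fun _ => μ) = n * ∫ x, f x ∂μ ∧
    ∫ x : Fin n → α, (∑ i, f (x i)) ^ 2 ∂(Measure.pi fun _ => μ) =
      n * ∫ x, f x ^ 2 ∂μ + n * (n - 1) * (∫ x, f x ∂μ) ^ 2 := by
  have i1 : Integrable f μ := by
    have hL : MemLp f 2 μ := (memLp_two_iff_integrable_sq hf.aestronglyMeasurable).2 h2
    exact hL.integrable (by norm_num)
  induction n with
  | zero => simp
  | succ n ih =>
    obtain ⟨ih1, ih2, ih3⟩ := ih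
    set π := (Measure.pi fun _ : Fin n => μ)
    set S : (Fin n → α) → ℝ := fun x => ∑ i, f (x i) with hS
    have hSm : Measurable S := by fun_prop
    have s1 : Integrable S π := by
      have hL : MemLp S 2 π := (memLp_two_iff_integrable_sq hSm.aestronglyMeasurable).2 ih1
      exact hL.integrable (by norm_num)
    have hmp : MeasurePreserving
        (MeasurableEquiv.piFinSuccAbove (fun _ : Fin (n + 1) => α) 0).symm (μ.prod π) _ :=
      (measurePreserving_piFinSuccAbove (fun _ : Fin (n + 1) => μ) 0).symm
    have key : ∀ p : α × (Fin n → α),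
        ∑ i, f ((MeasurableEquiv.piFinSuccAbove (fun _ : Fin (n + 1) => α) 0).symm p i) =
          f p.1 + S p.2 := by
      intro p
      rw [Fin.sum_univ_succ]
      simp [hS, MeasurableEquiv.piFinSuccAbove]
    have e : ∀ p : α × (Fin n → α), (f p.1 + S p.2) ^ 2 =
        f p.1 ^ 2 * 1 + 2 * (f p.1 * S p.2) + 1 * S p.2 ^ 2 := fun p => by ring
    have hc : Integrable (fun _ : α => (1 : ℝ)) μ := integrable_const _
    have hc' : Integrable (fun _ : Fin n → α => (1 : ℝ)) π := integrable_const _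
    have a1 := h2.mul_prod hc'
    have a2 := (i1.mul_prod s1).const_mul 2
    have a3 : Integrable (fun p : α × (Fin n → α) => 1 * S p.2 ^ 2) (μ.prod π) := hc.mul_prod ih1
    have a12 : Integrable (fun p : α × (Fin n → α) => f p.1 ^ 2 * 1 + 2 * (f p.1 * S p.2))
        (μ.prod π) := a1.add a2
    refine ⟨?_, ?_, ?_⟩
    · rw [← hmp.integrable_comp_emb (MeasurableEquiv.measurableEmbedding _)]
      simp only [Function.comp_def, key, e]
      exact a12.add a3
    · rw [← hmp.integral_comp (MeasurableEquiv.measurableEmbedding _)]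
      simp only [key]
      have b1 := i1.mul_prod hc'
      have b2 := hc.mul_prod s1
      simp only [mul_one, one_mul] at b1 b2
      rw [integral_add b1 b2, integral_fun_fst, integral_fun_snd, ih2]
      simp
      ring
    · rw [← hmp.integral_comp (MeasurableEquiv.measurableEmbedding _)]
      simp only [key, e]
      rw [integral_add a12 a3, integral_add a1 a2, integral_const_mul,
        integral_prod_mul (fun a => f a ^ 2) (fun _ => (1 : ℝ)), integral_prod_mul f S,
        integral_prod_mul (fun _ => (1 : ℝ)) (fun x => S x ^ 2), ih2, ih3]
      simp
      ring

/-- Fourth moment of a sum of centered i.i.d. variables. -/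
theorem moment_four_sum_pi_le (hf : Measurable f) (h4 : Integrable (fun x => f x ^ 4) μ)
    (h0 : ∫ x, f x ∂μ = 0) (n : ℕ) :
    Integrable (fun x : Fin n → α => (∑ i, f (x i)) ^ 4) (Measure.pi fun _ => μ) ∧
    ∫ x : Fin n → α, (∑ i, f (x i)) ^ 4 ∂(Measure.pi fun _ => μ) ≤
      3 * n ^ 2 * ∫ x, f x ^ 4 ∂μ := by
  have hi := fun i hi => integrable_pow_of_integrable_pow_four hf.aestronglyMeasurable h4 (i := i) hi
  have i1 : Integrable f μ := by simpa using hi 1 (by norm_num)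
  have i2 := hi 2 (by norm_num)
  have i3 := hi 3 (by norm_num)
  -- This is the nonnegativity of the variance of `f ^ 2`.
  have hK : (∫ x, f x ^ 2 ∂μ) ^ 2 ≤ ∫ x, f x ^ 4 ∂μ := by
    have : 0 ≤ ∫ x, (f x ^ 2 - ∫ x, f x ^ 2 ∂μ) ^ 2 ∂μ := integral_nonneg fun x => sq_nonneg _
    have e : ∀ x, (f x ^ 2 - ∫ x, f x ^ 2 ∂μ) ^ 2 =
        f x ^ 4 - (2 * ∫ x, f x ^ 2 ∂μ) * f x ^ 2 + (∫ x, f x ^ 2 ∂μ) ^ 2 := fun x => by ring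
    simp only [e] at this
    have h42 : Integrable (fun x => f x ^ 4 - (2 * ∫ x, f x ^ 2 ∂μ) * f x ^ 2) μ :=
      h4.sub (i2.const_mul _)
    rw [integral_add h42 (integrable_const _),
      integral_sub h4 (i2.const_mul _), integral_const_mul] at this
    simp at this
    nlinarith
  induction n with
  | zero => simp
  | succ n ih =>
    obtain ⟨ih1, ih2⟩ := ih
    obtain ⟨-, m1, m2⟩ := moments_two_sum_pi hf i2 n
    set π := (Measure.pi fun _ : Fin n => μ)
    set S : (Fin n → α) → ℝ := fun x => ∑ i, f (x i) with hS
    have hSm : Measurable S := by fun_prop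
    have hs := fun i hi =>
      integrable_pow_of_integrable_pow_four hSm.aestronglyMeasurable ih1 (i := i) hi
    have s1 : Integrable S π := by simpa using hs 1 (by norm_num)
    have s2 := hs 2 (by norm_num)
    have s3 := hs 3 (by norm_num)
    have hmp : MeasurePreserving
        (MeasurableEquiv.piFinSuccAbove (fun _ : Fin (n + 1) => α) 0).symm (μ.prod π) _ :=
      (measurePreserving_piFinSuccAbove (fun _ : Fin (n + 1) => μ) 0).symm
    have key : ∀ p : α × (Fin n → α),
        ∑ i, f ((MeasurableEquiv.piFinSuccAbove (fun _ : Fin (n + 1) => α) 0).symm p i) =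
          f p.1 + S p.2 := by
      intro p
      rw [Fin.sum_univ_succ]
      simp [hS, MeasurableEquiv.piFinSuccAbove]
    have e : ∀ p : α × (Fin n → α), (f p.1 + S p.2) ^ 4 =
        f p.1 ^ 4 * 1 + 4 * (f p.1 ^ 3 * S p.2) + 6 * (f p.1 ^ 2 * S p.2 ^ 2) +
          4 * (f p.1 * S p.2 ^ 3) + 1 * S p.2 ^ 4 := fun p => by ring
    have hc : Integrable (fun _ : α => (1 : ℝ)) μ := integrable_const _
    have hc' : Integrable (fun _ : Fin n → α => (1 : ℝ)) π := integrable_const _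
    have a1 := h4.mul_prod hc'
    have a2 := (i3.mul_prod s1).const_mul 4
    have a3 := (i2.mul_prod s2).const_mul 6
    have a4 := (i1.mul_prod s3).const_mul 4
    have a5 : Integrable (fun p : α × (Fin n → α) => 1 * S p.2 ^ 4) (μ.prod π) := hc.mul_prod ih1
    have a12 : Integrable (fun p : α × (Fin n → α) => f p.1 ^ 4 * 1 + 4 * (f p.1 ^ 3 * S p.2))
        (μ.prod π) := a1.add a2
    have a13 : Integrable (fun p : α × (Fin n → α) => f p.1 ^ 4 * 1 + 4 * (f p.1 ^ 3 * S p.2) +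
        6 * (f p.1 ^ 2 * S p.2 ^ 2)) (μ.prod π) := a12.add a3
    have a14 : Integrable (fun p : α × (Fin n → α) => f p.1 ^ 4 * 1 + 4 * (f p.1 ^ 3 * S p.2) +
        6 * (f p.1 ^ 2 * S p.2 ^ 2) + 4 * (f p.1 * S p.2 ^ 3)) (μ.prod π) := a13.add a4
    refine ⟨?_, ?_⟩
    · rw [← hmp.integrable_comp_emb (MeasurableEquiv.measurableEmbedding _)]
      simp only [Function.comp_def, key, e]
      exact a14.add a5
    · rw [← hmp.integral_comp (MeasurableEquiv.measurableEmbedding _)]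
      simp only [key, e]
      rw [integral_add a14 a5, integral_add a13 a4, integral_add a12 a3, integral_add a1 a2,
        integral_const_mul, integral_const_mul, integral_const_mul,
        integral_prod_mul (fun a => f a ^ 4) (fun _ => (1 : ℝ)),
        integral_prod_mul (fun a => f a ^ 3) S,
        integral_prod_mul (fun a => f a ^ 2) (fun x => S x ^ 2),
        integral_prod_mul f (fun x => S x ^ 3),
        integral_prod_mul (fun _ => (1 : ℝ)) (fun x => S x ^ 4), m1, m2, h0]
      have hn : (0 : ℝ) ≤ n := Nat.cast_nonneg n
      simp
      have hpos : 0 ≤ ∫ x, f x ^ 4 ∂μ := integral_nonneg fun x => by positivity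
      -- With `K = E f⁴`, centering removes the odd cross terms, and the induction closes because `K
      -- + 6 n (E f²)² + 3 n² K ≤ 3 (n + 1)² K`; this is where the constant `3` comes from.
      nlinarith [mul_le_mul_of_nonneg_left hK hn]

theorem integrable_pow_gaussianReal (v : ℝ≥0) (i : ℕ) :
    Integrable (fun x : ℝ => x ^ i) (gaussianReal 0 v) := by
  have h := (memLp_id_gaussianReal (μ := 0) (v := v) (i : ℝ≥0)).integrable_norm_pow'
  refine h.mono' (by fun_prop) (ae_of_all _ fun x => ?_)
  simp

/-- Reduces moments to unit variance, so that the constants in the bounds below do not depend on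
`v`. -/
theorem integral_comp_gaussianReal_scale (v : ℝ≥0) (f : ℝ → ℝ) (hf : Measurable f) :
    ∫ x, f x ∂(gaussianReal 0 v) = ∫ x, f (Real.sqrt v * x) ∂(gaussianReal 0 1) := by
  have h := gaussianReal_map_const_mul (μ := 0) (v := 1) (Real.sqrt v)
  have hv : NNReal.mk (Real.sqrt v ^ 2) (sq_nonneg _) * 1 = v := by
    ext; simp
  rw [hv, mul_zero] at h
  rw [← h, integral_map (by fun_prop) hf.aestronglyMeasurable]

/-- The fourth moment of a chi-square deviation is of the order of the square of the dimension. -/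
theorem exists_moment_four_chi_sq_le : ∃ C : ℝ, 0 ≤ C ∧ ∀ (n : ℕ) (v : ℝ≥0),
    ∫⁻ x : Fin n → ℝ, ENNReal.ofReal ((x ⬝ᵥ x - n * v) ^ 4) ∂(isoGaussian (Fin n) v) ≤
      ENNReal.ofReal (C * n ^ 2 * v ^ 4) := by
  refine ⟨3 * ∫ x, (x ^ 2 - 1) ^ 4 ∂(gaussianReal 0 1), ?_, fun n v => ?_⟩
  · exact mul_nonneg (by norm_num) (integral_nonneg fun x => by positivity)
  have i2 := integrable_pow_gaussianReal v 2
  have h4 : Integrable (fun x : ℝ => (x ^ 2 - v) ^ 4) (gaussianReal 0 v) := by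
    have e : ∀ x : ℝ, (x ^ 2 - v) ^ 4 = x ^ 8 - 4 * v * x ^ 6 + 6 * v ^ 2 * x ^ 4
        - 4 * v ^ 3 * x ^ 2 + (v : ℝ) ^ 4 := fun x => by ring
    simp only [e]
    exact (((((integrable_pow_gaussianReal v 8)).sub
      ((integrable_pow_gaussianReal v 6).const_mul _)).add
      ((integrable_pow_gaussianReal v 4).const_mul _)).sub (i2.const_mul _)).add
      (integrable_const _)
  have h0 : ∫ x : ℝ, (x ^ 2 - v) ∂(gaussianReal 0 v) = 0 := by
    rw [integral_sub i2 (integrable_const _)]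
    have := variance_fun_id_gaussianReal (μ := 0) (v := v)
    rw [variance_of_integral_eq_zero (by fun_prop) (by simp)] at this
    simp [this]
  obtain ⟨hi, hle⟩ := moment_four_sum_pi_le (μ := gaussianReal 0 v) (by fun_prop) h4 h0 n
  have e : ∀ x : Fin n → ℝ, (x ⬝ᵥ x - n * v) = ∑ i, (x i ^ 2 - (v : ℝ)) := by
    intro x
    simp [dotProduct, sq]
  simp only [e]
  rw [← ofReal_integral_eq_lintegral_ofReal hi (ae_of_all _ fun x => by positivity)]
  refine ENNReal.ofReal_le_ofReal (hle.trans (le_of_eq ?_))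
  rw [integral_comp_gaussianReal_scale v _ (by fun_prop)]
  have e2 : ∀ x : ℝ, ((Real.sqrt v * x) ^ 2 - v) ^ 4 = (v : ℝ) ^ 4 * (x ^ 2 - 1) ^ 4 := by
    intro x
    rw [mul_pow, Real.sq_sqrt v.coe_nonneg]
    ring
  simp only [e2]
  rw [integral_const_mul]
  ring

theorem exists_moment_four_gaussian_le : ∃ C : ℝ, 0 ≤ C ∧ ∀ (w : ℝ≥0),
    ∫⁻ x, ENNReal.ofReal (x ^ 4) ∂(gaussianReal 0 w) = ENNReal.ofReal (C * w ^ 2) := by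
  refine ⟨∫ x, x ^ 4 ∂(gaussianReal 0 1), integral_nonneg fun x => by positivity, fun w => ?_⟩
  rw [← ofReal_integral_eq_lintegral_ofReal (integrable_pow_gaussianReal w 4)
    (ae_of_all _ fun x => by positivity), integral_comp_gaussianReal_scale w _ (by fun_prop)]
  simp only [mul_pow]
  rw [integral_const_mul]
  congr 1
  have : Real.sqrt w ^ 4 = (Real.sqrt w ^ 2) ^ 2 := by ring
  rw [this, Real.sq_sqrt w.coe_nonneg]
  ring

end Moments

/-! ### Convergence in probability on varying spaces, and a weak law of large numbers -/

section InProbability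

variable {Ω : ℕ → Type*} [∀ n, MeasurableSpace (Ω n)] {μ : ∀ n, Measure (Ω n)}

/-- Convergence in probability to a constant of random variables on varying spaces. -/
def TendstoInProb {E : Type*} [TopologicalSpace E] (μ : ∀ n, Measure (Ω n)) (X : ∀ n, Ω n → E)
    (c : E) : Prop :=
  ∀ U ∈ 𝓝 c, Tendsto (fun n => μ n {ω | X n ω ∉ U}) atTop (𝓝 0)

namespace TendstoInProb

variable {E E' : Type*} [TopologicalSpace E] [TopologicalSpace E'] {X : ∀ n, Ω n → E} {c : E}
  {Y : ∀ n, Ω n → E'} {c' : E'}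

theorem of_tendsto {a : ℕ → E} (h : Tendsto a atTop (𝓝 c)) :
    TendstoInProb μ (fun n _ => a n) c := by
  intro U hU
  refine tendsto_const_nhds.congr' ?_
  filter_upwards [h hU] with n hn
  simp [show a n ∈ U from hn]

theorem prodMk (hX : TendstoInProb μ X c) (hY : TendstoInProb μ Y c') :
    TendstoInProb μ (fun n ω => (X n ω, Y n ω)) (c, c') := by
  intro U hU
  rw [nhds_prod_eq, Filter.mem_prod_iff] at hU
  obtain ⟨s, hs, t, ht, hst⟩ := hU
  have := (hX s hs).add (hY t ht)
  rw [add_zero] at this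
  refine tendsto_of_tendsto_of_tendsto_of_le_of_le tendsto_const_nhds this (fun _ => zero_le)
    fun n => (measure_mono ?_).trans (measure_union_le _ _)
  intro ω hω
  by_contra h
  simp only [Set.mem_union, Set.mem_ofPred_eq, not_or, not_not] at h
  exact hω (hst ⟨h.1, h.2⟩)

theorem pi {ι : Type*} [Finite ι] {X : ι → ∀ n, Ω n → E} {c : ι → E}
    (h : ∀ i, TendstoInProb μ (X i) (c i)) :
    TendstoInProb μ (fun n ω i => X i n ω) c := by
  have := Fintype.ofFinite ι
  intro U hU
  rw [nhds_pi, Filter.mem_pi'] at hU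
  obtain ⟨I, t, ht, hI⟩ := hU
  have := tendsto_finsetSum I fun i _ => h i (t i) (ht i)
  rw [Finset.sum_const_zero] at this
  refine tendsto_of_tendsto_of_tendsto_of_le_of_le tendsto_const_nhds this (fun _ => zero_le)
    fun n => (measure_mono ?_).trans (measure_biUnion_finset_le _ _)
  intro ω hω
  by_contra hc
  simp only [Set.mem_iUnion, not_exists, Set.mem_ofPred_eq, not_not] at hc
  exact hω (hI fun i hi => hc i hi)

theorem comp (hX : TendstoInProb μ X c) {g : E → E'} (hg : ContinuousAt g c) :
    TendstoInProb μ (fun n ω => g (X n ω)) (g c) :=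
  fun _ hU => hX _ (hg hU)

theorem congr (hX : TendstoInProb μ X c) {Z : ∀ n, Ω n → E}
    (h : Tendsto (fun n => μ n {ω | X n ω ≠ Z n ω}) atTop (𝓝 0)) : TendstoInProb μ Z c := by
  intro U hU
  have := (hX U hU).add h
  rw [add_zero] at this
  refine tendsto_of_tendsto_of_tendsto_of_le_of_le tendsto_const_nhds this (fun _ => zero_le)
    fun n => (measure_mono ?_).trans (measure_union_le _ _)
  intro ω hω
  by_cases hx : X n ω = Z n ω
  · exact Or.inl (by simpa [hx] using hω)
  · exact Or.inr hx

/-- Pulling convergence in probability back along maps with the prescribed laws. -/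
theorem comp_map {Ω' : ℕ → Type*} [∀ n, MeasurableSpace (Ω' n)] {ν : ∀ n, Measure (Ω' n)}
    {π : ∀ n, Ω' n → Ω n} (hπ : ∀ n, AEMeasurable (π n) (ν n)) (hν : ∀ n, (ν n).map (π n) = μ n)
    (hX : TendstoInProb μ X c) : TendstoInProb ν (fun n ω => X n (π n ω)) c := by
  intro U hU
  refine tendsto_of_tendsto_of_tendsto_of_le_of_le tendsto_const_nhds (hX U hU)
    (fun _ => zero_le) fun n => ?_
  rw [← hν n]
  exact le_trans le_rfl (Measure.le_map_apply (hπ n) _)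

/-- Markov's inequality applied to an even power of the deviation from `c`. -/
theorem of_lintegral_pow {X : ∀ n, Ω n → ℝ} {c : ℝ} (k : ℕ) (hk : Even k)
    (hX : ∀ n, AEMeasurable (X n) (μ n))
    (h : Tendsto (fun n => ∫⁻ ω, ENNReal.ofReal ((X n ω - c) ^ k) ∂(μ n)) atTop (𝓝 0)) :
    TendstoInProb μ X c := by
  intro U hU
  obtain ⟨ε, hε, hU⟩ := Metric.mem_nhds_iff.1 hU
  have he : ENNReal.ofReal (ε ^ k) ≠ 0 := by simpa using pow_pos hε k
  have := ENNReal.Tendsto.div_const h (b := ENNReal.ofReal (ε ^ k)) (Or.inr he)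
  rw [ENNReal.zero_div] at this
  refine tendsto_of_tendsto_of_tendsto_of_le_of_le tendsto_const_nhds this
    (fun _ => zero_le) fun n => ?_
  refine le_trans (measure_mono ?_) (meas_ge_le_lintegral_div
    (((hX n).sub_const c).pow_const k).ennreal_ofReal he ENNReal.ofReal_ne_top)
  intro ω hω
  have h1 : ε ≤ |X n ω - c| := by
    by_contra hlt
    exact hω (hU (by simpa [Real.dist_eq] using hlt))
  refine ENNReal.ofReal_le_ofReal ?_
  rw [← hk.pow_abs (X n ω - c)]
  exact pow_le_pow_left₀ hε.le h1 k

/-- Bounded convergence for convergence in probability to a constant. -/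
theorem tendsto_integral [∀ n, IsProbabilityMeasure (μ n)] (hX : TendstoInProb μ X c)
    {F : Type*} [NormedAddCommGroup F] [NormedSpace ℝ F] [CompleteSpace F] {g : E → F}
    (hg : ContinuousAt g c) {M : ℝ} (hM : ∀ x, ‖g x‖ ≤ M)
    (hm : ∀ n, AEStronglyMeasurable (fun ω => g (X n ω)) (μ n)) :
    Tendsto (fun n => ∫ ω, g (X n ω) ∂(μ n)) atTop (𝓝 (g c)) := by
  have hint : ∀ n, Integrable (fun ω => g (X n ω)) (μ n) := fun n =>
    (integrable_const M).mono' (hm n) (ae_of_all _ fun ω => hM _)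
  rw [Metric.tendsto_atTop]
  intro ε hε
  have hM0 : 0 ≤ M := (norm_nonneg _).trans (hM c)
  have hU : g ⁻¹' Metric.ball (g c) (ε / 2) ∈ 𝓝 c := hg (Metric.ball_mem_nhds _ (by positivity))
  have h0 := (ENNReal.tendsto_toReal ENNReal.zero_ne_top).comp (hX _ hU)
  have h1 := h0.const_mul (2 * M)
  simp only [ENNReal.toReal_zero, mul_zero] at h1
  obtain ⟨N, hN⟩ := eventually_atTop.1 (h1.eventually_lt_const (half_pos hε))
  refine ⟨N, fun n hn => ?_⟩
  -- The bad event need not be measurable, since `E` carries no σ-algebra; it is enlarged to a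
  -- measurable set of the same measure.
  set B := toMeasurable (μ n) {ω | X n ω ∉ g ⁻¹' Metric.ball (g c) (ε / 2)}
  have hB : MeasurableSet B := measurableSet_toMeasurable _ _
  have hBm : (μ n).real B * (2 * M) < ε / 2 := by
    have := hN n hn
    simp only [Function.comp_apply] at this
    rw [Measure.real, measure_toMeasurable, mul_comm]
    exact this
  rw [dist_eq_norm]
  have e : ∫ ω, g (X n ω) ∂(μ n) - g c = ∫ ω, (g (X n ω) - g c) ∂(μ n) := by
    rw [integral_sub (hint n) (integrable_const _)]
    simp
  rw [e]
  have hbound : ∀ ω, ‖g (X n ω) - g c‖ ≤ ε / 2 + B.indicator (fun _ => 2 * M) ω := by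
    intro ω
    by_cases hω : ω ∈ B
    · rw [Set.indicator_of_mem hω]
      have := norm_sub_le (g (X n ω)) (g c)
      have := hM (X n ω)
      have := hM c
      linarith
    · rw [Set.indicator_of_notMem hω, add_zero]
      have : ω ∉ {ω | X n ω ∉ g ⁻¹' Metric.ball (g c) (ε / 2)} :=
        fun h => hω (subset_toMeasurable _ _ h)
      simp only [Set.mem_ofPred_eq, not_not, Set.mem_preimage, Metric.mem_ball,
        dist_eq_norm] at this
      exact this.le
  have hi2 : Integrable (fun ω => ε / 2 + B.indicator (fun _ => 2 * M) ω) (μ n) :=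
    (integrable_const _).add ((integrable_const _).indicator hB)
  calc ‖∫ ω, (g (X n ω) - g c) ∂(μ n)‖
      ≤ ∫ ω, (ε / 2 + B.indicator (fun _ => 2 * M) ω) ∂(μ n) :=
        norm_integral_le_of_norm_le hi2 (ae_of_all _ hbound)
    _ = ε / 2 + (μ n).real B * (2 * M) := by
        rw [integral_add (integrable_const _) ((integrable_const _).indicator hB),
          integral_indicator_const _ hB]
        simp
    _ < ε := by linarith

end TendstoInProb

/-- Weak law of large numbers for triangular arrays. -/
theorem tendstoInProb_average {α : Type*} [MeasurableSpace α] (κ : ℕ → Measure α)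
    [∀ n, IsProbabilityMeasure (κ n)] (ℓ : ℕ → ℕ) {f : α → ℝ} (hf : Measurable f)
    (h2 : ∀ᶠ n in atTop, Integrable (fun x => f x ^ 2) (κ n)) {b : ℝ}
    (hb : Tendsto (fun n => ∫ x, f x ∂(κ n)) atTop (𝓝 b))
    (hv : Tendsto (fun n => (∫ x, f x ^ 2 ∂(κ n)) / ℓ n) atTop (𝓝 0))
    (hℓ : Tendsto (fun n => (ℓ n : ℝ)) atTop atTop) :
    TendstoInProb (fun n => Measure.pi fun _ : Fin (ℓ n) => κ n)
      (fun n x => (1 / (ℓ n : ℝ)) * ∑ i, f (x i)) b := by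
  refine TendstoInProb.of_lintegral_pow 2 even_two
    (fun n => (by fun_prop : Measurable _).aemeasurable) ?_
  -- With `a = E f`, the expression is the expansion of `E (average - b)²`, namely `E f² / ℓ + a² (1
  -- - 1 / ℓ) - 2 b a + b²`.
  have hlim : Tendsto (fun n => ENNReal.ofReal ((∫ x, f x ^ 2 ∂(κ n)) / ℓ n +
      ((∫ x, f x ∂(κ n)) ^ 2 * (1 - 1 / ℓ n) - 2 * b * (∫ x, f x ∂(κ n)) + b ^ 2)))
      atTop (𝓝 0) := by
    have h1 : Tendsto (fun n => 1 / (ℓ n : ℝ)) atTop (𝓝 0) := by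
      simpa only [one_div, Function.comp_def] using tendsto_inv_atTop_zero.comp hℓ
    have := hv.add (((((hb.pow 2).mul (h1.const_sub 1))).sub (hb.const_mul (2 * b))).add_const
      (b ^ 2))
    rw [show (0 : ℝ) + (b ^ 2 * (1 - 0) - 2 * b * b + b ^ 2) = 0 by ring] at this
    simpa [Function.comp_def] using (ENNReal.continuous_ofReal.tendsto _).comp this
  refine hlim.congr' ?_
  filter_upwards [h2, hℓ.eventually_gt_atTop 0] with n hn hl
  obtain ⟨j1, j2, j3⟩ := moments_two_sum_pi hf hn (ℓ n)
  set π := (Measure.pi fun _ : Fin (ℓ n) => κ n)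
  have hSm : Measurable fun x : Fin (ℓ n) → α => ∑ i, f (x i) := by fun_prop
  have s1 : Integrable (fun x : Fin (ℓ n) → α => ∑ i, f (x i)) π :=
    ((memLp_two_iff_integrable_sq hSm.aestronglyMeasurable).2 j1).integrable (by norm_num)
  have e : ∀ x : Fin (ℓ n) → α, (1 / (ℓ n : ℝ) * ∑ i, f (x i) - b) ^ 2 =
      (1 / (ℓ n : ℝ)) ^ 2 * (∑ i, f (x i)) ^ 2 - (2 * b * (1 / (ℓ n : ℝ))) * ∑ i, f (x i)
        + b ^ 2 := fun x => by ring
  have j12 : Integrable (fun x : Fin (ℓ n) → α => (1 / (ℓ n : ℝ)) ^ 2 * (∑ i, f (x i)) ^ 2 -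
      (2 * b * (1 / (ℓ n : ℝ))) * ∑ i, f (x i)) π := (j1.const_mul _).sub (s1.const_mul _)
  have hi : Integrable (fun x : Fin (ℓ n) → α => (1 / (ℓ n : ℝ) * ∑ i, f (x i) - b) ^ 2) π := by
    simp only [e]
    exact j12.add (integrable_const _)
  rw [← ofReal_integral_eq_lintegral_ofReal hi (ae_of_all _ fun x => by positivity)]
  congr 1
  simp only [e]
  rw [integral_add j12 (integrable_const _),
    integral_sub (j1.const_mul _) (s1.const_mul _), integral_const_mul, integral_const_mul, j2, j3]
  simp
  field_simp
  ring

end InProbability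

/-! ### Comparison of the laws of `|ξ|² / d` across dimensions -/

section Radial

theorem isoGaussian_one_eq_withDensity (ι : Type*) [Fintype ι] :
    isoGaussian ι 1 = (volume : Measure (ι → ℝ)).withDensity
      (fun x => ENNReal.ofReal (∏ i, gaussianPDFReal 0 1 (x i))) := by
  refine Measure.pi_eq fun s hs => ?_
  rw [withDensity_apply _ (MeasurableSet.univ_pi hs), volume_pi, Measure.restrict_pi_pi]
  have hint : ∀ i, Integrable (fun x => gaussianPDFReal 0 1 x) (volume.restrict (s i)) :=
    fun i => (integrable_gaussianPDFReal 0 1).restrict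
  rw [← ofReal_integral_eq_lintegral_ofReal
    (Integrable.fintype_prod (f := fun _ x => gaussianPDFReal 0 1 x) hint)
    (ae_of_all _ fun x => Finset.prod_nonneg fun i _ => gaussianPDFReal_nonneg 0 1 _),
    integral_fintype_prod_eq_prod (f := fun _ x => gaussianPDFReal 0 1 x),
    ENNReal.ofReal_prod_of_nonneg fun i _ => integral_nonneg fun x => gaussianPDFReal_nonneg 0 1 _]
  refine Finset.prod_congr rfl fun i _ => ?_
  rw [gaussianReal_apply_eq_integral 0 one_ne_zero]

/-- The unnormalized density of the normalized Euclidean norm of a Gaussian vector. -/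
noncomputable def radialWeight (d : ℕ) (s : ℝ) : ℝ := s ^ (d - 1) * Real.exp (-(d * s ^ 2 / 2))

theorem radialWeight_nonneg (d : ℕ) {s : ℝ} (hs : 0 < s) : 0 ≤ radialWeight d s := by
  unfold radialWeight; positivity

/-- Polar coordinates, with radius `√d * s`. The value of the constant `a` plays no role: it is
recovered later from the total mass. -/
theorem exists_radial_formula {d : ℕ} (hd : 1 ≤ d) :
    ∃ a : ℝ, 0 ≤ a ∧ ∀ B : Set ℝ, MeasurableSet B →
      (isoGaussian (Fin d) 1).real {x | x ⬝ᵥ x / d ∈ B} =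
        a * ∫ s in Set.Ioi (0 : ℝ), radialWeight d s * B.indicator (fun _ => 1) (s ^ 2) := by
  have hd0 : (0 : ℝ) < d := by exact_mod_cast hd
  have : Nonempty (Fin d) := ⟨⟨0, hd⟩⟩
  set V := (volume : Measure (EuclideanSpace ℝ (Fin d))).real (Metric.ball 0 1)
  refine ⟨(√(2 * Real.pi))⁻¹ ^ d * (d * (V * (√d * √d ^ (d - 1)))), by positivity, fun B hB => ?_⟩
  have hm : MeasurableSet {x : Fin d → ℝ | x ⬝ᵥ x / d ∈ B} := by
    have : Measurable fun x : Fin d → ℝ => x ⬝ᵥ x / d := by unfold dotProduct; fun_prop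
    exact this hB
  have hprod : ∀ x : Fin d → ℝ, ∏ i, gaussianPDFReal 0 1 (x i) =
      (√(2 * Real.pi))⁻¹ ^ d * Real.exp (-(x ⬝ᵥ x) / 2) := by
    intro x
    simp only [gaussianPDFReal, NNReal.coe_one, mul_one, sub_zero]
    rw [Finset.prod_mul_distrib, ← Real.exp_sum, ← Finset.sum_div, Finset.sum_neg_distrib]
    simp [dotProduct, sq]
  have hint : Integrable (fun x : Fin d → ℝ => ∏ i, gaussianPDFReal 0 1 (x i)) :=
    Integrable.fintype_prod (f := fun _ x => gaussianPDFReal 0 1 x)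
      fun _ => integrable_gaussianPDFReal 0 1
  have h1 : (isoGaussian (Fin d) 1).real {x | x ⬝ᵥ x / d ∈ B} =
      ∫ x : Fin d → ℝ, (√(2 * Real.pi))⁻¹ ^ d *
        (Real.exp (-(x ⬝ᵥ x) / 2) * B.indicator (fun _ => 1) (x ⬝ᵥ x / d)) := by
    rw [isoGaussian_one_eq_withDensity, Measure.real, withDensity_apply _ hm,
      ← ofReal_integral_eq_lintegral_ofReal hint.restrict
      (ae_of_all _ fun x => Finset.prod_nonneg fun i _ => gaussianPDFReal_nonneg 0 1 _),
      ENNReal.toReal_ofReal (integral_nonneg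
        fun x => Finset.prod_nonneg fun i _ => gaussianPDFReal_nonneg 0 1 _),
      ← integral_indicator hm]
    refine integral_congr_ae (ae_of_all _ fun x => ?_)
    simp only
    by_cases hx : x ⬝ᵥ x / d ∈ B
    · rw [Set.indicator_of_mem (by exact hx), Set.indicator_of_mem hx, hprod]; ring
    · rw [Set.indicator_of_notMem (by exact hx), Set.indicator_of_notMem hx]; ring
  have hnorm : ∀ x : EuclideanSpace ℝ (Fin d), WithLp.ofLp x ⬝ᵥ WithLp.ofLp x = ‖x‖ ^ 2 := by
    intro x
    rw [EuclideanSpace.norm_sq_eq]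
    simp [dotProduct, sq]
  rw [h1, ← (PiLp.volume_preserving_ofLp (Fin d)).integral_comp
    (MeasurableEquiv.toLp 2 (Fin d → ℝ)).symm.measurableEmbedding]
  simp only [hnorm]
  rw [integral_fun_norm_addHaar volume (fun r : ℝ => (√(2 * Real.pi))⁻¹ ^ d *
    (Real.exp (-r ^ 2 / 2) * B.indicator (fun _ => 1) (r ^ 2 / d)))]
  have hs := integral_comp_mul_left_Ioi (fun y : ℝ => y ^ (d - 1) * ((√(2 * Real.pi))⁻¹ ^ d *
    (Real.exp (-y ^ 2 / 2) * B.indicator (fun _ => 1) (y ^ 2 / d)))) 0 (Real.sqrt_pos.2 hd0)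
  rw [mul_zero, smul_eq_mul, eq_inv_mul_iff_mul_eq₀ (Real.sqrt_pos.2 hd0).ne'] at hs
  simp only [smul_eq_mul, finrank_euclideanSpace, Fintype.card_fin, nsmul_eq_mul]
  rw [← hs]
  have e : ∀ s : ℝ, (√d * s) ^ (d - 1) * ((√(2 * Real.pi))⁻¹ ^ d *
      (Real.exp (-(√d * s) ^ 2 / 2) * B.indicator (fun _ => 1) ((√d * s) ^ 2 / d))) =
      (√d ^ (d - 1) * (√(2 * Real.pi))⁻¹ ^ d) *
        (radialWeight d s * B.indicator (fun _ => 1) (s ^ 2)) := by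
    intro s
    rw [mul_pow _ s 2, Real.sq_sqrt hd0.le, mul_div_cancel_left₀ _ hd0.ne', radialWeight,
      neg_div]
    ring
  simp only [e]
  rw [integral_const_mul]
  ring

/-- The weights in dimensions `d` and `d₀` differ by the factor `(s exp (-s² / 2)) ^ (d - d₀)`, and
`s exp (-s² / 2)` is maximal at `s = 1`, with value `exp (-1 / 2)`. -/
theorem radialWeight_le {d₀ d : ℕ} (h0 : 1 ≤ d₀) (h : d₀ ≤ d) {s : ℝ} (hs : 0 < s) :
    radialWeight d s ≤ Real.exp (-((d - d₀ : ℝ) / 2)) * radialWeight d₀ s := by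
  have hb : s * Real.exp (-(s ^ 2 / 2)) ≤ Real.exp (-(1 / 2)) := by
    have h1 : s ≤ Real.exp (s ^ 2 / 2 - 1 / 2) := by
      have := Real.add_one_le_exp (s ^ 2 / 2 - 1 / 2)
      nlinarith [sq_nonneg (s - 1)]
    calc s * Real.exp (-(s ^ 2 / 2))
        ≤ Real.exp (s ^ 2 / 2 - 1 / 2) * Real.exp (-(s ^ 2 / 2)) := by gcongr
      _ = _ := by rw [← Real.exp_add]; congr 1; ring
  have hp := pow_le_pow_left₀ (by positivity) hb (d - d₀)
  have hcast : ((d - d₀ : ℕ) : ℝ) = d - d₀ := by push_cast [h]; ring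
  rw [mul_pow, ← Real.exp_nat_mul, ← Real.exp_nat_mul, hcast] at hp
  calc radialWeight d s = (s ^ (d - d₀) * Real.exp ((d - d₀ : ℝ) * -(s ^ 2 / 2))) *
        radialWeight d₀ s := by
        unfold radialWeight
        rw [show d - 1 = (d - d₀) + (d₀ - 1) by omega, pow_add,
          show -((d : ℝ) * s ^ 2 / 2) = (d - d₀ : ℝ) * -(s ^ 2 / 2) + -(d₀ * s ^ 2 / 2) by ring,
          Real.exp_add]
        ring
    _ ≤ Real.exp ((d - d₀ : ℝ) * -(1 / 2)) * radialWeight d₀ s :=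
        mul_le_mul_of_nonneg_right hp (radialWeight_nonneg _ hs)
    _ = _ := by congr 2; ring

/-- On a window of width `1 / √d` next to its peak the weight loses only a constant factor.
Integrated over the window, this bounds the normalizing integral below by `exp (-d / 2) / √d` up to
a constant. -/
theorem radialWeight_lower {d : ℕ} (hd : 1 ≤ d) {s : ℝ} (h1 : 1 ≤ s) (h2 : s ≤ 1 + 1 / √d) :
    Real.exp (-(3 / 2)) / 2 * Real.exp (-(d / 2)) ≤ radialWeight d s := by
  have hd0 : (1 : ℝ) ≤ d := by exact_mod_cast hd
  have hsq : 1 ≤ √(d : ℝ) := Real.one_le_sqrt.2 hd0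
  have hs0 : 0 < s := by linarith
  obtain ⟨h, rfl⟩ : ∃ h, s = 1 + h := ⟨s - 1, by ring⟩
  have hh0 : 0 ≤ h := by linarith
  have hhd : h * √d ≤ 1 := by
    have : h ≤ 1 / √d := by linarith
    rwa [le_div_iff₀ (by positivity)] at this
  have hh1 : h ≤ 1 := by nlinarith
  have hdh : d * h ^ 2 ≤ 1 := by
    have := Real.sq_sqrt (zero_le_one.trans hd0)
    have : (h * √d) ^ 2 ≤ 1 := by nlinarith [mul_nonneg hh0 (Real.sqrt_nonneg d)]
    rw [mul_pow, Real.sq_sqrt (zero_le_one.trans hd0)] at this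
    linarith
  -- From `log (1 + h) ≥ h / (1 + h) ≥ h - h²`. Multiplied by `d` and combined with `-d (1 + h)² /
  -- 2`, the exponent becomes `-d / 2 - 3 d h² / 2 ≥ -d / 2 - 3 / 2`.
  have hexp : Real.exp (h - h ^ 2) ≤ 1 + h := by
    have h3 := Real.one_sub_inv_le_log_of_pos hs0
    rw [← Real.le_log_iff_exp_le hs0]
    refine le_trans ?_ h3
    rw [le_sub_iff_add_le, ← le_sub_iff_add_le', inv_le_iff_one_le_mul₀ hs0]
    nlinarith [pow_nonneg hh0 3]
  have hpow : Real.exp (d * (h - h ^ 2)) ≤ (1 + h) ^ d := by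
    rw [Real.exp_nat_mul]
    exact pow_le_pow_left₀ (Real.exp_pos _).le hexp d
  -- The weight has exponent `d - 1`; the missing factor `1 + h ≤ 2` costs the `1 / 2` in the bound.
  have h4 : (1 + h) ^ d ≤ 2 * (1 + h) ^ (d - 1) := by
    obtain ⟨k, rfl⟩ : ∃ k, d = k + 1 := ⟨d - 1, by omega⟩
    rw [pow_succ, Nat.add_sub_cancel, mul_comm]
    gcongr
    linarith
  calc Real.exp (-(3 / 2)) / 2 * Real.exp (-(d / 2))
      ≤ Real.exp (d * (h - h ^ 2)) / 2 * Real.exp (-(d * (1 + h) ^ 2 / 2)) := by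
        rw [div_mul_eq_mul_div, div_mul_eq_mul_div, ← Real.exp_add, ← Real.exp_add]
        refine div_le_div_of_nonneg_right (Real.exp_le_exp.2 ?_) zero_le_two
        nlinarith
    _ ≤ (1 + h) ^ (d - 1) * Real.exp (-(d * (1 + h) ^ 2 / 2)) := by
        gcongr
        linarith
    _ = _ := rfl

/-- The law of the normalized squared norm in dimension `d` is dominated by the one in a smaller
dimension, up to a factor of the order of `√d`. -/
theorem exists_lintegral_normSq_le {d₀ : ℕ} (h0 : 1 ≤ d₀) : ∃ C : ℝ, 0 ≤ C ∧
    ∀ d, d₀ ≤ d → ∀ g : ℝ → ENNReal, Measurable g →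
      ∫⁻ x, g (x ⬝ᵥ x / d) ∂(isoGaussian (Fin d) 1) ≤
        ENNReal.ofReal (C * √d) * ∫⁻ x, g (x ⬝ᵥ x / d₀) ∂(isoGaussian (Fin d₀) 1) := by
  have hN : ∀ {d : ℕ}, 1 ≤ d → ∃ a : ℝ, 0 < a ∧
      IntegrableOn (radialWeight d) (Set.Ioi 0) ∧ a * ∫ s in Set.Ioi (0 : ℝ), radialWeight d s = 1 ∧
      ∀ B : Set ℝ, MeasurableSet B → (isoGaussian (Fin d) 1).real {x | x ⬝ᵥ x / d ∈ B} =
        a * ∫ s in Set.Ioi (0 : ℝ), radialWeight d s * B.indicator (fun _ => 1) (s ^ 2) := by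
    intro d hd
    obtain ⟨a, ha, hB⟩ := exists_radial_formula hd
    have h1 := hB Set.univ MeasurableSet.univ
    simp only [Set.mem_univ, Set.indicator_univ, mul_one, Set.ofPred_true,
      probReal_univ] at h1
    have hint : IntegrableOn (radialWeight d) (Set.Ioi 0) := by
      -- A non-integrable weight would have integral `0` by convention, contradicting total mass
      -- `1`.
      by_contra hc
      have : ∫ s in Set.Ioi (0 : ℝ), radialWeight d s = 0 := integral_undef hc
      rw [this, mul_zero] at h1
      exact one_ne_zero h1
    refine ⟨a, lt_of_le_of_ne ha ?_, hint, h1.symm, hB⟩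
    rintro rfl
    simp at h1
  obtain ⟨a₀, ha₀, hi₀, hn₀, hB₀⟩ := hN h0
  set c := Real.exp (-(3 / 2)) / 2 with hc
  have hcpos : 0 < c := by positivity
  refine ⟨Real.exp (d₀ / 2) / c / a₀, by positivity, fun d hd g hg => ?_⟩
  have hd1 : 1 ≤ d := h0.trans hd
  have hdpos : (0 : ℝ) < d := by exact_mod_cast hd1
  obtain ⟨a, ha, hi, hn, hB⟩ := hN hd1
  have hsd : 0 < √(d : ℝ) := Real.sqrt_pos.2 hdpos
  have hlow : c * Real.exp (-(d / 2)) / √d ≤ ∫ s in Set.Ioi (0 : ℝ), radialWeight d s := by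
    have hsub : Set.Ioc (1 : ℝ) (1 + 1 / √d) ⊆ Set.Ioi 0 := fun s hs => by
      have := hs.1
      simp only [Set.mem_Ioi]; linarith
    calc c * Real.exp (-(d / 2)) / √d
        = ∫ s in Set.Ioc (1 : ℝ) (1 + 1 / √d), c * Real.exp (-(d / 2)) := by
          rw [setIntegral_const, measureReal_def, Real.volume_Ioc,
            ENNReal.toReal_ofReal (by simp), smul_eq_mul]
          ring
      _ ≤ ∫ s in Set.Ioc (1 : ℝ) (1 + 1 / √d), radialWeight d s := by
          refine setIntegral_mono_on (integrableOn_const (by simp))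
            (hi.mono_set hsub) measurableSet_Ioc fun s hs => ?_
          exact radialWeight_lower hd1 hs.1.le hs.2
      _ ≤ _ := setIntegral_mono_set hi
          ((ae_restrict_mem measurableSet_Ioi).mono fun s hs => radialWeight_nonneg d hs)
          (ae_of_all _ hsub)
  have ha_le : a ≤ √d * Real.exp (d / 2) / c := by
    have h1 : a * (c * Real.exp (-(d / 2)) / √d) ≤ 1 := by
      rw [← hn]; gcongr
    rw [Real.exp_neg] at h1
    rw [le_div_iff₀ hcpos]
    have h2 := mul_le_mul_of_nonneg_right h1 (by positivity : 0 ≤ √d * Real.exp (d / 2))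
    have h3 : a * (c * (Real.exp (d / 2))⁻¹ / √d) * (√d * Real.exp (d / 2)) = a * c := by
      field_simp
    linarith
  have hmd : ∀ n : ℕ, Measurable fun x : Fin n → ℝ => x ⬝ᵥ x / n := by
    intro n; unfold dotProduct; fun_prop
  have hmeas : (isoGaussian (Fin d) 1).map (fun x : Fin d → ℝ => x ⬝ᵥ x / (d : ℝ)) ≤
      ENNReal.ofReal (Real.exp (d₀ / 2) / c / a₀ * √d) •
        (isoGaussian (Fin d₀) 1).map (fun x : Fin d₀ → ℝ => x ⬝ᵥ x / (d₀ : ℝ)) := by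
    refine Measure.le_iff.2 fun B hBm => ?_
    have hind : ∀ {n : ℕ}, IntegrableOn (radialWeight n) (Set.Ioi 0) →
        IntegrableOn (fun s => radialWeight n s * B.indicator (fun _ => 1) (s ^ 2))
          (Set.Ioi 0) := by
      intro n hn
      refine Integrable.mono' (g := fun s => ‖radialWeight n s‖) hn.norm
        (hn.aestronglyMeasurable.mul ?_) (ae_of_all _ fun s => ?_)
      · exact (((measurable_const.indicator hBm).comp (measurable_id.pow_const 2))).aestronglyMeasurable
      · rw [norm_mul]
        by_cases hs : s ^ 2 ∈ B <;> simp [hs]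
    rw [Measure.map_apply (hmd d) hBm, Measure.smul_apply, Measure.map_apply (hmd d₀) hBm,
      smul_eq_mul, ← ofReal_measureReal, ← ofReal_measureReal, ← ENNReal.ofReal_mul (by positivity)]
    refine ENNReal.ofReal_le_ofReal ?_
    have e1 := hB B hBm
    have e2 := hB₀ B hBm
    simp only [Set.preimage]
    rw [e1, e2]
    have hI0 : 0 ≤ ∫ s in Set.Ioi (0 : ℝ), radialWeight d₀ s * B.indicator (fun _ => 1) (s ^ 2) :=
      setIntegral_nonneg measurableSet_Ioi fun s hs =>
        mul_nonneg (radialWeight_nonneg _ hs) (Set.indicator_nonneg (fun _ _ => zero_le_one) _)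
    calc a * ∫ s in Set.Ioi (0 : ℝ), radialWeight d s * B.indicator (fun _ => 1) (s ^ 2)
        ≤ (√d * Real.exp (d / 2) / c) * (Real.exp (-((d - d₀ : ℝ) / 2)) *
          ∫ s in Set.Ioi (0 : ℝ), radialWeight d₀ s * B.indicator (fun _ => 1) (s ^ 2)) := by
          rw [← integral_const_mul (Real.exp (-((d - d₀ : ℝ) / 2)))]
          have hI : 0 ≤ ∫ s in Set.Ioi (0 : ℝ),
              radialWeight d s * B.indicator (fun _ => 1) (s ^ 2) :=
            setIntegral_nonneg measurableSet_Ioi fun s hs =>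
              mul_nonneg (radialWeight_nonneg _ hs)
                (Set.indicator_nonneg (fun _ _ => zero_le_one) _)
          refine mul_le_mul ha_le ?_ hI (by positivity)
          refine setIntegral_mono_on (hind hi) ((hind hi₀).const_mul _) measurableSet_Ioi
            fun s hs => ?_
          rw [← mul_assoc]
          exact mul_le_mul_of_nonneg_right (radialWeight_le h0 hd hs)
            (Set.indicator_nonneg (fun _ _ => zero_le_one) _)
      _ = _ := by
          -- The factor `exp (d / 2)` from the normalization cancels `exp (-(d - d₀) / 2)` up to
          -- `exp (d₀ / 2)`; only `√d` survives.
          rw [show -((d - d₀ : ℝ) / 2) = d₀ / 2 + -(d / 2) by ring, Real.exp_add, Real.exp_neg]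
          field_simp
  calc ∫⁻ x, g (x ⬝ᵥ x / d) ∂(isoGaussian (Fin d) 1)
      = ∫⁻ y, g y ∂((isoGaussian (Fin d) 1).map (fun x : Fin d → ℝ => x ⬝ᵥ x / (d : ℝ))) :=
        (lintegral_map hg (hmd d)).symm
    _ ≤ ∫⁻ y, g y ∂(ENNReal.ofReal (Real.exp (d₀ / 2) / c / a₀ * √d) •
        (isoGaussian (Fin d₀) 1).map (fun x : Fin d₀ → ℝ => x ⬝ᵥ x / (d₀ : ℝ))) := lintegral_mono' hmeas le_rfl
    _ = _ := by rw [lintegral_smul_measure, lintegral_map hg (hmd d₀), smul_eq_mul]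

end Radial

/-! ### Moments of a label as functions of the variance `s = |ξ|² / d` -/

section LabelLaw

/-- The joint law of a projected input of variance `s` and of its label noise. -/
noncomputable def labelLaw (ρ : ℝ≥0) (s : ℝ) : Measure (ℝ × ℝ) :=
  (gaussianReal 0 s.toNNReal).prod (gaussianReal 0 ρ)

instance (ρ : ℝ≥0) (s : ℝ) : IsProbabilityMeasure (labelLaw ρ s) := by
  unfold labelLaw; infer_instance

/-- The noisy label as a function of the projected input and of the noise. -/
def noisyLabel (σs : ℝ → ℝ) (w : ℝ × ℝ) : ℝ := σs w.1 + w.2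

variable {σs : ℝ → ℝ} {ρ : ℝ≥0}

@[fun_prop]
theorem measurable_noisyLabel (hσ : Measurable σs) : Measurable (noisyLabel σs) := by
  unfold noisyLabel; fun_prop

/-- Moves the dependence on `s` from the measure into the integrand, which makes expectations
measurable in `s`. For `s ≤ 0` both sides are degenerate, since `√s = 0` and `s.toNNReal = 0`. -/
theorem labelLaw_eq_map (ρ : ℝ≥0) (s : ℝ) :
    labelLaw ρ s = (labelLaw ρ 1).map (fun w => (√s * w.1, w.2)) := by
  have h := gaussianReal_map_const_mul (μ := 0) (v := 1) (√s)
  have hv : NNReal.mk (√s ^ 2) (sq_nonneg _) * 1 = s.toNNReal := by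
    ext
    rcases le_total 0 s with hs | hs
    · simp [hs]
    · simp [Real.sqrt_eq_zero_of_nonpos hs, hs]
  rw [hv, mul_zero] at h
  unfold labelLaw
  rw [← h, Real.toNNReal_one]
  conv_lhs => rw [← Measure.map_id (μ := gaussianReal 0 ρ)]
  rw [Measure.map_prod_map _ _ (by fun_prop) measurable_id]
  rfl

theorem measurable_lintegral_labelLaw {f : ℝ × ℝ → ENNReal} (hf : Measurable f) :
    Measurable fun s => ∫⁻ w, f w ∂(labelLaw ρ s) := by
  have : ∀ s, ∫⁻ w, f w ∂(labelLaw ρ s) = ∫⁻ w, f (√s * w.1, w.2) ∂(labelLaw ρ 1) := by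
    intro s
    rw [labelLaw_eq_map, lintegral_map hf (by fun_prop)]
  simp_rw [this]
  exact Measurable.lintegral_prod_right' (f := fun p : ℝ × (ℝ × ℝ) => f (√p.1 * p.2.1, p.2.2))
    (by fun_prop)

theorem measurable_integral_labelLaw {f : ℝ × ℝ → ℝ} (hf : Measurable f) :
    Measurable fun s => ∫ w, f w ∂(labelLaw ρ s) := by
  have : ∀ s, ∫ w, f w ∂(labelLaw ρ s) = ∫ w, f (√s * w.1, w.2) ∂(labelLaw ρ 1) := by
    intro s
    conv_lhs => rw [labelLaw_eq_map]
    rw [integral_map (by fun_prop) hf.aestronglyMeasurable]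
  simp_rw [this]
  refine (StronglyMeasurable.integral_prod_right'
    (f := fun p : ℝ × (ℝ × ℝ) => f (√p.1 * p.2.1, p.2.2)) ?_).measurable
  exact Measurable.stronglyMeasurable (by fun_prop)

/-- The exponential factor increases with the variance, and the ratio of the prefactors is `√(V / v)
≤ √(2 V)`. -/
theorem gaussianPDFReal_le {v V : ℝ≥0} (hv : 1 / 2 ≤ v) (hV : v ≤ V) (x : ℝ) :
    gaussianPDFReal 0 v x ≤ √(2 * V) * gaussianPDFReal 0 V x := by
  have hv' : (1 / 2 : ℝ) ≤ v := by exact_mod_cast hv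
  have hV' : (v : ℝ) ≤ V := by exact_mod_cast hV
  have hv0 : (0 : ℝ) < v := by linarith
  have hV0 : (0 : ℝ) < V := by linarith
  unfold gaussianPDFReal
  rw [← mul_assoc]
  refine mul_le_mul ?_ ?_ (Real.exp_pos _).le (by positivity)
  · rw [← Real.sqrt_inv, ← Real.sqrt_inv, ← Real.sqrt_mul (by positivity)]
    refine Real.sqrt_le_sqrt ?_
    have hpi := Real.pi_pos
    rw [mul_inv, mul_inv (2 * Real.pi) (V : ℝ)]
    have : (v : ℝ)⁻¹ ≤ 2 := by
      rw [inv_le_comm₀ hv0 two_pos]; linarith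
    calc (2 * Real.pi)⁻¹ * (v : ℝ)⁻¹ ≤ (2 * Real.pi)⁻¹ * 2 := by gcongr
      _ = _ := by field_simp
  · refine Real.exp_le_exp.2 ?_
    rw [neg_div, neg_div, neg_le_neg_iff]
    gcongr

/-- Only the densities are compared, so nothing is required of `f` beyond measurability: finiteness
of an expectation at one variance `V` passes to all variances in `[1 / 2, V]`. -/
theorem lintegral_labelLaw_le {s V : ℝ} (hs : 1 / 2 ≤ s) (hV : s ≤ V) {f : ℝ × ℝ → ENNReal}
    (hf : Measurable f) :
    ∫⁻ w, f w ∂(labelLaw ρ s) ≤ ENNReal.ofReal √(2 * V) * ∫⁻ w, f w ∂(labelLaw ρ V) := by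
  have hs0 : (s.toNNReal) ≠ 0 := by simp; linarith
  have hV0 : (V.toNNReal) ≠ 0 := by simp; linarith
  have hg : Measurable fun u => ∫⁻ e, f (u, e) ∂(gaussianReal 0 ρ) := hf.lintegral_prod_right'
  unfold labelLaw
  rw [lintegral_prod _ hf.aemeasurable, lintegral_prod _ hf.aemeasurable,
    gaussianReal_of_var_ne_zero 0 hs0, gaussianReal_of_var_ne_zero 0 hV0,
    lintegral_withDensity_eq_lintegral_mul _ (measurable_gaussianPDF _ _) hg,
    lintegral_withDensity_eq_lintegral_mul _ (measurable_gaussianPDF _ _) hg,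
    ← lintegral_const_mul _ ((measurable_gaussianPDF _ _).mul hg)]
  refine lintegral_mono fun x => ?_
  simp only [Pi.mul_apply]
  rw [← mul_assoc]
  gcongr
  unfold gaussianPDF
  rw [← ENNReal.ofReal_mul (by positivity)]
  refine ENNReal.ofReal_le_ofReal ?_
  have := gaussianPDFReal_le (v := s.toNNReal) (V := V.toNNReal)
    (by rw [Real.le_toNNReal_iff_coe_le (by linarith)]; simpa using hs)
    (Real.toNNReal_le_toNNReal hV) x
  rwa [Real.coe_toNNReal V (by linarith)] at this

/-- Expectations under `labelLaw` depend continuously on the variance. -/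
theorem continuousAt_integral_labelLaw {V : ℝ} (hV : 2 ≤ V) {f : ℝ × ℝ → ℝ} (hf : Measurable f)
    (hi : Integrable f (labelLaw ρ V)) : ContinuousAt (fun s => ∫ w, f w ∂(labelLaw ρ s)) 1 := by
  have hV0 : (V.toNNReal) ≠ 0 := by simp; linarith
  -- Once the noise is integrated out, `s` enters through the Gaussian density alone. Dominated
  -- convergence, with the density at `V` as dominating function, then gives continuity without any
  -- regularity of `f`.
  set g : ℝ → ℝ := fun u => ∫ e, f (u, e) ∂(gaussianReal 0 ρ)
  have hg : StronglyMeasurable g :=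
    StronglyMeasurable.integral_prod_right' (f := f) hf.stronglyMeasurable
  have hgi : Integrable g (gaussianReal 0 V.toNNReal) := Integrable.integral_prod_left hi
  have hgi' : Integrable (fun x => gaussianPDFReal 0 V.toNNReal x * g x) := by
    rw [gaussianReal_of_var_ne_zero 0 hV0, integrable_withDensity_iff_integrable_smul'
      (measurable_gaussianPDF _ _) (ae_of_all _ fun _ => gaussianPDF_lt_top)] at hgi
    simpa [toReal_gaussianPDF] using hgi
  have hnhds : Set.Icc (1 / 2 : ℝ) 2 ∈ 𝓝 (1 : ℝ) := Icc_mem_nhds (by norm_num) (by norm_num)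
  have hfi : ∀ s ∈ Set.Icc (1 / 2 : ℝ) 2, Integrable f (labelLaw ρ s) := by
    intro s hs
    refine ⟨hf.aestronglyMeasurable, ?_⟩
    refine (lintegral_labelLaw_le hs.1 (hs.2.trans hV) hf.enorm).trans_lt ?_
    exact ENNReal.mul_lt_top ENNReal.ofReal_lt_top hi.2
  have heq : ∀ s ∈ Set.Icc (1 / 2 : ℝ) 2, ∫ w, f w ∂(labelLaw ρ s) =
      ∫ x, gaussianPDFReal 0 s.toNNReal x * g x := by
    intro s hs
    have hs0 : (s.toNNReal) ≠ 0 := by simp; linarith [hs.1]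
    rw [labelLaw, integral_prod _ (hfi s hs), integral_gaussianReal_eq_integral_smul hs0]
    rfl
  have hev : (fun s => ∫ w, f w ∂(labelLaw ρ s)) =ᶠ[𝓝 1]
      fun s => ∫ x, gaussianPDFReal 0 s.toNNReal x * g x := by
    filter_upwards [hnhds] with s hs using heq s hs
  refine ContinuousAt.congr ?_ hev.symm
  refine tendsto_integral_filter_of_dominated_convergence
    (fun x => √(2 * V) * ‖gaussianPDFReal 0 V.toNNReal x * g x‖) ?_ ?_ (hgi'.norm.const_mul _) ?_
  · exact Eventually.of_forall fun s =>
      (((measurable_gaussianPDFReal _ _).mul hg.measurable)).aestronglyMeasurable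
  · filter_upwards [hnhds] with s hs
    refine ae_of_all _ fun x => ?_
    rw [norm_mul, norm_mul, ← mul_assoc]
    gcongr
    rw [Real.norm_of_nonneg (gaussianPDFReal_nonneg _ _ _),
      Real.norm_of_nonneg (gaussianPDFReal_nonneg _ _ _)]
    have := gaussianPDFReal_le (v := s.toNNReal) (V := V.toNNReal)
      (by rw [Real.le_toNNReal_iff_coe_le (by linarith [hs.1])]; simpa using hs.1)
      (Real.toNNReal_le_toNNReal (hs.2.trans hV)) x
    rwa [Real.coe_toNNReal V (by linarith)] at this
  · refine ae_of_all _ fun x => Tendsto.mul_const _ ?_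
    have h1 : Tendsto (fun s : ℝ => ((s.toNNReal : ℝ≥0) : ℝ)) (𝓝 1) (𝓝 ((Real.toNNReal 1 : ℝ≥0) : ℝ)) :=
      ((NNReal.continuous_coe.comp continuous_real_toNNReal).tendsto 1)
    unfold gaussianPDFReal
    have hne : √(2 * Real.pi * ((Real.toNNReal 1 : ℝ≥0) : ℝ)) ≠ 0 := by
      rw [Real.toNNReal_one]; simp [Real.pi_pos.ne', Real.pi_pos.le]
    refine Tendsto.mul (Tendsto.inv₀ ((h1.const_mul _).sqrt) hne) ?_
    refine (Real.continuous_exp.tendsto _).comp (Tendsto.div tendsto_const_nhds (h1.const_mul 2) ?_)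
    simp

/-- The fourth moment of a label, given the normalized squared norm of the task vector. -/
noncomputable def labelFourth (σs : ℝ → ℝ) (ρ : ℝ≥0) (s : ℝ) : ENNReal :=
  ∫⁻ w, ENNReal.ofReal (noisyLabel σs w ^ 4) ∂(labelLaw ρ s)

/-- The second moment of a label. -/
noncomputable def labelSecond (σs : ℝ → ℝ) (ρ : ℝ≥0) (s : ℝ) : ℝ :=
  ∫ w, noisyLabel σs w ^ 2 ∂(labelLaw ρ s)

/-- The correlation of a label with the projected input. -/
noncomputable def labelCorr (σs : ℝ → ℝ) (ρ : ℝ≥0) (s : ℝ) : ℝ :=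
  ∫ w, noisyLabel σs w * w.1 ∂(labelLaw ρ s)

/-- The second moment of the product of a label with the projected input. -/
noncomputable def labelMixed (σs : ℝ → ℝ) (ρ : ℝ≥0) (s : ℝ) : ℝ :=
  ∫ w, (noisyLabel σs w * w.1) ^ 2 ∂(labelLaw ρ s)

/-- The fourth moment of the standard Gaussian law. -/
noncomputable def gaussianFourth : ℝ := ∫ x, x ^ 4 ∂(gaussianReal 0 1)

theorem gaussianFourth_nonneg : 0 ≤ gaussianFourth := integral_nonneg fun x => by positivity

theorem integral_pow_four_gaussianReal (w : ℝ≥0) :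
    ∫ x, x ^ 4 ∂(gaussianReal 0 w) = gaussianFourth * w ^ 2 := by
  rw [integral_comp_gaussianReal_scale w _ (by fun_prop)]
  simp only [mul_pow]
  rw [integral_const_mul, gaussianFourth]
  have : Real.sqrt w ^ 4 = (Real.sqrt w ^ 2) ^ 2 := by ring
  rw [this, Real.sq_sqrt w.coe_nonneg]
  ring

theorem measurable_labelFourth (hσ : Measurable σs) : Measurable (labelFourth σs ρ) :=
  measurable_lintegral_labelLaw (by fun_prop)

theorem measurable_labelSecond (hσ : Measurable σs) : Measurable (labelSecond σs ρ) :=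
  measurable_integral_labelLaw (by fun_prop)

theorem measurable_labelCorr (hσ : Measurable σs) : Measurable (labelCorr σs ρ) :=
  measurable_integral_labelLaw (by fun_prop)

theorem measurable_labelMixed (hσ : Measurable σs) : Measurable (labelMixed σs ρ) :=
  measurable_integral_labelLaw (by fun_prop)

section FiniteFourth

variable {s : ℝ} (hσ : Measurable σs) (h4 : labelFourth σs ρ s < ⊤)
include hσ h4

theorem integrable_label_four : Integrable (fun w => noisyLabel σs w ^ 4) (labelLaw ρ s) := by
  refine ⟨(by fun_prop : Measurable _).aestronglyMeasurable, ?_⟩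
  rw [hasFiniteIntegral_iff_ofReal (ae_of_all _ fun w => by positivity)]
  exact h4

theorem integral_label_four : ∫ w, noisyLabel σs w ^ 4 ∂(labelLaw ρ s) =
    (labelFourth σs ρ s).toReal := by
  rw [labelFourth, integral_eq_lintegral_of_nonneg_ae (ae_of_all _ fun w => by positivity)
    (integrable_label_four hσ h4).1]

theorem integrable_label_two : Integrable (fun w => noisyLabel σs w ^ 2) (labelLaw ρ s) :=
  integrable_pow_of_integrable_pow_four (measurable_noisyLabel hσ).aestronglyMeasurable
    (integrable_label_four hσ h4) (by norm_num)

theorem labelSecond_sq_le : labelSecond σs ρ s ^ 2 ≤ (labelFourth σs ρ s).toReal := by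
  rw [← integral_label_four hσ h4]
  have i4 := integrable_label_four hσ h4
  have i2 := integrable_label_two hσ h4
  have : 0 ≤ ∫ w, (noisyLabel σs w ^ 2 - labelSecond σs ρ s) ^ 2 ∂(labelLaw ρ s) :=
    integral_nonneg fun x => sq_nonneg _
  have e : ∀ w, (noisyLabel σs w ^ 2 - labelSecond σs ρ s) ^ 2 = noisyLabel σs w ^ 4 -
      (2 * labelSecond σs ρ s) * noisyLabel σs w ^ 2 + labelSecond σs ρ s ^ 2 := fun x => by ring
  simp only [e] at this
  have h42 : Integrable (fun w => noisyLabel σs w ^ 4 -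
      (2 * labelSecond σs ρ s) * noisyLabel σs w ^ 2) (labelLaw ρ s) := i4.sub (i2.const_mul _)
  rw [integral_add h42 (integrable_const _), integral_sub i4 (i2.const_mul _),
    integral_const_mul] at this
  simp only [integral_const, probReal_univ, one_smul] at this
  change 0 ≤ _ - 2 * labelSecond σs ρ s * labelSecond σs ρ s + _ at this
  nlinarith

omit hσ h4 in
theorem integrable_input_pow (i : ℕ) : Integrable (fun w : ℝ × ℝ => w.1 ^ i) (labelLaw ρ s) :=
  (integrable_pow_gaussianReal s.toNNReal i).comp_fst (gaussianReal 0 ρ)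

omit hσ h4 in
theorem integral_input_sq : ∫ w, w.1 ^ 2 ∂(labelLaw ρ s) = s.toNNReal := by
  rw [labelLaw, integral_fun_fst (fun u : ℝ => u ^ 2)]
  have := variance_fun_id_gaussianReal (μ := 0) (v := s.toNNReal)
  rw [variance_of_integral_eq_zero (by fun_prop) (by simp)] at this
  simp [this]

omit hσ h4 in
theorem integral_input_four : ∫ w, w.1 ^ 4 ∂(labelLaw ρ s) =
    gaussianFourth * (s.toNNReal : ℝ) ^ 2 := by
  rw [labelLaw, integral_fun_fst (fun u : ℝ => u ^ 4), integral_pow_four_gaussianReal]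
  simp

theorem integrable_label_mixed :
    Integrable (fun w => (noisyLabel σs w * w.1) ^ 2) (labelLaw ρ s) := by
  refine ((integrable_label_four hσ h4).add (integrable_input_pow 4)).mono'
    (by fun_prop : Measurable _).aestronglyMeasurable (ae_of_all _ fun w => ?_)
  simp only [Pi.add_apply]
  rw [Real.norm_of_nonneg (by positivity)]
  nlinarith [sq_nonneg (noisyLabel σs w ^ 2 - w.1 ^ 2), sq_nonneg (noisyLabel σs w ^ 2),
    sq_nonneg (w.1 ^ 2)]

/-- The inequality `(y u)² ≤ s y⁴ + s⁻¹ u⁴` is weighted so that `E u⁴`, of order `s²`, leaves a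
global factor `s`. The quotient `labelMixed / s` is then controlled even for small `s`. -/
theorem labelMixed_le (hs : 0 < s) :
    labelMixed σs ρ s ≤ s * ((labelFourth σs ρ s).toReal + gaussianFourth) := by
  have h1 := (integrable_label_four hσ h4).const_mul s
  have h2 := (integrable_input_pow (ρ := ρ) (s := s) 4).const_mul s⁻¹
  have : labelMixed σs ρ s ≤ ∫ w, (s * noisyLabel σs w ^ 4 + s⁻¹ * w.1 ^ 4) ∂(labelLaw ρ s) := by
    refine integral_mono (integrable_label_mixed hσ h4) (h1.add h2) fun w => ?_
    have e : s * noisyLabel σs w ^ 4 + s⁻¹ * w.1 ^ 4 - (noisyLabel σs w * w.1) ^ 2 =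
        s⁻¹ * ((s * noisyLabel σs w ^ 2 - w.1 ^ 2 / 2) ^ 2 + 3 / 4 * w.1 ^ 4) := by
      field_simp
      ring
    have : 0 ≤ s⁻¹ * ((s * noisyLabel σs w ^ 2 - w.1 ^ 2 / 2) ^ 2 + 3 / 4 * w.1 ^ 4) := by
      positivity
    simp only
    linarith
  rw [integral_add h1 h2, integral_const_mul, integral_const_mul, integral_label_four hσ h4,
    integral_input_four, Real.coe_toNNReal _ hs.le] at this
  refine this.trans (le_of_eq ?_)
  field_simp

theorem integrable_label_corr : Integrable (fun w => noisyLabel σs w * w.1) (labelLaw ρ s) := by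
  have hm : Measurable fun w => noisyLabel σs w * w.1 := by fun_prop
  exact ((memLp_two_iff_integrable_sq hm.aestronglyMeasurable).2
    (integrable_label_mixed hσ h4)).integrable (by norm_num)

/-- Cauchy–Schwarz, as the nonnegativity of the error of the linear regression of the label on the
input. -/
theorem labelCorr_sq_le (hs : 0 < s) : labelCorr σs ρ s ^ 2 / s ≤ labelSecond σs ρ s := by
  set b := labelCorr σs ρ s with hb
  have i1 := integrable_label_two hσ h4
  have i2 := (integrable_label_corr hσ h4).const_mul (2 * (b / s))
  have i3 := (integrable_input_pow (ρ := ρ) (s := s) 2).const_mul ((b / s) ^ 2)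
  have : 0 ≤ ∫ w, (noisyLabel σs w - (b / s) * w.1) ^ 2 ∂(labelLaw ρ s) :=
    integral_nonneg fun x => sq_nonneg _
  have e : ∀ w : ℝ × ℝ, (noisyLabel σs w - (b / s) * w.1) ^ 2 = noisyLabel σs w ^ 2 -
      (2 * (b / s)) * (noisyLabel σs w * w.1) + (b / s) ^ 2 * w.1 ^ 2 := fun x => by ring
  simp only [e] at this
  have h12 : Integrable (fun w : ℝ × ℝ => noisyLabel σs w ^ 2 -
      (2 * (b / s)) * (noisyLabel σs w * w.1)) (labelLaw ρ s) := i1.sub i2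
  rw [integral_add h12 i3, integral_sub i1 i2, integral_const_mul, integral_const_mul,
    integral_input_sq, Real.coe_toNNReal _ hs.le] at this
  change 0 ≤ labelSecond σs ρ s - 2 * (b / s) * b + (b / s) ^ 2 * s at this
  have e2 : 2 * (b / s) * b - (b / s) ^ 2 * s = b ^ 2 / s := by field_simp; ring
  linarith

/-- The noise is centered and independent of the input, so the second moment is `E σ_*² + ρ`. This
is what makes `rowLimit` positive. -/
theorem le_labelSecond : (ρ : ℝ) ≤ labelSecond σs ρ s := by
  have hi := integrable_label_two hσ h4
  rw [labelSecond, labelLaw, integral_prod _ hi]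
  have hin : ∀ u : ℝ, ∫ e, noisyLabel σs (u, e) ^ 2 ∂(gaussianReal 0 ρ) = σs u ^ 2 + ρ := by
    intro u
    have i1 := integrable_pow_gaussianReal ρ 1
    have i2 := integrable_pow_gaussianReal ρ 2
    simp only [pow_one] at i1
    have e : ∀ x : ℝ, noisyLabel σs (u, x) ^ 2 = σs u ^ 2 + 2 * σs u * x + x ^ 2 :=
      fun x => by simp only [noisyLabel]; ring
    simp only [e]
    have i12 : Integrable (fun x : ℝ => σs u ^ 2 + 2 * σs u * x) (gaussianReal 0 ρ) :=
      (integrable_const _).add (i1.const_mul _)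
    rw [integral_add i12 i2, integral_add (integrable_const _) (i1.const_mul _),
      integral_const_mul]
    have := variance_fun_id_gaussianReal (μ := 0) (v := ρ)
    rw [variance_of_integral_eq_zero (by fun_prop) (by simp)] at this
    simp [this]
  have hi' := Integrable.integral_prod_left hi
  simp only [hin] at hi' ⊢
  have : ∫ u : ℝ, (ρ : ℝ) ∂(gaussianReal 0 s.toNNReal) ≤
      ∫ u, (σs u ^ 2 + ρ) ∂(gaussianReal 0 s.toNNReal) :=
    integral_mono (integrable_const _) hi' fun u => by simp only; nlinarith [sq_nonneg (σs u)]
  simpa using this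

end FiniteFourth

/-- Integrability of the fourth moment over the task vectors of one dimension provides a
variance larger than `2` at which the fourth moment is finite. -/
theorem exists_labelFourth_lt_top {d : ℕ} (hd : 1 ≤ d) (hσ : Measurable σs)
    (h : ∫⁻ x, labelFourth σs ρ (x ⬝ᵥ x / d) ∂(isoGaussian (Fin d) 1) ≠ ⊤) :
    ∃ V, 2 ≤ V ∧ labelFourth σs ρ V < ⊤ := by
  have hd0 : (0 : ℝ) < d := by exact_mod_cast hd
  have hpos : Measure.IsOpenPosMeasure (gaussianReal 0 1) :=
    (gaussianReal_absolutelyContinuous' 0 one_ne_zero).isOpenPosMeasure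
  have hm : Continuous fun x : Fin d → ℝ => x ⬝ᵥ x / d := by unfold dotProduct; fun_prop
  have hae := ae_lt_top ((measurable_labelFourth hσ).comp hm.measurable) h
  have hopen : IsOpen {x : Fin d → ℝ | 2 < x ⬝ᵥ x / d} := isOpen_lt continuous_const hm
  have hne : {x : Fin d → ℝ | 2 < x ⬝ᵥ x / d}.Nonempty := by
    refine ⟨fun _ => 2, ?_⟩
    simp only [Set.mem_ofPred_eq, dotProduct, Finset.sum_const, Finset.card_univ,
      Fintype.card_fin, nsmul_eq_mul]
    rw [mul_div_cancel_left₀ _ hd0.ne']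
    norm_num
  -- A finite integral makes the fourth moment finite almost everywhere, and a nonempty open set has
  -- positive Gaussian measure; so it is finite at some point with `|x|² / d > 2`.
  have hmeas := hopen.measure_pos (isoGaussian (Fin d) 1) hne
  by_contra hc
  push Not at hc
  refine hmeas.ne' (measure_mono_null ?_ (ae_iff.1 hae))
  intro x hx
  simp only [Set.mem_ofPred_eq, not_lt]
  exact hc _ (le_of_lt hx)

theorem labelFourth_le {V : ℝ} (hσ : Measurable σs) {s : ℝ} (hs : 1 / 2 ≤ s) (hsV : s ≤ V) :
    labelFourth σs ρ s ≤ ENNReal.ofReal √(2 * V) * labelFourth σs ρ V :=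
  lintegral_labelLaw_le hs hsV (by fun_prop)

end LabelLaw

/-! ### Law of the squared norm of the context row given the task vector -/

section ContextLaw

/-- The joint law of the context inputs and of the label noises. -/
noncomputable def contextLaw (d ℓ : ℕ) (ρ : ℝ≥0) : Measure ((Fin ℓ → Fin d → ℝ) × (Fin ℓ → ℝ)) :=
  (Measure.pi fun _ => ICL.inputLaw d).prod (Measure.pi fun _ => gaussianReal 0 ρ)

instance (d ℓ : ℕ) (ρ : ℝ≥0) : IsProbabilityMeasure (contextLaw d ℓ ρ) := by
  unfold contextLaw; infer_instance

/-- Separation of a prompt into its context and its query. -/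
def splitPrompt {d ℓ : ℕ} (z : (Fin (ℓ + 1) → Fin d → ℝ) × (Fin ℓ → ℝ)) :
    ((Fin ℓ → Fin d → ℝ) × (Fin ℓ → ℝ)) × (Fin d → ℝ) :=
  ((fun i => z.1 i.castSucc, z.2), z.1 (Fin.last ℓ))

theorem measurePreserving_splitPrompt (d ℓ : ℕ) (ρ : ℝ≥0) :
    MeasurePreserving (splitPrompt (d := d) (ℓ := ℓ)) (ICL.promptLaw d ℓ ρ)
      ((contextLaw d ℓ ρ).prod (ICL.inputLaw d)) := by
  have h1 := measurePreserving_piFinSuccAbove (fun _ : Fin (ℓ + 1) => ICL.inputLaw d) (Fin.last ℓ)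
  have h2 := h1.prod (MeasurePreserving.id (Measure.pi fun _ : Fin ℓ => gaussianReal 0 ρ))
  have h3 := measurePreserving_prodAssoc (ICL.inputLaw d)
    (Measure.pi fun _ : Fin ℓ => ICL.inputLaw d) (Measure.pi fun _ : Fin ℓ => gaussianReal 0 ρ)
  have h4 := (Measure.measurePreserving_swap (μ := ICL.inputLaw d)
    (ν := (Measure.pi fun _ : Fin ℓ => ICL.inputLaw d).prod
      (Measure.pi fun _ : Fin ℓ => gaussianReal 0 ρ)))
  have h := h4.comp (h3.comp h2)
  convert! h using 1
  ext z : 1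
  simp [splitPrompt, MeasurableEquiv.piFinSuccAbove, MeasurableEquiv.prodAssoc, Fin.init_def]

/-- The labels of a context. -/
def contextLabels {d ℓ : ℕ} (σs : ℝ → ℝ) (ξ : Fin d → ℝ) (c : (Fin ℓ → Fin d → ℝ) × (Fin ℓ → ℝ)) :
    Fin ℓ → ℝ := fun i => σs (ξ ⬝ᵥ c.1 i) + c.2 i

/-- The row `ICL.contextRow` as a function of the context. -/
noncomputable def rowOfContext {d ℓ : ℕ} (σs : ℝ → ℝ) (ξ : Fin d → ℝ)
    (c : (Fin ℓ → Fin d → ℝ) × (Fin ℓ → ℝ)) : Fin (d + 1) → ℝ :=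
  Fin.snoc (α := fun _ => ℝ)
    (fun j => ((d : ℝ) / ℓ) * ∑ i : Fin ℓ, contextLabels σs ξ c i * c.1 i j)
    ((1 / (ℓ : ℝ)) * ∑ i : Fin ℓ, contextLabels σs ξ c i ^ 2)

variable {d ℓ : ℕ} {σs : ℝ → ℝ} {ρ : ℝ≥0}

theorem measurable_rowOfContext_uncurry (hσ : Measurable σs) :
    Measurable fun p : (Fin d → ℝ) × ((Fin ℓ → Fin d → ℝ) × (Fin ℓ → ℝ)) =>
      rowOfContext σs p.1 p.2 := by
  have hl : ∀ i, Measurable fun p : (Fin d → ℝ) × ((Fin ℓ → Fin d → ℝ) × (Fin ℓ → ℝ)) =>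
      contextLabels σs p.1 p.2 i := by
    intro i; unfold contextLabels dotProduct; fun_prop
  refine measurable_pi_lambda _ fun j => ?_
  refine Fin.lastCases ?_ (fun j => ?_) j
  · simp only [rowOfContext, Fin.snoc_last]
    fun_prop
  · simp only [rowOfContext, Fin.snoc_castSucc]
    fun_prop

theorem measurable_rowOfContext (hσ : Measurable σs) (ξ : Fin d → ℝ) :
    Measurable fun c : (Fin ℓ → Fin d → ℝ) × (Fin ℓ → ℝ) => rowOfContext σs ξ c :=
  Measurable.of_uncurry_left (f := rowOfContext σs) (measurable_rowOfContext_uncurry hσ)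

theorem measurable_rowOfContext_sq (hσ : Measurable σs) (ξ : Fin d → ℝ) :
    Measurable fun c : (Fin ℓ → Fin d → ℝ) × (Fin ℓ → ℝ) =>
      rowOfContext σs ξ c ⬝ᵥ rowOfContext σs ξ c := by
  have := measurable_rowOfContext (ℓ := ℓ) hσ ξ
  unfold dotProduct
  fun_prop

theorem rowOfContext_sq (σs : ℝ → ℝ) (ξ : Fin d → ℝ) (c : (Fin ℓ → Fin d → ℝ) × (Fin ℓ → ℝ)) :
    rowOfContext σs ξ c ⬝ᵥ rowOfContext σs ξ c =
      ((d : ℝ) / ℓ) ^ 2 * ((∑ i, contextLabels σs ξ c i • c.1 i) ⬝ᵥ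
        (∑ i, contextLabels σs ξ c i • c.1 i)) +
      ((1 / (ℓ : ℝ)) * ∑ i : Fin ℓ, contextLabels σs ξ c i ^ 2) ^ 2 := by
  rw [dotProduct, Fin.sum_univ_castSucc]
  simp only [rowOfContext, Fin.snoc_last, Fin.snoc_castSucc, dotProduct, Finset.sum_apply,
    Pi.smul_apply, smul_eq_mul]
  rw [Finset.mul_sum _ _ (((d : ℝ) / ℓ) ^ 2)]
  refine congrArg₂ (· + ·) (Finset.sum_congr rfl fun j _ => ?_) ?_ <;> ring

/-- The squared norm of the context row, in terms of the projected inputs, of the noises and of one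
independent Gaussian vector. -/
noncomputable def rowNormSq {d ℓ : ℕ} (σs : ℝ → ℝ) (ξ : Fin d → ℝ) (w : Fin ℓ → ℝ × ℝ)
    (x : Fin d → ℝ) : ℝ :=
  ((d : ℝ) / ℓ) ^ 2 * ((∑ i, noisyLabel σs (w i) * (w i).1) ^ 2 / (ξ ⬝ᵥ ξ) +
    (∑ i, noisyLabel σs (w i) ^ 2) * (x ⬝ᵥ x - (ξ ⬝ᵥ x) ^ 2 / (ξ ⬝ᵥ ξ))) +
  ((1 / (ℓ : ℝ)) * ∑ i, noisyLabel σs (w i) ^ 2) ^ 2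

theorem measurable_rowNormSq (hσ : Measurable σs) (ξ : Fin d → ℝ) :
    Measurable fun p : (Fin ℓ → ℝ × ℝ) × (Fin d → ℝ) => rowNormSq σs ξ p.1 p.2 := by
  unfold rowNormSq dotProduct; fun_prop

/-- After this splitting the labels depend only on the pairs `(ξ · x_i, ε_i)`, while the components
orthogonal to `ξ` come from Gaussian vectors independent of these pairs. Apart from the splitting of
one input, the proof rearranges product measures. -/
theorem map_context_split (hd : 1 ≤ d) {ξ : Fin d → ℝ} (hξ : ξ ⬝ᵥ ξ ≠ 0) :
    ((Measure.pi fun _ : Fin ℓ => labelLaw ρ (ξ ⬝ᵥ ξ / d)).prod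
      (Measure.pi fun _ : Fin ℓ => ICL.inputLaw d)).map
      (fun p => (fun i => ((p.1 i).1 / (ξ ⬝ᵥ ξ)) • ξ +
        (p.2 i - ((ξ ⬝ᵥ p.2 i) / (ξ ⬝ᵥ ξ)) • ξ), fun i => (p.1 i).2)) = contextLaw d ℓ ρ := by
  set s := ξ ⬝ᵥ ξ / d with hs
  have hnn : 0 ≤ ξ ⬝ᵥ ξ := Finset.sum_nonneg fun i _ => mul_self_nonneg _
  have hw : (s.toNNReal : ℝ) = ((d : ℝ≥0)⁻¹ : ℝ≥0) * (ξ ⬝ᵥ ξ) := by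
    rw [Real.coe_toNNReal _ (by positivity)]
    push_cast
    rw [hs]; ring
  have hm1 : Measurable fun p : ℝ × (Fin d → ℝ) => ξ ⬝ᵥ p.2 := by unfold dotProduct; fun_prop
  have hsplit : MeasurePreserving (fun p : ℝ × (Fin d → ℝ) =>
      (p.1 / (ξ ⬝ᵥ ξ)) • ξ + (p.2 - ((ξ ⬝ᵥ p.2) / (ξ ⬝ᵥ ξ)) • ξ))
      ((gaussianReal 0 s.toNNReal).prod (ICL.inputLaw d)) (ICL.inputLaw d) :=
    ⟨by fun_prop, isoGaussian_eq_map_split _ _ ξ hξ hw⟩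
  have h1 := measurePreserving_prodAssoc (gaussianReal 0 s.toNNReal) (gaussianReal 0 ρ)
    (ICL.inputLaw d)
  have h2 := (MeasurePreserving.id (gaussianReal 0 s.toNNReal)).prod
    (Measure.measurePreserving_swap (μ := gaussianReal 0 ρ) (ν := ICL.inputLaw d))
  have h3 := (measurePreserving_prodAssoc (gaussianReal 0 s.toNNReal) (ICL.inputLaw d)
    (gaussianReal 0 ρ)).symm
  have h4 := hsplit.prod (MeasurePreserving.id (gaussianReal 0 ρ))
  have hone := h4.comp (h3.comp (h2.comp h1))
  have hpi := measurePreserving_pi (fun _ : Fin ℓ => (labelLaw ρ s).prod (ICL.inputLaw d))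
    (fun _ => (ICL.inputLaw d).prod (gaussianReal 0 ρ)) (fun _ => hone)
  have ha := (measurePreserving_arrowProdEquivProdArrow (ℝ × ℝ) (Fin d → ℝ) (Fin ℓ)
    (fun _ => labelLaw ρ s) (fun _ => ICL.inputLaw d)).symm
  have hb := measurePreserving_arrowProdEquivProdArrow (Fin d → ℝ) ℝ (Fin ℓ)
    (fun _ => ICL.inputLaw d) (fun _ => gaussianReal 0 ρ)
  exact (hb.comp (hpi.comp ha)).map_eq

/-- The law of the squared norm of the context row. -/
theorem map_rowOfContext_sq (hσ : Measurable σs) (hd : 1 ≤ d) {ξ : Fin d → ℝ}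
    (hξ : ξ ⬝ᵥ ξ ≠ 0) :
    (contextLaw d ℓ ρ).map (fun c => rowOfContext σs ξ c ⬝ᵥ rowOfContext σs ξ c) =
    ((Measure.pi fun _ : Fin ℓ => labelLaw ρ (ξ ⬝ᵥ ξ / d)).prod (ICL.inputLaw d)).map
      (fun p => rowNormSq σs ξ p.1 p.2) := by
  refine Measure.ext_of_lintegral _ fun Φ hΦ => ?_
  have hmd : ∀ {α : Type} [MeasurableSpace α] {g : α → Fin d → ℝ}, Measurable g →
      Measurable fun a => ξ ⬝ᵥ g a := by
    intro α _ g hg; unfold dotProduct; fun_prop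
  have hmp : Measurable fun p : (Fin ℓ → ℝ × ℝ) × (Fin ℓ → Fin d → ℝ) =>
      (fun i => ((p.1 i).1 / (ξ ⬝ᵥ ξ)) • ξ + (p.2 i - ((ξ ⬝ᵥ p.2 i) / (ξ ⬝ᵥ ξ)) • ξ),
        fun i => (p.1 i).2) := by
    have : ∀ i, Measurable fun p : (Fin ℓ → ℝ × ℝ) × (Fin ℓ → Fin d → ℝ) => ξ ⬝ᵥ p.2 i :=
      fun i => hmd (by fun_prop)
    fun_prop
  have hmr := measurable_rowOfContext_sq (ℓ := ℓ) hσ ξ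
  have hmn := measurable_rowNormSq (ℓ := ℓ) hσ ξ
  -- The orthogonal parts enter the squared norm only through `z = ∑ y_i x'_i`, the `x'_i` being the
  -- independent copies.
  set G : (Fin ℓ → ℝ × ℝ) → (Fin d → ℝ) → ℝ := fun w z =>
    ((d : ℝ) / ℓ) ^ 2 * ((∑ i, noisyLabel σs (w i) * (w i).1) ^ 2 / (ξ ⬝ᵥ ξ) +
      (z ⬝ᵥ z - (ξ ⬝ᵥ z) ^ 2 / (ξ ⬝ᵥ ξ))) +
    ((1 / (ℓ : ℝ)) * ∑ i, noisyLabel σs (w i) ^ 2) ^ 2 with hG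
  have hmG : ∀ w, Measurable (G w) := by
    intro w; unfold G dotProduct; fun_prop
  have key : ∀ p : (Fin ℓ → ℝ × ℝ) × (Fin ℓ → Fin d → ℝ),
      rowOfContext σs ξ (fun i => ((p.1 i).1 / (ξ ⬝ᵥ ξ)) • ξ +
        (p.2 i - ((ξ ⬝ᵥ p.2 i) / (ξ ⬝ᵥ ξ)) • ξ), fun i => (p.1 i).2) ⬝ᵥ
      rowOfContext σs ξ (fun i => ((p.1 i).1 / (ξ ⬝ᵥ ξ)) • ξ +
        (p.2 i - ((ξ ⬝ᵥ p.2 i) / (ξ ⬝ᵥ ξ)) • ξ), fun i => (p.1 i).2) =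
      G p.1 (∑ i, noisyLabel σs (p.1 i) • p.2 i) := by
    intro p
    rw [rowOfContext_sq]
    have hl : ∀ i, contextLabels σs ξ (fun i => ((p.1 i).1 / (ξ ⬝ᵥ ξ)) • ξ +
        (p.2 i - ((ξ ⬝ᵥ p.2 i) / (ξ ⬝ᵥ ξ)) • ξ), fun i => (p.1 i).2) i =
        noisyLabel σs (p.1 i) := by
      intro i
      simp only [contextLabels, noisyLabel, dotProduct_add, dotProduct_sub, dotProduct_smul,
        smul_eq_mul]
      rw [div_mul_cancel₀ _ hξ, div_mul_cancel₀ _ hξ, sub_self, add_zero]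
    simp only [hl]
    set y : Fin ℓ → ℝ := fun i => noisyLabel σs (p.1 i)
    set z := ∑ i, y i • p.2 i with hz
    have hsum : ∑ i, y i • (((p.1 i).1 / (ξ ⬝ᵥ ξ)) • ξ +
        (p.2 i - ((ξ ⬝ᵥ p.2 i) / (ξ ⬝ᵥ ξ)) • ξ)) =
        ((∑ i, y i * (p.1 i).1) / (ξ ⬝ᵥ ξ)) • ξ + (z - ((ξ ⬝ᵥ z) / (ξ ⬝ᵥ ξ)) • ξ) := by
      simp only [smul_add, smul_sub, smul_smul, Finset.sum_add_distrib, Finset.sum_sub_distrib,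
        ← Finset.sum_smul, hz, dotProduct_sum, dotProduct_smul, smul_eq_mul, Finset.sum_div,
        mul_div_assoc]
    change ((d : ℝ) / ℓ) ^ 2 * ((∑ i, y i • _) ⬝ᵥ (∑ i, y i • _)) + _ = _
    rw [hsum]
    simp only [hG]
    congr 2
    simp only [dotProduct_add, add_dotProduct, dotProduct_sub, sub_dotProduct, smul_dotProduct,
      dotProduct_smul, smul_eq_mul, dotProduct_comm z ξ]
    field_simp
    ring
  have hΦn : Measurable fun p : (Fin ℓ → ℝ × ℝ) × (Fin d → ℝ) => Φ (rowNormSq σs ξ p.1 p.2) :=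
    hΦ.comp hmn
  have hΦr : Measurable fun c : (Fin ℓ → Fin d → ℝ) × (Fin ℓ → ℝ) =>
      Φ (rowOfContext σs ξ c ⬝ᵥ rowOfContext σs ξ c) := hΦ.comp hmr
  rw [lintegral_map hΦ hmr, lintegral_map hΦ hmn, ← map_context_split hd hξ,
    lintegral_map hΦr hmp]
  simp only [key]
  have hmG2 : Measurable fun p : (Fin ℓ → ℝ × ℝ) × (Fin ℓ → Fin d → ℝ) =>
      Φ (G p.1 (∑ i, noisyLabel σs (p.1 i) • p.2 i)) := by
    refine hΦ.comp ?_
    have hz : Measurable fun p : (Fin ℓ → ℝ × ℝ) × (Fin ℓ → Fin d → ℝ) =>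
      ∑ i, noisyLabel σs (p.1 i) • p.2 i := by fun_prop
    have hz2 := hmd hz
    unfold G dotProduct at *
    fun_prop
  rw [lintegral_prod _ hmG2.aemeasurable, lintegral_prod _ hΦn.aemeasurable]
  refine lintegral_congr fun w => ?_
  -- With the labels frozen, `∑ y_i x'_i` has the law of `√t • x` for a single input `x`; both are
  -- the isotropic Gaussian with variance `t / d`.
  set t : ℝ := ∑ i, noisyLabel σs (w i) ^ 2 with ht
  have ht0 : 0 ≤ t := Finset.sum_nonneg fun i _ => sq_nonneg _
  have hw1 : (((d : ℝ≥0)⁻¹ * t.toNNReal : ℝ≥0) : ℝ) = ((d : ℝ≥0)⁻¹ : ℝ≥0) * t := by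
    rw [NNReal.coe_mul, Real.coe_toNNReal _ ht0]
  have hw2 : (((d : ℝ≥0)⁻¹ * t.toNNReal : ℝ≥0) : ℝ) = ((d : ℝ≥0)⁻¹ : ℝ≥0) * (√t) ^ 2 := by
    rw [hw1, Real.sq_sqrt ht0]
  have e1 := pi_isoGaussian_map_sum_smul (ι := Fin d) _ _ (fun i => noisyLabel σs (w i)) hw1
  have e2 := isoGaussian_map_smul (ι := Fin d) _ _ (√t) hw2
  have hΦG : Measurable fun z => Φ (G w z) := hΦ.comp (hmG w)
  calc ∫⁻ X, Φ (G w (∑ i, noisyLabel σs (w i) • X i)) ∂(Measure.pi fun _ => ICL.inputLaw d)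
      = ∫⁻ z, Φ (G w z) ∂(isoGaussian (Fin d) ((d : ℝ≥0)⁻¹ * t.toNNReal)) := by
        rw [← e1, lintegral_map hΦG (by fun_prop)]
        rfl
    _ = ∫⁻ x, Φ (G w (√t • x)) ∂(ICL.inputLaw d) := by
        rw [← e2, lintegral_map hΦG (by fun_prop)]
        rfl
    _ = _ := by
        refine lintegral_congr fun x => ?_
        congr 1
        simp only [hG, rowNormSq, ← ht, smul_dotProduct, dotProduct_smul, smul_eq_mul]
        congr 3
        have := Real.sq_sqrt ht0
        rw [mul_sub, ← mul_assoc, ← sq, this, mul_pow, this]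
        ring

end ContextLaw

/-! ### The trace of the covariance as the second moment of the context row -/

section Trace

variable {d ℓ : ℕ} {σs : ℝ → ℝ} {ρ : ℝ≥0}

theorem lintegral_gaussianReal_sq (v : ℝ≥0) :
    ∫⁻ x, ENNReal.ofReal (x ^ 2) ∂(gaussianReal 0 v) = v := by
  rw [← ofReal_integral_eq_lintegral_ofReal (integrable_pow_gaussianReal v 2)
    (ae_of_all _ fun x => by positivity)]
  have := variance_fun_id_gaussianReal (μ := 0) (v := v)
  rw [variance_of_integral_eq_zero (by fun_prop) (by simp)] at this
  simp [this]

theorem lintegral_inputLaw_sq (d : ℕ) (i : Fin d) :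
    ∫⁻ q, ENNReal.ofReal (q i ^ 2) ∂(ICL.inputLaw d) = (d : ENNReal)⁻¹ := by
  have h := measurePreserving_eval (fun _ : Fin d => gaussianReal 0 ((d : ℝ≥0)⁻¹)) i
  have := h.lintegral_comp (f := fun x => ENNReal.ofReal (x ^ 2)) (by fun_prop)
  rw [lintegral_gaussianReal_sq, ENNReal.coe_inv (by have := i.pos; positivity)] at this
  rw [ICL.inputLaw]
  simpa using this

theorem integral_inputLaw_eval (d : ℕ) (i : Fin d) : ∫ q, q i ∂(ICL.inputLaw d) = 0 := by
  have h := measurePreserving_eval (fun _ : Fin d => gaussianReal 0 ((d : ℝ≥0)⁻¹)) i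
  have h2 : ∫ x, x ∂(gaussianReal 0 ((d : ℝ≥0)⁻¹)) = 0 := by simp
  rw [← h.map_eq, integral_map h.measurable.aemeasurable (by fun_prop)] at h2
  exact h2

theorem vecH_eq (σs : ℝ → ℝ) (ξ : Fin d → ℝ) (z : (Fin (ℓ + 1) → Fin d → ℝ) × (Fin ℓ → ℝ))
    (p : Fin (d + 1) × Fin d) :
    ICL.vecH σs ξ z p = rowOfContext σs ξ (splitPrompt z).1 p.1 * (splitPrompt z).2 p.2 := by
  rw [mul_comm]
  rfl

theorem measurable_splitPrompt :
    Measurable (splitPrompt (d := d) (ℓ := ℓ)) := by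
  unfold splitPrompt; fun_prop

theorem measurable_vecH (hσ : Measurable σs) (p : Fin (d + 1) × Fin d) :
    Measurable fun w : (Fin d → ℝ) × ((Fin (ℓ + 1) → Fin d → ℝ) × (Fin ℓ → ℝ)) =>
      ICL.vecH σs w.1 w.2 p := by
  simp only [vecH_eq]
  have hs : Measurable fun w : (Fin d → ℝ) × ((Fin (ℓ + 1) → Fin d → ℝ) × (Fin ℓ → ℝ)) =>
      splitPrompt w.2 := measurable_splitPrompt.comp measurable_snd
  have hp : Measurable fun w : (Fin d → ℝ) × ((Fin (ℓ + 1) → Fin d → ℝ) × (Fin ℓ → ℝ)) =>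
      (w.1, (splitPrompt w.2).1) := measurable_fst.prodMk hs.fst
  have h1 := (measurable_rowOfContext_uncurry (ℓ := ℓ) hσ).comp hp
  have h2 := hs.snd
  exact ((measurable_pi_apply p.1).comp h1).mul ((measurable_pi_apply p.2).comp h2)

/-- The trace of the feature covariance is the second moment of the context row. -/
theorem ofReal_trace_featureCov (hσ : Measurable σs) (hd : 1 ≤ d)
    (hcov : ∀ p : Fin (d + 1) × Fin d,
      MemLp (fun w : (Fin d → ℝ) × ((Fin (ℓ + 1) → Fin d → ℝ) × (Fin ℓ → ℝ)) =>
        ICL.vecH σs w.1 w.2 p) 2 ((ICL.taskLaw d).prod (ICL.promptLaw d ℓ ρ))) :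
    ENNReal.ofReal (ICL.featureCov d ℓ ρ σs).trace =
      ∫⁻ ξ, ∫⁻ c, ENNReal.ofReal (rowOfContext σs ξ c ⬝ᵥ rowOfContext σs ξ c)
        ∂(contextLaw d ℓ ρ) ∂(ICL.taskLaw d) := by
  have hmrow := measurable_rowOfContext_uncurry (d := d) (ℓ := ℓ) hσ
  have hsp := measurePreserving_splitPrompt d ℓ ρ
  -- Every coordinate of `vec(H_Z)` has the centered query as an independent factor, so it is
  -- centered and its variance is its second moment.
  have hmean : ∀ p : Fin (d + 1) × Fin d, ∫ w, ICL.vecH σs w.1 w.2 p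
      ∂((ICL.taskLaw d).prod (ICL.promptLaw d ℓ ρ)) = 0 := by
    intro p
    have hi := (hcov p).integrable (by norm_num)
    rw [integral_prod _ hi]
    refine integral_eq_zero_of_ae (ae_of_all _ fun ξ => ?_)
    simp only [vecH_eq, Pi.zero_apply]
    have hm : Measurable fun y : ((Fin ℓ → Fin d → ℝ) × (Fin ℓ → ℝ)) × (Fin d → ℝ) =>
        rowOfContext σs ξ y.1 p.1 * y.2 p.2 := by
      have := measurable_rowOfContext (ℓ := ℓ) hσ ξ
      fun_prop
    have := integral_map (μ := ICL.promptLaw d ℓ ρ) hsp.measurable.aemeasurable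
      (f := fun y => rowOfContext σs ξ y.1 p.1 * y.2 p.2) hm.aestronglyMeasurable
    rw [← this, hsp.map_eq, integral_prod_mul (fun c => rowOfContext σs ξ c p.1)
      (fun q : Fin d → ℝ => q p.2), integral_inputLaw_eval, mul_zero]
  have hvar : ∀ p : Fin (d + 1) × Fin d, ENNReal.ofReal (ICL.featureCov d ℓ ρ σs p p) =
      (∫⁻ ξ, ∫⁻ c, ENNReal.ofReal (rowOfContext σs ξ c p.1 ^ 2) ∂(contextLaw d ℓ ρ)
        ∂(ICL.taskLaw d)) * (d : ENNReal)⁻¹ := by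
    intro p
    have hm := measurable_vecH (ℓ := ℓ) hσ p
    have hrow : Measurable fun w : (Fin d → ℝ) × ((Fin ℓ → Fin d → ℝ) × (Fin ℓ → ℝ)) =>
        ENNReal.ofReal (rowOfContext σs w.1 w.2 p.1 ^ 2) := by fun_prop
    rw [ICL.featureCov, Matrix.of_apply, covariance_self hm.aemeasurable,
      variance_of_integral_eq_zero hm.aemeasurable (hmean p),
      ofReal_integral_eq_lintegral_ofReal (hcov p).integrable_sq
        (ae_of_all _ fun w => sq_nonneg _), lintegral_prod _ (by fun_prop),
      ← lintegral_mul_const _ hrow.lintegral_prod_right']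
    refine lintegral_congr fun ξ => ?_
    simp only [vecH_eq]
    have hr : Measurable fun c : (Fin ℓ → Fin d → ℝ) × (Fin ℓ → ℝ) =>
        rowOfContext σs ξ c p.1 := by
      have := measurable_rowOfContext (ℓ := ℓ) hσ ξ
      fun_prop
    have := hsp.lintegral_comp
      (f := fun y => ENNReal.ofReal ((rowOfContext σs ξ y.1 p.1 * y.2 p.2) ^ 2)) (by fun_prop)
    rw [this]
    simp only [mul_pow]
    simp_rw [ENNReal.ofReal_mul (sq_nonneg _)]
    have hq : Measurable fun q : Fin d → ℝ => ENNReal.ofReal (q p.2 ^ 2) := by fun_prop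
    rw [lintegral_prod_mul (f := fun c => ENNReal.ofReal (rowOfContext σs ξ c p.1 ^ 2))
      (g := fun q : Fin d → ℝ => ENNReal.ofReal (q p.2 ^ 2)) (by fun_prop) hq.aemeasurable,
      lintegral_inputLaw_sq]
  have hnn : ∀ p : Fin (d + 1) × Fin d, 0 ≤ ICL.featureCov d ℓ ρ σs p p := by
    intro p
    rw [ICL.featureCov, Matrix.of_apply,
      covariance_self (measurable_vecH (ℓ := ℓ) hσ p).aemeasurable]
    exact variance_nonneg _ _
  simp only [Matrix.trace, Matrix.diag_apply]
  rw [ENNReal.ofReal_sum_of_nonneg fun p _ => hnn p]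
  simp only [hvar]
  rw [Fintype.sum_prod_type]
  simp only [Finset.sum_const, Finset.card_univ, Fintype.card_fin, nsmul_eq_mul]
  have hd0 : (d : ENNReal) ≠ 0 := by simp; omega
  -- The `d` row indices share the same bound-free summand, each with the factor `1 / d` from the
  -- variance of a query coordinate.
  have hcancel : ∀ x : ENNReal, d * (x * (d : ENNReal)⁻¹) = x := by
    intro x
    rw [mul_comm x, ← mul_assoc, ENNReal.mul_inv_cancel hd0 (ENNReal.natCast_ne_top d), one_mul]
  simp only [hcancel]
  have hrow : ∀ j, Measurable fun w : (Fin d → ℝ) × ((Fin ℓ → Fin d → ℝ) × (Fin ℓ → ℝ)) =>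
      ENNReal.ofReal (rowOfContext σs w.1 w.2 j ^ 2) := fun j => by fun_prop
  rw [← lintegral_finsetSum _ fun j _ => (hrow j).lintegral_prod_right']
  refine lintegral_congr fun ξ => ?_
  have hr := measurable_rowOfContext (ℓ := ℓ) hσ ξ
  rw [← lintegral_finsetSum _ fun j _ => by fun_prop]
  refine lintegral_congr fun c => ?_
  rw [← ENNReal.ofReal_sum_of_nonneg fun j _ => sq_nonneg _]
  simp only [dotProduct, sq]

/-- The normalized second moment of the context row, given the normalized squared norm `s` of the
task vector. -/
noncomputable def rowMean (σs : ℝ → ℝ) (ρ : ℝ≥0) (d ℓ : ℕ) (s : ℝ) : ℝ :=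
  (1 / ℓ) * (labelMixed σs ρ s / s) + (1 - 1 / ℓ) * (labelCorr σs ρ s ^ 2 / s) +
    (d / ℓ) * (1 - 1 / d) * labelSecond σs ρ s +
    (1 / d) * ((1 / ℓ) * (labelFourth σs ρ s).toReal + (1 - 1 / ℓ) * labelSecond σs ρ s ^ 2)

/-- The quantity is the squared norm of the projection of `x` onto the complement of `ξ`. For `ξ =
0` the convention `0 / 0 = 0` leaves `x ⬝ᵥ x`. -/
theorem dotProduct_sub_proj_nonneg (ξ x : Fin d → ℝ) :
    0 ≤ x ⬝ᵥ x - (ξ ⬝ᵥ x) ^ 2 / (ξ ⬝ᵥ ξ) := by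
  have hnn : 0 ≤ ξ ⬝ᵥ ξ := Finset.sum_nonneg fun i _ => mul_self_nonneg _
  rcases hnn.eq_or_lt with h | h
  · rw [← h, div_zero, sub_zero]
    exact Finset.sum_nonneg fun i _ => mul_self_nonneg _
  · have h1 : 0 ≤ (x - ((ξ ⬝ᵥ x) / (ξ ⬝ᵥ ξ)) • ξ) ⬝ᵥ (x - ((ξ ⬝ᵥ x) / (ξ ⬝ᵥ ξ)) • ξ) :=
      Finset.sum_nonneg fun i _ => mul_self_nonneg _
    refine h1.trans (le_of_eq ?_)
    simp only [dotProduct_sub, sub_dotProduct, smul_dotProduct,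
      dotProduct_smul, smul_eq_mul, dotProduct_comm x ξ]
    field_simp
    ring

theorem rowNormSq_nonneg (ξ : Fin d → ℝ) (w : Fin ℓ → ℝ × ℝ) (x : Fin d → ℝ) :
    0 ≤ rowNormSq σs ξ w x := by
  have := dotProduct_sub_proj_nonneg ξ x
  have hnn : 0 ≤ ξ ⬝ᵥ ξ := Finset.sum_nonneg fun i _ => mul_self_nonneg _
  have : 0 ≤ ∑ i, noisyLabel σs (w i) ^ 2 := Finset.sum_nonneg fun i _ => sq_nonneg _
  unfold rowNormSq
  positivity

theorem integral_dotProduct_self_inputLaw (hd : 1 ≤ d) :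
    Integrable (fun x : Fin d → ℝ => x ⬝ᵥ x) (ICL.inputLaw d) ∧
      ∫ x, x ⬝ᵥ x ∂(ICL.inputLaw d) = 1 := by
  have hd0 : (0 : ℝ) < d := by exact_mod_cast hd
  have h4 : Integrable (fun x : ℝ => (x ^ 2) ^ 2) (gaussianReal 0 ((d : ℝ≥0)⁻¹)) := by
    simp only [← pow_mul]; exact integrable_pow_gaussianReal _ 4
  obtain ⟨h1, h2, -⟩ := moments_two_sum_pi (f := fun x : ℝ => x ^ 2) (by fun_prop) h4 d
  have e : ∀ x : Fin d → ℝ, x ⬝ᵥ x = ∑ i, x i ^ 2 := fun x => by simp [dotProduct, sq]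
  have hm : Measurable fun x : Fin d → ℝ => ∑ i, x i ^ 2 := by fun_prop
  refine ⟨?_, ?_⟩
  · simp only [e]
    exact ((memLp_two_iff_integrable_sq hm.aestronglyMeasurable).2 h1).integrable (by norm_num)
  · simp only [e]
    rw [ICL.inputLaw, h2]
    have := variance_fun_id_gaussianReal (μ := 0) (v := (d : ℝ≥0)⁻¹)
    rw [variance_of_integral_eq_zero (by fun_prop) (by simp)] at this
    rw [this]
    push_cast
    field_simp

theorem integral_dotProduct_sq_inputLaw (ξ : Fin d → ℝ) :
    Integrable (fun x : Fin d → ℝ => (ξ ⬝ᵥ x) ^ 2) (ICL.inputLaw d) ∧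
      ∫ x, (ξ ⬝ᵥ x) ^ 2 ∂(ICL.inputLaw d) = ξ ⬝ᵥ ξ / d := by
  have hnn : 0 ≤ ξ ⬝ᵥ ξ := Finset.sum_nonneg fun i _ => mul_self_nonneg _
  have hw : ((((d : ℝ≥0)⁻¹) * (ξ ⬝ᵥ ξ).toNNReal : ℝ≥0) : ℝ) = ((d : ℝ≥0)⁻¹ : ℝ≥0) * (ξ ⬝ᵥ ξ) := by
    rw [NNReal.coe_mul, Real.coe_toNNReal _ hnn]
  have hmap := isoGaussian_map_dotProduct _ _ ξ hw
  have hm : Measurable fun x : Fin d → ℝ => ξ ⬝ᵥ x := by unfold dotProduct; fun_prop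
  have hi := integrable_pow_gaussianReal ((d : ℝ≥0)⁻¹ * (ξ ⬝ᵥ ξ).toNNReal) 2
  have hv := variance_fun_id_gaussianReal (μ := 0) (v := (d : ℝ≥0)⁻¹ * (ξ ⬝ᵥ ξ).toNNReal)
  rw [variance_of_integral_eq_zero (by fun_prop) (by simp)] at hv
  rw [← hmap] at hi hv
  rw [integrable_map_measure (by fun_prop) hm.aemeasurable] at hi
  rw [integral_map hm.aemeasurable (by fun_prop)] at hv
  refine ⟨hi, hv.trans ?_⟩
  rw [hw]
  push_cast
  ring

/-- `rowMean` is obtained by integrating the three terms of `rowNormSq`: the squared sums by the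
i.i.d. moment formulas, the orthogonal part by `E (|x|² - (ξ · x)² / |ξ|²) = 1 - 1 / d`. -/
theorem lintegral_rowOfContext_sq (hσ : Measurable σs) (hd : 1 ≤ d) (hℓ : 1 ≤ ℓ)
    {ξ : Fin d → ℝ} (hξ : ξ ⬝ᵥ ξ ≠ 0) (h4 : labelFourth σs ρ (ξ ⬝ᵥ ξ / d) < ⊤) :
    ∫⁻ c, ENNReal.ofReal (rowOfContext σs ξ c ⬝ᵥ rowOfContext σs ξ c) ∂(contextLaw d ℓ ρ) =
      ENNReal.ofReal (d * rowMean σs ρ d ℓ (ξ ⬝ᵥ ξ / d)) := by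
  have hd0 : (0 : ℝ) < d := by exact_mod_cast hd
  have hℓ0 : (0 : ℝ) < ℓ := by exact_mod_cast hℓ
  have hmn := measurable_rowNormSq (ℓ := ℓ) hσ ξ
  have e1 := lintegral_map (μ := contextLaw d ℓ ρ) ENNReal.measurable_ofReal
    (measurable_rowOfContext_sq hσ ξ)
  rw [← e1, map_rowOfContext_sq hσ hd hξ, lintegral_map ENNReal.measurable_ofReal hmn]
  set s := ξ ⬝ᵥ ξ / d with hs
  have hξs : ξ ⬝ᵥ ξ = d * s := by rw [hs]; field_simp
  have hs0 : s ≠ 0 := by rintro h; rw [h, mul_zero] at hξs; exact hξ hξs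
  obtain ⟨a1, -, a3⟩ := moments_two_sum_pi (μ := labelLaw ρ s)
    (f := fun w => noisyLabel σs w * w.1) (by fun_prop) (integrable_label_mixed hσ h4) ℓ
  have h4' : Integrable (fun w => (noisyLabel σs w ^ 2) ^ 2) (labelLaw ρ s) := by
    simp only [← pow_mul]; exact integrable_label_four hσ h4
  obtain ⟨b1, b2, b3⟩ := moments_two_sum_pi (μ := labelLaw ρ s)
    (f := fun w => noisyLabel σs w ^ 2) (by fun_prop) h4' ℓ
  obtain ⟨x1, x2⟩ := integral_dotProduct_self_inputLaw hd
  obtain ⟨y1, y2⟩ := integral_dotProduct_sq_inputLaw ξ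
  set π := Measure.pi fun _ : Fin ℓ => labelLaw ρ s
  have hmB : Measurable fun w : Fin ℓ → ℝ × ℝ => ∑ i, noisyLabel σs (w i) ^ 2 := by fun_prop
  have b0 : Integrable (fun w : Fin ℓ → ℝ × ℝ => ∑ i, noisyLabel σs (w i) ^ 2) π :=
    ((memLp_two_iff_integrable_sq hmB.aestronglyMeasurable).2 b1).integrable (by norm_num)
  have xy : Integrable (fun x : Fin d → ℝ => x ⬝ᵥ x - (ξ ⬝ᵥ x) ^ 2 / (ξ ⬝ᵥ ξ))
      (ICL.inputLaw d) := x1.sub (y1.div_const _)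
  have exy : ∫ x : Fin d → ℝ, (x ⬝ᵥ x - (ξ ⬝ᵥ x) ^ 2 / (ξ ⬝ᵥ ξ)) ∂(ICL.inputLaw d) =
      1 - 1 / d := by
    rw [integral_sub x1 (y1.div_const _), integral_div, x2, y2]
    field_simp
  have e : ∀ p : (Fin ℓ → ℝ × ℝ) × (Fin d → ℝ), rowNormSq σs ξ p.1 p.2 =
      ((d : ℝ) / ℓ) ^ 2 / (ξ ⬝ᵥ ξ) * ((∑ i, noisyLabel σs (p.1 i) * (p.1 i).1) ^ 2) +
      ((d : ℝ) / ℓ) ^ 2 * ((∑ i, noisyLabel σs (p.1 i) ^ 2) *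
        (p.2 ⬝ᵥ p.2 - (ξ ⬝ᵥ p.2) ^ 2 / (ξ ⬝ᵥ ξ))) +
      (1 / (ℓ : ℝ)) ^ 2 * (∑ i, noisyLabel σs (p.1 i) ^ 2) ^ 2 := by
    intro p; unfold rowNormSq; ring
  have c1 : Integrable (fun p : (Fin ℓ → ℝ × ℝ) × (Fin d → ℝ) =>
      ((d : ℝ) / ℓ) ^ 2 / (ξ ⬝ᵥ ξ) * ((∑ i, noisyLabel σs (p.1 i) * (p.1 i).1) ^ 2))
      (π.prod (ICL.inputLaw d)) := (a1.comp_fst _).const_mul _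
  have c2 : Integrable (fun p : (Fin ℓ → ℝ × ℝ) × (Fin d → ℝ) =>
      ((d : ℝ) / ℓ) ^ 2 * ((∑ i, noisyLabel σs (p.1 i) ^ 2) *
        (p.2 ⬝ᵥ p.2 - (ξ ⬝ᵥ p.2) ^ 2 / (ξ ⬝ᵥ ξ))))
      (π.prod (ICL.inputLaw d)) := (b0.mul_prod xy).const_mul _
  have c3 : Integrable (fun p : (Fin ℓ → ℝ × ℝ) × (Fin d → ℝ) =>
      (1 / (ℓ : ℝ)) ^ 2 * (∑ i, noisyLabel σs (p.1 i) ^ 2) ^ 2)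
      (π.prod (ICL.inputLaw d)) := (b1.comp_fst _).const_mul _
  have c12 : Integrable (fun p : (Fin ℓ → ℝ × ℝ) × (Fin d → ℝ) =>
      ((d : ℝ) / ℓ) ^ 2 / (ξ ⬝ᵥ ξ) * ((∑ i, noisyLabel σs (p.1 i) * (p.1 i).1) ^ 2) +
      ((d : ℝ) / ℓ) ^ 2 * ((∑ i, noisyLabel σs (p.1 i) ^ 2) *
        (p.2 ⬝ᵥ p.2 - (ξ ⬝ᵥ p.2) ^ 2 / (ξ ⬝ᵥ ξ))))
      (π.prod (ICL.inputLaw d)) := c1.add c2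
  have hint : Integrable (fun p : (Fin ℓ → ℝ × ℝ) × (Fin d → ℝ) => rowNormSq σs ξ p.1 p.2)
      (π.prod (ICL.inputLaw d)) := by
    simp only [e]
    exact c12.add c3
  rw [← ofReal_integral_eq_lintegral_ofReal hint (ae_of_all _ fun p => rowNormSq_nonneg _ _ _)]
  congr 1
  simp only [e]
  rw [integral_add c12 c3, integral_add c1 c2, integral_const_mul, integral_const_mul,
    integral_const_mul,
    integral_fun_fst (fun w : Fin ℓ → ℝ × ℝ => (∑ i, noisyLabel σs (w i) * (w i).1) ^ 2),
    integral_fun_fst (fun w : Fin ℓ → ℝ × ℝ => (∑ i, noisyLabel σs (w i) ^ 2) ^ 2),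
    integral_prod_mul (fun w : Fin ℓ → ℝ × ℝ => ∑ i, noisyLabel σs (w i) ^ 2)
      (fun x : Fin d → ℝ => x ⬝ᵥ x - (ξ ⬝ᵥ x) ^ 2 / (ξ ⬝ᵥ ξ)), exy, a3, b2, b3, hξs]
  have hf : ∫ w, (noisyLabel σs w ^ 2) ^ 2 ∂(labelLaw ρ s) = (labelFourth σs ρ s).toReal := by
    simp only [← pow_mul]; exact integral_label_four hσ h4
  rw [hf]
  change _ * (_ • (ℓ * labelMixed σs ρ s + ℓ * (ℓ - 1) * labelCorr σs ρ s ^ 2)) +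
    _ * ((ℓ * labelSecond σs ρ s) * (1 - 1 / d)) +
    _ * (_ • (ℓ * (labelFourth σs ρ s).toReal + ℓ * (ℓ - 1) * labelSecond σs ρ s ^ 2)) = _
  simp only [probReal_univ, one_smul]
  unfold rowMean
  field_simp

/-- Finite second moments of the features force a finite fourth moment of the labels. -/
theorem lintegral_labelFourth_ne_top (hσ : Measurable σs) (hd : 1 ≤ d) (hℓ : 1 ≤ ℓ)
    (hfin : ∫⁻ ξ, ∫⁻ c, ENNReal.ofReal (rowOfContext σs ξ c ⬝ᵥ rowOfContext σs ξ c)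
        ∂(contextLaw d ℓ ρ) ∂(ICL.taskLaw d) ≠ ⊤) (hξ : ∀ᵐ ξ ∂(ICL.taskLaw d), ξ ⬝ᵥ ξ ≠ 0) :
    ∫⁻ x, labelFourth σs ρ (x ⬝ᵥ x / d) ∂(ICL.taskLaw d) ≠ ⊤ := by
  have hℓ0 : (0 : ℝ) < ℓ := by exact_mod_cast hℓ
  have hkey : ∀ᵐ ξ ∂(ICL.taskLaw d), ENNReal.ofReal ((1 / (ℓ : ℝ)) ^ 2) *
      labelFourth σs ρ (ξ ⬝ᵥ ξ / d) ≤
      ∫⁻ c, ENNReal.ofReal (rowOfContext σs ξ c ⬝ᵥ rowOfContext σs ξ c) ∂(contextLaw d ℓ ρ) := by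
    filter_upwards [hξ] with ξ h
    have e1 := lintegral_map (μ := contextLaw d ℓ ρ) ENNReal.measurable_ofReal
      (measurable_rowOfContext_sq hσ ξ)
    rw [← e1, map_rowOfContext_sq hσ hd h,
      lintegral_map ENNReal.measurable_ofReal (measurable_rowNormSq hσ ξ)]
    have hev := (measurePreserving_eval
      (fun _ : Fin ℓ => labelLaw ρ (ξ ⬝ᵥ ξ / d)) ⟨0, hℓ⟩).comp
      (measurePreserving_fst (μ := Measure.pi fun _ : Fin ℓ => labelLaw ρ (ξ ⬝ᵥ ξ / d))
        (ν := ICL.inputLaw d))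
    have hm : Measurable fun w => ENNReal.ofReal (noisyLabel σs w ^ 4) := by fun_prop
    have hmc : Measurable fun p : (Fin ℓ → ℝ × ℝ) × (Fin d → ℝ) =>
        ENNReal.ofReal (noisyLabel σs ((Function.eval (⟨0, hℓ⟩ : Fin ℓ) ∘ Prod.fst) p) ^ 4) :=
      hm.comp hev.measurable
    rw [labelFourth, ← hev.lintegral_comp hm, ← lintegral_const_mul _ hmc]
    refine lintegral_mono fun p => ?_
    rw [← ENNReal.ofReal_mul (by positivity)]
    refine ENNReal.ofReal_le_ofReal ?_
    have h1 := dotProduct_sub_proj_nonneg ξ p.2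
    have hnn : 0 ≤ ξ ⬝ᵥ ξ := Finset.sum_nonneg fun i _ => mul_self_nonneg _
    have h2 : noisyLabel σs (p.1 ⟨0, hℓ⟩) ^ 2 ≤ ∑ i, noisyLabel σs (p.1 i) ^ 2 :=
      Finset.single_le_sum (f := fun i => noisyLabel σs (p.1 i) ^ 2)
        (fun i _ => sq_nonneg _) (Finset.mem_univ _)
    have h3 : 0 ≤ ∑ i, noisyLabel σs (p.1 i) ^ 2 := (sq_nonneg _).trans h2
    have h4 : 0 ≤ ((d : ℝ) / ℓ) ^ 2 * ((∑ i, noisyLabel σs (p.1 i) * (p.1 i).1) ^ 2 / (ξ ⬝ᵥ ξ) +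
      (∑ i, noisyLabel σs (p.1 i) ^ 2) * (p.2 ⬝ᵥ p.2 - (ξ ⬝ᵥ p.2) ^ 2 / (ξ ⬝ᵥ ξ))) := by
      positivity
    -- The square of the last entry of the row, `(∑ y_i² / ℓ)²`, already dominates the fourth power
    -- of one label divided by `ℓ²`.
    have h5 : noisyLabel σs (p.1 ⟨0, hℓ⟩) ^ 4 ≤ (∑ i, noisyLabel σs (p.1 i) ^ 2) ^ 2 := by
      have := pow_le_pow_left₀ (sq_nonneg _) h2 2
      rwa [← pow_mul] at this
    unfold rowNormSq
    rw [mul_pow]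
    have h6 := mul_le_mul_of_nonneg_left h5 (by positivity : 0 ≤ (1 / (ℓ : ℝ)) ^ 2)
    simp only [Function.comp_apply, Function.eval]
    linarith
  have hlt := (lintegral_mono_ae hkey).trans_lt (lt_top_iff_ne_top.2 hfin)
  have hms : Measurable fun x : Fin d → ℝ => labelFourth σs ρ (x ⬝ᵥ x / d) := by
    refine (measurable_labelFourth hσ).comp ?_
    unfold dotProduct; fun_prop
  rw [lintegral_const_mul _ hms] at hlt
  intro htop
  rw [htop, ENNReal.mul_top (by simpa using hℓ0.ne')] at hlt
  exact lt_irrefl _ hlt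

end Trace

/-! ### Linear growth of the trace -/

section TraceLimit

variable {σs : ℝ → ℝ} {ρ : ℝ≥0}

theorem ae_dotProduct_self_pos {d : ℕ} (hd : 1 ≤ d) :
    ∀ᵐ ξ ∂(ICL.taskLaw d), 0 < ξ ⬝ᵥ ξ := by
  have := nullSingletonClass_gaussianReal (μ := 0) (v := 1) one_ne_zero
  have h := measurePreserving_eval (fun _ : Fin d => gaussianReal 0 1) ⟨0, hd⟩
  have h0 : ∀ᵐ x ∂(gaussianReal 0 1), x ≠ 0 := by
    simp only [ae_iff, not_not, Set.ofPred_eq_eq_singleton]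
    exact measure_singleton 0
  have := h.quasiMeasurePreserving.ae h0
  rw [ICL.taskLaw]
  filter_upwards [this] with ξ hξ
  refine lt_of_lt_of_le (mul_self_pos.2 hξ)
    (Finset.single_le_sum (f := fun i => ξ i * ξ i) (fun i _ => mul_self_nonneg _)
      (Finset.mem_univ (⟨0, hd⟩ : Fin d)))

theorem measurable_normSq_div (d : ℕ) : Measurable fun x : Fin d → ℝ => x ⬝ᵥ x / d := by
  unfold dotProduct; fun_prop

theorem exists_lintegral_normSq_sub_one_le : ∃ C : ℝ, 0 ≤ C ∧ ∀ d : ℕ, 1 ≤ d →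
    ∫⁻ x, ENNReal.ofReal ((x ⬝ᵥ x / d - 1) ^ 4) ∂(ICL.taskLaw d) ≤
      ENNReal.ofReal (C / d ^ 2) := by
  obtain ⟨C, hC, h⟩ := exists_moment_four_chi_sq_le
  refine ⟨C, hC, fun d hd => ?_⟩
  have hd0 : (0 : ℝ) < d := by exact_mod_cast hd
  have h1 := h d 1
  have e : ∀ x : Fin d → ℝ, ENNReal.ofReal ((x ⬝ᵥ x / d - 1) ^ 4) =
      ENNReal.ofReal (1 / d ^ 4) * ENNReal.ofReal ((x ⬝ᵥ x - d * (1 : ℝ≥0)) ^ 4) := by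
    intro x
    rw [← ENNReal.ofReal_mul (by positivity)]
    congr 1
    push_cast
    field_simp
  simp_rw [e]
  have hm : Measurable fun x : Fin d → ℝ =>
      ENNReal.ofReal ((x ⬝ᵥ x - d * (1 : ℝ≥0)) ^ 4) := by
    unfold dotProduct; fun_prop
  rw [lintegral_const_mul _ hm]
  calc _ ≤ ENNReal.ofReal (1 / d ^ 4) * ENNReal.ofReal (C * d ^ 2 * (1 : ℝ≥0) ^ 4) := by
        gcongr
        exact h1
    _ = _ := by
        rw [← ENNReal.ofReal_mul (by positivity)]
        congr 1
        push_cast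
        field_simp

variable {d : ℕ → ℕ}

/-- Domination by the law in dimension `d₀` bounds the mean fourth moment by a multiple of `√d`,
which `1 / d` beats. Finiteness in one dimension thus controls all larger ones. -/
theorem tendsto_lintegral_labelFourth_div (hσ : Measurable σs)
    (hd : Tendsto (fun n => (d n : ℝ)) atTop atTop) {d₀ : ℕ} (h0 : 1 ≤ d₀)
    (hfin : ∫⁻ x, labelFourth σs ρ (x ⬝ᵥ x / d₀) ∂(ICL.taskLaw d₀) ≠ ⊤) :
    Tendsto (fun n => ENNReal.ofReal (1 / d n) *
      ∫⁻ x, labelFourth σs ρ (x ⬝ᵥ x / d n) ∂(ICL.taskLaw (d n))) atTop (𝓝 0) := by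
  obtain ⟨C, hC, h⟩ := exists_lintegral_normSq_le h0
  have hlim : Tendsto (fun n => ENNReal.ofReal (C * (√(d n))⁻¹) *
      ∫⁻ x, labelFourth σs ρ (x ⬝ᵥ x / d₀) ∂(ICL.taskLaw d₀)) atTop (𝓝 0) := by
    have h1 := (tendsto_inv_atTop_zero.comp (Real.tendsto_sqrt_atTop.comp hd)).const_mul C
    rw [mul_zero] at h1
    have h2 := (ENNReal.continuous_ofReal.tendsto _).comp h1
    rw [ENNReal.ofReal_zero] at h2
    have := ENNReal.Tendsto.mul_const h2 (Or.inr hfin)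
    rw [zero_mul] at this
    exact this
  refine tendsto_of_tendsto_of_tendsto_of_le_of_le' tendsto_const_nhds hlim
    (Eventually.of_forall fun _ => zero_le) ?_
  filter_upwards [hd.eventually_ge_atTop (d₀ : ℝ), hd.eventually_gt_atTop 0] with n hn hn0
  have := h (d n) (by exact_mod_cast hn) _ (measurable_labelFourth (ρ := ρ) hσ)
  calc _ ≤ ENNReal.ofReal (1 / d n) * (ENNReal.ofReal (C * √(d n)) *
        ∫⁻ x, labelFourth σs ρ (x ⬝ᵥ x / d₀) ∂(ICL.taskLaw d₀)) := by
        gcongr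
        exact this
    _ = _ := by
        rw [← mul_assoc, ← ENNReal.ofReal_mul (by positivity)]
        congr 2
        have := Real.sq_sqrt hn0.le
        have h3 : √(d n : ℝ) ≠ 0 := (Real.sqrt_pos.2 hn0).ne'
        field_simp
        rw [this, mul_comm]

/-- Expectations of functions of the normalized squared norm converge to their value at `1`, for
functions whose square has a slowly growing expectation. -/
theorem tendsto_lintegral_normSq (hd : Tendsto (fun n => (d n : ℝ)) atTop atTop)
    {h : ℝ → ℝ} (hc : ContinuousAt h 1) {M : ℝ → ENNReal} (hM : Measurable M)
    (hle : ∀ s, 0 < s → ENNReal.ofReal (h s ^ 2) ≤ M s)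
    (hMlim : Tendsto (fun n => ENNReal.ofReal (1 / d n) *
      ∫⁻ x, M (x ⬝ᵥ x / d n) ∂(ICL.taskLaw (d n))) atTop (𝓝 0)) :
    Tendsto (fun n => ∫⁻ x, ENNReal.ofReal |h (x ⬝ᵥ x / d n) - h 1| ∂(ICL.taskLaw (d n)))
      atTop (𝓝 0) := by
  obtain ⟨C, hC, hchi⟩ := exists_lintegral_normSq_sub_one_le
  refine ENNReal.tendsto_nhds_zero.2 fun ε hε => ?_
  obtain ⟨δ, hδ0, hδ⟩ : ∃ δ : ℝ, 0 < δ ∧ ENNReal.ofReal δ ≤ ε / 2 := by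
    rcases eq_or_ne ε ⊤ with rfl | hne
    · exact ⟨1, one_pos, by rw [ENNReal.top_div_of_ne_top (by simp)]; exact le_top⟩
    · refine ⟨(ε / 2).toReal, ENNReal.toReal_pos (by simpa using hε.ne') ?_, ?_⟩
      · exact (ENNReal.div_lt_top hne (by simp)).ne
      · rw [ENNReal.ofReal_toReal (ENNReal.div_lt_top hne (by simp)).ne]
  obtain ⟨η, hη0, hη⟩ := Metric.continuousAt_iff.1 hc δ hδ0
  have hlim : Tendsto (fun n => ENNReal.ofReal (1 / d n) *
      ∫⁻ x, M (x ⬝ᵥ x / d n) ∂(ICL.taskLaw (d n)) +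
      ENNReal.ofReal ((d n + |h 1|) / η ^ 4 * (C / d n ^ 2))) atTop (𝓝 0) := by
    have h1 : Tendsto (fun n => 1 / (d n : ℝ)) atTop (𝓝 0) := by
      simpa only [one_div, Function.comp_def] using tendsto_inv_atTop_zero.comp hd
    have h2 : Tendsto (fun n => C / η ^ 4 * (1 / (d n : ℝ) + |h 1| * (1 / (d n : ℝ)) ^ 2)) atTop
        (𝓝 0) := by
      have := (h1.add ((h1.pow 2).const_mul |h 1|)).const_mul (C / η ^ 4)
      simpa using this
    have h3 := (ENNReal.continuous_ofReal.tendsto _).comp h2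
    rw [ENNReal.ofReal_zero] at h3
    have h4 := hMlim.add h3
    rw [add_zero] at h4
    refine h4.congr' ?_
    filter_upwards [hd.eventually_gt_atTop 0] with n hn
    simp only [Function.comp_apply]
    congr 2
    field_simp
  filter_upwards [(ENNReal.tendsto_nhds_zero.1 hlim) (ε / 2) (by simpa using hε.ne'),
    hd.eventually_ge_atTop 1] with n hn hn1
  have hd1 : 1 ≤ d n := by exact_mod_cast hn1
  have hd0 : (0 : ℝ) < d n := by linarith
  have hpt : ∀ᵐ x ∂(ICL.taskLaw (d n)), ENNReal.ofReal |h (x ⬝ᵥ x / d n) - h 1| ≤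
      ENNReal.ofReal δ + (ENNReal.ofReal (1 / d n) * M (x ⬝ᵥ x / d n) +
        ENNReal.ofReal ((d n + |h 1|) / η ^ 4) * ENNReal.ofReal ((x ⬝ᵥ x / d n - 1) ^ 4)) := by
    filter_upwards [ae_dotProduct_self_pos hd1] with x hx
    set s := x ⬝ᵥ x / d n with hs
    have hs0 : 0 < s := by positivity
    by_cases hclose : |s - 1| < η
    · have := hη (x := s) (by rwa [Real.dist_eq])
      rw [Real.dist_eq] at this
      exact (ENNReal.ofReal_le_ofReal this.le).trans le_self_add
    · push Not at hclose
      -- Away from `1`, Young's inequality `|h| ≤ h² / d + d` is used. The square is paid by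
      -- `hMlim`; the constant `d` is multiplied by `(s - 1)⁴ / η⁴ ≥ 1`, whose mean is `O(d⁻²)`.
      have h1 : |h s - h 1| ≤ 1 / d n * h s ^ 2 + (d n + |h 1|) / η ^ 4 * (s - 1) ^ 4 := by
        have h2 : 1 ≤ (s - 1) ^ 4 / η ^ 4 := by
          rw [one_le_div (by positivity), ← Even.pow_abs (by decide) (s - 1)]
          exact pow_le_pow_left₀ hη0.le hclose 4
        have h3 : |h s| ≤ 1 / d n * h s ^ 2 + d n := by
          have h4 : 1 / d n * h s ^ 2 + d n - |h s| =
              1 / d n * ((|h s| - d n / 2) ^ 2 + 3 / 4 * d n ^ 2) := by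
            rw [← sq_abs (h s)]
            field_simp
            ring
          have : 0 ≤ 1 / d n * ((|h s| - d n / 2) ^ 2 + 3 / 4 * (d n : ℝ) ^ 2) := by positivity
          linarith
        have h5 := abs_sub (h s) (h 1)
        have h6 : (d n + |h 1|) * 1 ≤ (d n + |h 1|) * ((s - 1) ^ 4 / η ^ 4) := by gcongr
        have h7 : (d n + |h 1|) * ((s - 1) ^ 4 / η ^ 4) =
            (d n + |h 1|) / η ^ 4 * (s - 1) ^ 4 := by ring
        linarith
      refine (ENNReal.ofReal_le_ofReal h1).trans (le_trans ?_ le_add_self)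
      rw [ENNReal.ofReal_add (by positivity) (by positivity), ENNReal.ofReal_mul (by positivity),
        ENNReal.ofReal_mul (by positivity)]
      gcongr
      exact hle s hs0
  have hm := measurable_normSq_div (d n)
  have hm4 : Measurable fun x : Fin (d n) → ℝ => ENNReal.ofReal ((x ⬝ᵥ x / d n - 1) ^ 4) := by
    fun_prop
  have hmM : Measurable fun x : Fin (d n) → ℝ => M (x ⬝ᵥ x / d n) := hM.comp hm
  calc _ ≤ _ := lintegral_mono_ae hpt
    _ = ENNReal.ofReal δ + (ENNReal.ofReal (1 / d n) *
        ∫⁻ x, M (x ⬝ᵥ x / d n) ∂(ICL.taskLaw (d n)) + ENNReal.ofReal ((d n + |h 1|) / η ^ 4) *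
        ∫⁻ x, ENNReal.ofReal ((x ⬝ᵥ x / d n - 1) ^ 4) ∂(ICL.taskLaw (d n))) := by
        rw [lintegral_add_left measurable_const, lintegral_add_right _ (hm4.const_mul _),
          lintegral_const_mul _ hmM, lintegral_const_mul _ hm4]
        simp
    _ ≤ ε / 2 + ε / 2 := by
        gcongr
        refine le_trans ?_ hn
        gcongr
        rw [ENNReal.ofReal_mul (by positivity)]
        gcongr
        exact hchi _ hd1
    _ = ε := ENNReal.add_halves ε

/-- The limit of the normalized squared norm of the context row. -/
noncomputable def rowLimit (σs : ℝ → ℝ) (ρ : ℝ≥0) (τ : ℝ) : ℝ :=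
  labelCorr σs ρ 1 ^ 2 + labelSecond σs ρ 1 / τ

theorem rowLimit_pos (hσ : Measurable σs) (hρ : 0 < ρ) {τ : ℝ} (hτ : 0 < τ)
    (h4 : labelFourth σs ρ 1 < ⊤) : 0 < rowLimit σs ρ τ := by
  have h := le_labelSecond hσ h4
  have hρ' : (0 : ℝ) < ρ := by exact_mod_cast hρ
  have : 0 < labelSecond σs ρ 1 := hρ'.trans_le h
  unfold rowLimit
  positivity

theorem labelSecond_nonneg (s : ℝ) : 0 ≤ labelSecond σs ρ s :=
  integral_nonneg fun _ => sq_nonneg _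

theorem labelMixed_nonneg (s : ℝ) : 0 ≤ labelMixed σs ρ s :=
  integral_nonneg fun _ => sq_nonneg _

theorem rowMean_nonneg {d ℓ : ℕ} (hd : 1 ≤ d) (hℓ : 1 ≤ ℓ) {s : ℝ} (hs : 0 < s) :
    0 ≤ rowMean σs ρ d ℓ s := by
  have hd0 : (1 : ℝ) ≤ d := by exact_mod_cast hd
  have hℓ0 : (1 : ℝ) ≤ ℓ := by exact_mod_cast hℓ
  have h1 : 0 ≤ 1 - 1 / (d : ℝ) := by
    rw [sub_nonneg, div_le_one (by linarith)]; exact hd0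
  have h2 : 0 ≤ 1 - 1 / (ℓ : ℝ) := by
    rw [sub_nonneg, div_le_one (by linarith)]; exact hℓ0
  have := labelSecond_nonneg (σs := σs) (ρ := ρ) s
  have := labelMixed_nonneg (σs := σs) (ρ := ρ) s
  unfold rowMean
  positivity

/-- The first two terms vanish by continuity of the label moments at `s = 1` and the third by `ℓ / d
→ τ`. The rest carries the factor `1 / ℓ + 1 / d` and is affine in the fourth moment, because the
fourth moment controls `labelMixed / s`, `labelCorr ^ 2 / s` and `labelSecond ^ 2`. -/
theorem abs_rowMean_sub_le (hσ : Measurable σs) {d ℓ : ℕ} (hd : 1 ≤ d) (hℓ : 1 ≤ ℓ) {s τ : ℝ}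
    (hs : 0 < s) (h4 : labelFourth σs ρ s < ⊤) :
    |rowMean σs ρ d ℓ s - rowLimit σs ρ τ| ≤
      |labelCorr σs ρ s ^ 2 / s - labelCorr σs ρ 1 ^ 2 / 1| +
      (d / ℓ) * (1 - 1 / d) * |labelSecond σs ρ s - labelSecond σs ρ 1| +
      |(d / ℓ) * (1 - 1 / d) - 1 / τ| * labelSecond σs ρ 1 +
      (1 / ℓ + 1 / d) * (2 * (labelFourth σs ρ s).toReal + (gaussianFourth + 1)) := by
  have hd0 : (1 : ℝ) ≤ d := by exact_mod_cast hd
  have hℓ0 : (1 : ℝ) ≤ ℓ := by exact_mod_cast hℓ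
  have hd1 : 0 ≤ 1 - 1 / (d : ℝ) := by
    rw [sub_nonneg, div_le_one (by linarith)]; exact hd0
  have hℓ1 : 0 ≤ 1 - 1 / (ℓ : ℝ) := by
    rw [sub_nonneg, div_le_one (by linarith)]; exact hℓ0
  have hi : 0 ≤ 1 / (ℓ : ℝ) := by positivity
  have hj : 0 ≤ 1 / (d : ℝ) := by positivity
  have hc : (0 : ℝ) ≤ d / ℓ := by positivity
  have hG := gaussianFourth_nonneg
  have hm2 := labelSecond_nonneg (σs := σs) (ρ := ρ) s
  have hm21 := labelSecond_nonneg (σs := σs) (ρ := ρ) 1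
  have hX : labelMixed σs ρ s / s ≤ (labelFourth σs ρ s).toReal + gaussianFourth := by
    rw [div_le_iff₀ hs, mul_comm]
    exact labelMixed_le hσ h4 hs
  have hX0 : 0 ≤ labelMixed σs ρ s / s := div_nonneg (labelMixed_nonneg _) hs.le
  have hb := labelCorr_sq_le hσ h4 hs
  have hb0 : 0 ≤ labelCorr σs ρ s ^ 2 / s := by positivity
  have hsq := labelSecond_sq_le hσ h4
  have hf0 : 0 ≤ (labelFourth σs ρ s).toReal := ENNReal.toReal_nonneg
  unfold rowMean rowLimit
  set X := labelMixed σs ρ s / s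
  set b := labelCorr σs ρ s ^ 2 / s
  set b1 := labelCorr σs ρ 1 ^ 2 / 1 with hb1
  have hb1' : labelCorr σs ρ 1 ^ 2 = b1 := by rw [hb1, div_one]
  rw [hb1']
  set m := labelSecond σs ρ s
  set m1 := labelSecond σs ρ 1
  set f := (labelFourth σs ρ s).toReal
  set c := (d / ℓ : ℝ) * (1 - 1 / d) with hcdef
  have hc0 : 0 ≤ c := mul_nonneg hc hd1
  set i := 1 / (ℓ : ℝ)
  set j := 1 / (d : ℝ)
  have hm_le : m ≤ f + 1 := by nlinarith [sq_nonneg (m - 1)]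
  have e : i * X + (1 - i) * b + c * m + j * (i * f + (1 - i) * m ^ 2) - (b1 + m1 / τ) =
      (b - b1) + c * (m - m1) + (c - 1 / τ) * m1 + (i * (X - b) + j * (i * f + (1 - i) * m ^ 2)) := by
    ring
  rw [e]
  have t1 : |c * (m - m1)| = c * |m - m1| := by rw [abs_mul, abs_of_nonneg hc0]
  have t2 : |(c - 1 / τ) * m1| = |c - 1 / τ| * m1 := by rw [abs_mul, abs_of_nonneg hm21]
  have hy : i * f + (1 - i) * m ^ 2 ≤ f := by nlinarith
  have hy0 : 0 ≤ i * f + (1 - i) * m ^ 2 := by positivity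
  have t3 : |i * (X - b) + j * (i * f + (1 - i) * m ^ 2)| ≤
      (i + j) * (2 * f + (gaussianFourth + 1)) := by
    have hXb : |X - b| ≤ 2 * f + (gaussianFourth + 1) := by
      rw [abs_le]; constructor <;> linarith
    calc _ ≤ |i * (X - b)| + |j * (i * f + (1 - i) * m ^ 2)| := abs_add_le _ _
      _ = i * |X - b| + j * (i * f + (1 - i) * m ^ 2) := by
        rw [abs_mul, abs_mul, abs_of_nonneg hi, abs_of_nonneg hj, abs_of_nonneg hy0]
      _ ≤ i * (2 * f + (gaussianFourth + 1)) + j * (2 * f + (gaussianFourth + 1)) := by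
        exact add_le_add (mul_le_mul_of_nonneg_left hXb hi)
          (mul_le_mul_of_nonneg_left (by linarith) hj)
      _ = _ := by ring
  have s1 := abs_add_le ((b - b1) + c * (m - m1) + (c - 1 / τ) * m1)
    (i * (X - b) + j * (i * f + (1 - i) * m ^ 2))
  have s2 := abs_add_le ((b - b1) + c * (m - m1)) ((c - 1 / τ) * m1)
  have s3 := abs_add_le (b - b1) (c * (m - m1))
  rw [t1] at s3
  rw [t2] at s2
  linarith

theorem measurable_rowMean (hσ : Measurable σs) (d ℓ : ℕ) : Measurable (rowMean σs ρ d ℓ) := by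
  have h1 := measurable_labelMixed (ρ := ρ) hσ
  have h2 := measurable_labelCorr (ρ := ρ) hσ
  have h3 := measurable_labelSecond (ρ := ρ) hσ
  have h4 := measurable_labelFourth (ρ := ρ) hσ
  unfold rowMean
  fun_prop

theorem labelFourth_one_lt_top {V : ℝ} (hσ : Measurable σs) (hV : 2 ≤ V)
    (h : labelFourth σs ρ V < ⊤) {s : ℝ} (hs : 1 / 2 ≤ s) (hs2 : s ≤ 2) :
    labelFourth σs ρ s < ⊤ :=
  (labelFourth_le hσ hs (hs2.trans hV)).trans_lt (ENNReal.mul_lt_top ENNReal.ofReal_lt_top h)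

theorem continuousAt_labelSecond {V : ℝ} (hσ : Measurable σs) (hV : 2 ≤ V)
    (h : labelFourth σs ρ V < ⊤) : ContinuousAt (labelSecond σs ρ) 1 :=
  continuousAt_integral_labelLaw hV (by fun_prop) (integrable_label_two hσ h)

theorem continuousAt_labelCorr {V : ℝ} (hσ : Measurable σs) (hV : 2 ≤ V)
    (h : labelFourth σs ρ V < ⊤) : ContinuousAt (labelCorr σs ρ) 1 :=
  continuousAt_integral_labelLaw hV (by fun_prop) (integrable_label_corr hσ h)

theorem trace_featureCov_nonneg (hσ : Measurable σs) (d ℓ : ℕ) :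
    0 ≤ (ICL.featureCov d ℓ ρ σs).trace := by
  refine Finset.sum_nonneg fun p _ => ?_
  rw [Matrix.diag_apply, ICL.featureCov, Matrix.of_apply,
    covariance_self (measurable_vecH (ℓ := ℓ) hσ p).aemeasurable]
  exact variance_nonneg _ _

variable {ℓ : ℕ → ℕ}

/-- Conditioning on `ξ`. The finite trace first forces finite fourth moments of the labels for
almost every `ξ`, and this makes the closed formula `rowMean` available. -/
theorem trace_div_eq_integral (hσ : Measurable σs) {d ℓ : ℕ} (hd : 1 ≤ d) (hℓ : 1 ≤ ℓ)
    (hcov : ∀ p : Fin (d + 1) × Fin d,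
      MemLp (fun w : (Fin d → ℝ) × ((Fin (ℓ + 1) → Fin d → ℝ) × (Fin ℓ → ℝ)) =>
        ICL.vecH σs w.1 w.2 p) 2 ((ICL.taskLaw d).prod (ICL.promptLaw d ℓ ρ))) :
    (∫⁻ x, labelFourth σs ρ (x ⬝ᵥ x / d) ∂(ICL.taskLaw d) ≠ ⊤) ∧
    Integrable (fun x : Fin d → ℝ => rowMean σs ρ d ℓ (x ⬝ᵥ x / d)) (ICL.taskLaw d) ∧
    (ICL.featureCov d ℓ ρ σs).trace / d =
      ∫ x, rowMean σs ρ d ℓ (x ⬝ᵥ x / d) ∂(ICL.taskLaw d) := by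
  have hd0 : (0 : ℝ) < d := by exact_mod_cast hd
  have hT := ofReal_trace_featureCov hσ hd hcov
  have hpos := ae_dotProduct_self_pos hd
  have hfin := lintegral_labelFourth_ne_top (ρ := ρ) hσ hd hℓ (by rw [← hT]; exact ENNReal.ofReal_ne_top)
    (hpos.mono fun x hx => hx.ne')
  have hm := measurable_normSq_div d
  have hae := ae_lt_top ((measurable_labelFourth hσ).comp hm) hfin
  have hK : ∫⁻ ξ, ∫⁻ c, ENNReal.ofReal (rowOfContext σs ξ c ⬝ᵥ rowOfContext σs ξ c)
        ∂(contextLaw d ℓ ρ) ∂(ICL.taskLaw d) =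
      ∫⁻ x, ENNReal.ofReal (d * rowMean σs ρ d ℓ (x ⬝ᵥ x / d)) ∂(ICL.taskLaw d) := by
    refine lintegral_congr_ae ?_
    filter_upwards [hpos, hae] with x hx h4
    exact lintegral_rowOfContext_sq hσ hd hℓ hx.ne' h4
  have hnn : 0 ≤ᵐ[ICL.taskLaw d] fun x => d * rowMean σs ρ d ℓ (x ⬝ᵥ x / d) := by
    filter_upwards [hpos] with x hx
    exact mul_nonneg hd0.le (rowMean_nonneg hd hℓ (by positivity))
  have hmr : Measurable fun x : Fin d → ℝ => d * rowMean σs ρ d ℓ (x ⬝ᵥ x / d) :=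
    ((measurable_rowMean hσ d ℓ).comp hm).const_mul _
  have hint : Integrable (fun x : Fin d → ℝ => d * rowMean σs ρ d ℓ (x ⬝ᵥ x / d))
      (ICL.taskLaw d) := by
    refine ⟨hmr.aestronglyMeasurable, ?_⟩
    rw [hasFiniteIntegral_iff_ofReal hnn, ← hK, ← hT]
    exact ENNReal.ofReal_lt_top
  refine ⟨hfin, ?_, ?_⟩
  · have := hint.const_mul (d : ℝ)⁻¹
    refine this.congr (ae_of_all _ fun x => ?_)
    simp only
    field_simp
  · rw [hK, ← ofReal_integral_eq_lintegral_ofReal hint hnn] at hT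
    have := congrArg ENNReal.toReal hT
    rw [ENNReal.toReal_ofReal (trace_featureCov_nonneg hσ d ℓ),
      ENNReal.toReal_ofReal (integral_nonneg_of_ae hnn), integral_const_mul] at this
    rw [this]
    field_simp

/-- The trace of the feature covariance grows linearly in the dimension. -/
theorem tendsto_trace_div (hσ : Measurable σs) {τ : ℝ} (hτ : 0 < τ)
    (hd : Tendsto (fun n => (d n : ℝ)) atTop atTop)
    (hℓ : Tendsto (fun n => (ℓ n : ℝ)) atTop atTop)
    (hratio : Tendsto (fun n => (ℓ n : ℝ) / d n) atTop (𝓝 τ))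
    (hcov : ∀ n, ∀ p : Fin (d n + 1) × Fin (d n),
      MemLp (fun w : (Fin (d n) → ℝ) × ((Fin (ℓ n + 1) → Fin (d n) → ℝ) × (Fin (ℓ n) → ℝ)) =>
          ICL.vecH σs w.1 w.2 p) 2 ((ICL.taskLaw (d n)).prod (ICL.promptLaw (d n) (ℓ n) ρ))) :
    Tendsto (fun n => (ICL.featureCov (d n) (ℓ n) ρ σs).trace / d n) atTop
      (𝓝 (rowLimit σs ρ τ)) ∧ ∃ V, 2 ≤ V ∧ labelFourth σs ρ V < ⊤ := by
  have hev : ∀ᶠ n in atTop, 1 ≤ d n ∧ 1 ≤ ℓ n := by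
    filter_upwards [hd.eventually_ge_atTop 1, hℓ.eventually_ge_atTop 1] with n h1 h2
    exact ⟨by exact_mod_cast h1, by exact_mod_cast h2⟩
  -- One nondegenerate index supplies both the reference dimension `d₀` and the variance `V`.
  obtain ⟨N, hN1, hN2⟩ := hev.exists
  have hfinN := (trace_div_eq_integral hσ hN1 hN2 (hcov N)).1
  obtain ⟨V, hV, hV4⟩ := exists_labelFourth_lt_top hN1 hσ hfinN
  refine ⟨?_, V, hV, hV4⟩
  have hM := tendsto_lintegral_labelFourth_div hσ hd hN1 hfinN
  have hM4 := measurable_labelFourth (ρ := ρ) hσ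
  have hc2 := continuousAt_labelSecond hσ hV hV4
  have hcb := continuousAt_labelCorr hσ hV hV4
  have hdi : Tendsto (fun n => 1 / (d n : ℝ)) atTop (𝓝 0) := by
    simpa only [one_div, Function.comp_def] using tendsto_inv_atTop_zero.comp hd
  have hℓi : Tendsto (fun n => 1 / (ℓ n : ℝ)) atTop (𝓝 0) := by
    simpa only [one_div, Function.comp_def] using tendsto_inv_atTop_zero.comp hℓ
  have hr : Tendsto (fun n => (d n / ℓ n : ℝ) * (1 - 1 / d n)) atTop (𝓝 (1 / τ)) := by
    have h1 := (hratio.inv₀ hτ.ne').mul (hdi.const_sub 1)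
    simp only [inv_div, sub_zero, mul_one, inv_eq_one_div τ] at h1
    exact h1
  have second_le : ∀ s, 0 < s → ENNReal.ofReal (labelSecond σs ρ s ^ 2) ≤ labelFourth σs ρ s := by
    intro s _
    rcases eq_or_ne (labelFourth σs ρ s) ⊤ with h | h
    · rw [h]; exact le_top
    · rw [← ENNReal.ofReal_toReal h]
      exact ENNReal.ofReal_le_ofReal (labelSecond_sq_le hσ h.lt_top)
  have L2 := tendsto_lintegral_normSq hd hc2 hM4 second_le hM
  -- By Cauchy–Schwarz `labelCorr ^ 2 / s ≤ labelSecond`, so its square is again dominated by the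
  -- fourth moment.
  have L1 := tendsto_lintegral_normSq (h := fun s => labelCorr σs ρ s ^ 2 / s) hd
    ((hcb.pow 2).div continuousAt_id one_ne_zero) hM4 (fun s hs => by
      rcases eq_or_ne (labelFourth σs ρ s) ⊤ with h | h
      · rw [h]; exact le_top
      · refine le_trans (ENNReal.ofReal_le_ofReal ?_) (second_le s hs)
        exact pow_le_pow_left₀ (by positivity) (labelCorr_sq_le hσ h.lt_top hs) 2) hM
  set G := gaussianFourth + 1 with hG
  have hG0 : 0 ≤ G := by have := gaussianFourth_nonneg; linarith
  have hbound : ∀ᶠ n in atTop,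
      ENNReal.ofReal |(ICL.featureCov (d n) (ℓ n) ρ σs).trace / d n - rowLimit σs ρ τ| ≤
      ∫⁻ x, ENNReal.ofReal |labelCorr σs ρ (x ⬝ᵥ x / d n) ^ 2 / (x ⬝ᵥ x / d n) -
        labelCorr σs ρ 1 ^ 2 / 1| ∂(ICL.taskLaw (d n)) +
      ENNReal.ofReal ((d n / ℓ n : ℝ) * (1 - 1 / d n)) *
        ∫⁻ x, ENNReal.ofReal |labelSecond σs ρ (x ⬝ᵥ x / d n) - labelSecond σs ρ 1|
          ∂(ICL.taskLaw (d n)) +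
      ENNReal.ofReal (|(d n / ℓ n : ℝ) * (1 - 1 / d n) - 1 / τ| * labelSecond σs ρ 1) +
      (ENNReal.ofReal (2 * (d n / ℓ n + 1 : ℝ)) * (ENNReal.ofReal (1 / d n) *
        ∫⁻ x, labelFourth σs ρ (x ⬝ᵥ x / d n) ∂(ICL.taskLaw (d n))) +
        ENNReal.ofReal ((1 / ℓ n + 1 / d n : ℝ) * G)) := by
    filter_upwards [hev] with n hn
    obtain ⟨hd1, hℓ1⟩ := hn
    have hd0 : (0 : ℝ) < d n := by exact_mod_cast hd1
    have hℓ0 : (0 : ℝ) < ℓ n := by exact_mod_cast hℓ1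
    obtain ⟨hfin, hint, htr⟩ := trace_div_eq_integral hσ hd1 hℓ1 (hcov n)
    have hm := measurable_normSq_div (d n)
    have hae := ae_lt_top (hM4.comp hm) hfin
    have hd1' : 0 ≤ 1 - 1 / (d n : ℝ) := by
      rw [sub_nonneg, div_le_one hd0]; exact_mod_cast hd1
    have hm2 : Measurable fun x : Fin (d n) → ℝ =>
        ENNReal.ofReal |labelSecond σs ρ (x ⬝ᵥ x / d n) - labelSecond σs ρ 1| := by
      have := (measurable_labelSecond (ρ := ρ) hσ).comp hm
      exact ((this.sub_const _).abs).ennreal_ofReal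
    have hm1 : Measurable fun x : Fin (d n) → ℝ =>
        ENNReal.ofReal |labelCorr σs ρ (x ⬝ᵥ x / d n) ^ 2 / (x ⬝ᵥ x / d n) -
        labelCorr σs ρ 1 ^ 2 / 1| := by
      have := (measurable_labelCorr (ρ := ρ) hσ).comp hm
      exact ((((this.pow_const 2).div hm).sub_const _).abs).ennreal_ofReal
    have hmf : Measurable fun x : Fin (d n) → ℝ => labelFourth σs ρ (x ⬝ᵥ x / d n) := hM4.comp hm
    have e : (ICL.featureCov (d n) (ℓ n) ρ σs).trace / d n - rowLimit σs ρ τ =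
        ∫ x, (rowMean σs ρ (d n) (ℓ n) (x ⬝ᵥ x / d n) - rowLimit σs ρ τ)
          ∂(ICL.taskLaw (d n)) := by
      rw [integral_sub hint (integrable_const _), htr]
      simp
    rw [e]
    calc _ = ‖∫ x, (rowMean σs ρ (d n) (ℓ n) (x ⬝ᵥ x / d n) - rowLimit σs ρ τ)
          ∂(ICL.taskLaw (d n))‖ₑ := by rw [← Real.norm_eq_abs, ofReal_norm]
      _ ≤ ∫⁻ x, ‖rowMean σs ρ (d n) (ℓ n) (x ⬝ᵥ x / d n) - rowLimit σs ρ τ‖ₑ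
          ∂(ICL.taskLaw (d n)) := enorm_integral_le_lintegral_enorm _
      _ ≤ ∫⁻ x, (ENNReal.ofReal |labelCorr σs ρ (x ⬝ᵥ x / d n) ^ 2 / (x ⬝ᵥ x / d n) -
          labelCorr σs ρ 1 ^ 2 / 1| + ENNReal.ofReal ((d n / ℓ n : ℝ) * (1 - 1 / d n)) *
          ENNReal.ofReal |labelSecond σs ρ (x ⬝ᵥ x / d n) - labelSecond σs ρ 1| +
          ENNReal.ofReal (|(d n / ℓ n : ℝ) * (1 - 1 / d n) - 1 / τ| * labelSecond σs ρ 1) +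
          (ENNReal.ofReal (2 * (d n / ℓ n + 1 : ℝ)) * (ENNReal.ofReal (1 / d n) *
          labelFourth σs ρ (x ⬝ᵥ x / d n)) + ENNReal.ofReal ((1 / ℓ n + 1 / d n : ℝ) * G)))
          ∂(ICL.taskLaw (d n)) := by
          refine lintegral_mono_ae ?_
          filter_upwards [ae_dotProduct_self_pos hd1, hae] with x hx h4
          have hle := abs_rowMean_sub_le (τ := τ) hσ hd1 hℓ1
            (by positivity : 0 < x ⬝ᵥ x / d n) h4
          rw [← ofReal_norm, Real.norm_eq_abs]
          refine (ENNReal.ofReal_le_ofReal hle).trans ?_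
          have hs2 := labelSecond_nonneg (σs := σs) (ρ := ρ) 1
          have hcoef : 0 ≤ (d n / ℓ n : ℝ) * (1 - 1 / d n) := mul_nonneg (by positivity) hd1'
          have hf0 : 0 ≤ (labelFourth σs ρ (x ⬝ᵥ x / d n)).toReal := ENNReal.toReal_nonneg
          have hsplit : (1 / ℓ n + 1 / d n : ℝ) *
              (2 * (labelFourth σs ρ (x ⬝ᵥ x / d n)).toReal + G) =
              2 * (d n / ℓ n + 1 : ℝ) * (1 / d n * (labelFourth σs ρ (x ⬝ᵥ x / d n)).toReal) +
              (1 / ℓ n + 1 / d n : ℝ) * G := by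
            field_simp
          rw [← hG, hsplit, ENNReal.ofReal_add (by positivity) (by positivity),
            ENNReal.ofReal_add (by positivity) (by positivity),
            ENNReal.ofReal_add (by positivity) (by positivity),
            ENNReal.ofReal_add (by positivity) (by positivity),
            ENNReal.ofReal_mul hcoef,
            ENNReal.ofReal_mul (by positivity : (0 : ℝ) ≤ 2 * (d n / ℓ n + 1 : ℝ)),
            ENNReal.ofReal_mul (by positivity : (0 : ℝ) ≤ 1 / d n),
            ENNReal.ofReal_toReal (a := labelFourth σs ρ (x ⬝ᵥ x / d n)) (ne_of_lt h4)]
      _ = _ := by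
          rw [lintegral_add_right _ (by fun_prop), lintegral_add_right _ measurable_const,
            lintegral_add_left hm1, lintegral_const_mul _ hm2,
            lintegral_add_right _ measurable_const, lintegral_const_mul _ (hmf.const_mul _),
            lintegral_const_mul _ hmf]
          simp
  have hzero : Tendsto (fun n =>
      ∫⁻ x, ENNReal.ofReal |labelCorr σs ρ (x ⬝ᵥ x / d n) ^ 2 / (x ⬝ᵥ x / d n) -
        labelCorr σs ρ 1 ^ 2 / 1| ∂(ICL.taskLaw (d n)) +
      ENNReal.ofReal ((d n / ℓ n : ℝ) * (1 - 1 / d n)) *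
        ∫⁻ x, ENNReal.ofReal |labelSecond σs ρ (x ⬝ᵥ x / d n) - labelSecond σs ρ 1|
          ∂(ICL.taskLaw (d n)) +
      ENNReal.ofReal (|(d n / ℓ n : ℝ) * (1 - 1 / d n) - 1 / τ| * labelSecond σs ρ 1) +
      (ENNReal.ofReal (2 * (d n / ℓ n + 1 : ℝ)) * (ENNReal.ofReal (1 / d n) *
        ∫⁻ x, labelFourth σs ρ (x ⬝ᵥ x / d n) ∂(ICL.taskLaw (d n))) +
        ENNReal.ofReal ((1 / ℓ n + 1 / d n : ℝ) * G))) atTop (𝓝 0) := by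
    have z2 := ENNReal.Tendsto.mul ((ENNReal.continuous_ofReal.tendsto _).comp hr)
      (Or.inr ENNReal.zero_ne_top) L2 (Or.inr ENNReal.ofReal_ne_top)
    have z3 : Tendsto (fun n => |(d n / ℓ n : ℝ) * (1 - 1 / d n) - 1 / τ| * labelSecond σs ρ 1)
        atTop (𝓝 0) := by
      have := ((hr.sub_const (1 / τ)).abs).mul_const (labelSecond σs ρ 1)
      simpa using this
    have z3' := (ENNReal.continuous_ofReal.tendsto _).comp z3
    have hr' : Tendsto (fun n => 2 * (d n / ℓ n + 1 : ℝ)) atTop (𝓝 (2 * (1 / τ + 1))) := by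
      have h1 := hratio.inv₀ hτ.ne'
      simp only [inv_div, inv_eq_one_div τ] at h1
      exact (h1.add_const 1).const_mul 2
    have z4 := ENNReal.Tendsto.mul ((ENNReal.continuous_ofReal.tendsto _).comp hr')
      (Or.inr ENNReal.zero_ne_top) hM (Or.inr ENNReal.ofReal_ne_top)
    have z5 : Tendsto (fun n => (1 / ℓ n + 1 / d n : ℝ) * G) atTop (𝓝 0) := by
      have := (hℓi.add hdi).mul_const G
      simpa using this
    have z5' := (ENNReal.continuous_ofReal.tendsto _).comp z5
    have := ((L1.add z2).add z3').add (z4.add z5')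
    simp only [mul_zero, add_zero, ENNReal.ofReal_zero] at this
    exact this
  have hfinal := tendsto_of_tendsto_of_tendsto_of_le_of_le' tendsto_const_nhds hzero
    (Eventually.of_forall fun _ => zero_le) hbound
  have hreal := (ENNReal.tendsto_toReal ENNReal.zero_ne_top).comp hfinal
  rw [tendsto_iff_dist_tendsto_zero]
  simpa [Function.comp_def, Real.dist_eq, ENNReal.toReal_ofReal] using hreal

end TraceLimit

/-! ### Concentration of the context row for fixed task vectors -/

section RowConcentration

namespace TendstoInProb

variable {Ω : ℕ → Type*} [∀ n, MeasurableSpace (Ω n)] {μ : ∀ n, Measure (Ω n)}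

theorem congr_eventually {E : Type*} [TopologicalSpace E] {X Z : ∀ n, Ω n → E} {c : E}
    (hX : TendstoInProb μ X c) (h : ∀ᶠ n in atTop, ∀ ω, X n ω = Z n ω) :
    TendstoInProb μ Z c := by
  refine hX.congr (tendsto_const_nhds.congr' ?_)
  filter_upwards [h] with n hn
  simp [hn]

/-- Convergence in probability to a constant only depends on the laws. -/
theorem of_map_eq {Ω' : ℕ → Type*} [∀ n, MeasurableSpace (Ω' n)] {ν : ∀ n, Measure (Ω' n)}
    {X : ∀ n, Ω n → ℝ} {Y : ∀ n, Ω' n → ℝ} {c : ℝ} (hX : ∀ n, Measurable (X n))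
    (hY : ∀ n, Measurable (Y n)) (h : ∀ᶠ n in atTop, (μ n).map (X n) = (ν n).map (Y n))
    (hlim : TendstoInProb ν Y c) : TendstoInProb μ X c := by
  intro U hU
  -- An open subset replaces `U`, whose preimages need not be measurable.
  obtain ⟨V, hVU, hVo, hcV⟩ := mem_nhds_iff.1 hU
  refine tendsto_of_tendsto_of_tendsto_of_le_of_le' tendsto_const_nhds
    (hlim V (hVo.mem_nhds hcV)) (Eventually.of_forall fun _ => zero_le) ?_
  filter_upwards [h] with n hn
  have hV := hVo.measurableSet.compl
  calc μ n {ω | X n ω ∉ U} ≤ μ n (X n ⁻¹' Vᶜ) := measure_mono fun ω hω hωV => hω (hVU hωV)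
    _ = ν n (Y n ⁻¹' Vᶜ) := by
        rw [← Measure.map_apply (hX n) hV, hn, Measure.map_apply (hY n) hV]

end TendstoInProb

variable {σs : ℝ → ℝ} {ρ : ℝ≥0} {d ℓ : ℕ → ℕ}

theorem tendstoInProb_normSq_inputLaw (hd : Tendsto (fun n => (d n : ℝ)) atTop atTop) :
    TendstoInProb (fun n => ICL.inputLaw (d n)) (fun _ x => x ⬝ᵥ x) 1 := by
  obtain ⟨C, hC, h⟩ := exists_moment_four_chi_sq_le
  refine TendstoInProb.of_lintegral_pow 4 (by decide)
    (fun n => by unfold dotProduct; fun_prop) ?_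
  have hlim : Tendsto (fun n => ENNReal.ofReal (C * (1 / (d n : ℝ)) ^ 2)) atTop (𝓝 0) := by
    have h1 : Tendsto (fun n => 1 / (d n : ℝ)) atTop (𝓝 0) := by
      simpa only [one_div, Function.comp_def] using tendsto_inv_atTop_zero.comp hd
    have := (ENNReal.continuous_ofReal.tendsto _).comp ((h1.pow 2).const_mul C)
    simpa [Function.comp_def] using this
  refine tendsto_of_tendsto_of_tendsto_of_le_of_le' tendsto_const_nhds hlim
    (Eventually.of_forall fun _ => zero_le) ?_
  filter_upwards [hd.eventually_gt_atTop 0] with n hn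
  have h1 := h (d n) ((d n : ℝ≥0)⁻¹)
  have e : (d n : ℝ) * ((d n : ℝ≥0)⁻¹ : ℝ≥0) = 1 := by
    push_cast; field_simp
  rw [e] at h1
  refine h1.trans (ENNReal.ofReal_le_ofReal (le_of_eq ?_))
  push_cast
  field_simp

theorem tendstoInProb_proj_inputLaw (hd : Tendsto (fun n => (d n : ℝ)) atTop atTop)
    (ξ : ∀ n, Fin (d n) → ℝ) :
    TendstoInProb (fun n => ICL.inputLaw (d n)) (fun n x => (ξ n ⬝ᵥ x) ^ 2 / (ξ n ⬝ᵥ ξ n)) 0 := by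
  have hnn : ∀ n, 0 ≤ ξ n ⬝ᵥ ξ n := fun n => Finset.sum_nonneg fun i _ => mul_self_nonneg _
  have key : TendstoInProb (fun n => ICL.inputLaw (d n)) (fun n x => (ξ n ⬝ᵥ x) / √(ξ n ⬝ᵥ ξ n))
      0 := by
    refine TendstoInProb.of_lintegral_pow 2 (by decide)
      (fun n => ?_) ?_
    · have : Measurable fun x : Fin (d n) → ℝ => ξ n ⬝ᵥ x := by
        have h := Measurable.of_uncurry_left (f := fun a x : Fin (d n) → ℝ => a ⬝ᵥ x)
          (by unfold dotProduct; fun_prop) (x := ξ n)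
        exact h
      exact (this.div_const _).aemeasurable
    have hlim : Tendsto (fun n => ENNReal.ofReal (1 / (d n : ℝ))) atTop (𝓝 0) := by
      have h1 : Tendsto (fun n => 1 / (d n : ℝ)) atTop (𝓝 0) := by
        simpa only [one_div, Function.comp_def] using tendsto_inv_atTop_zero.comp hd
      have := (ENNReal.continuous_ofReal.tendsto _).comp h1
      simpa only [Function.comp_def, ENNReal.ofReal_zero] using this
    refine tendsto_of_tendsto_of_tendsto_of_le_of_le tendsto_const_nhds hlim
      (fun _ => zero_le) fun n => ?_
    obtain ⟨hi, he⟩ := integral_dotProduct_sq_inputLaw (ξ n)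
    have e : ∀ x : Fin (d n) → ℝ, ((ξ n ⬝ᵥ x) / √(ξ n ⬝ᵥ ξ n) - 0) ^ 2 =
        (ξ n ⬝ᵥ ξ n)⁻¹ * (ξ n ⬝ᵥ x) ^ 2 := by
      intro x
      rw [sub_zero, div_pow, Real.sq_sqrt (hnn n), div_eq_inv_mul]
    simp only [e]
    rw [← ofReal_integral_eq_lintegral_ofReal (hi.const_mul _)
      (ae_of_all _ fun x => mul_nonneg (inv_nonneg.2 (hnn n)) (sq_nonneg _)), integral_const_mul, he]
    refine ENNReal.ofReal_le_ofReal ?_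
    rw [← mul_div_assoc]
    gcongr
    -- The bound also covers `ξ n = 0`, where the inverse is `0` by convention.
    exact inv_mul_le_one
  have := key.comp (g := fun x => x ^ 2) (continuous_pow 2).continuousAt
  simpa only [div_pow, Real.sq_sqrt (hnn _), zero_pow two_ne_zero] using this

/-- The squared norm of the context row concentrates, for a fixed sequence of task vectors. -/
theorem tendstoInProb_rowOfContext_sq (hσ : Measurable σs) {V : ℝ} (hV : 2 ≤ V)
    (hV4 : labelFourth σs ρ V < ⊤) {τ : ℝ} (hτ : 0 < τ)
    (hd : Tendsto (fun n => (d n : ℝ)) atTop atTop)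
    (hℓ : Tendsto (fun n => (ℓ n : ℝ)) atTop atTop)
    (hratio : Tendsto (fun n => (ℓ n : ℝ) / d n) atTop (𝓝 τ)) {ξ : ∀ n, Fin (d n) → ℝ}
    (hξ : Tendsto (fun n => ξ n ⬝ᵥ ξ n / d n) atTop (𝓝 1)) :
    TendstoInProb (fun n => contextLaw (d n) (ℓ n) ρ)
      (fun n c => rowOfContext σs (ξ n) c ⬝ᵥ rowOfContext σs (ξ n) c / d n)
      (rowLimit σs ρ τ) := by
  set s : ℕ → ℝ := fun n => ξ n ⬝ᵥ ξ n / d n with hs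
  have hrow := fun n => measurable_rowOfContext_sq (ℓ := ℓ n) hσ (ξ n)
  have hnorm := fun n => measurable_rowNormSq (ℓ := ℓ n) hσ (ξ n)
  have hs_ev : ∀ᶠ n in atTop, 1 / 2 ≤ s n ∧ s n ≤ 2 :=
    (hξ.eventually_const_le (by norm_num)).and (hξ.eventually_le_const (by norm_num))
  have hpos : ∀ᶠ n in atTop, (0 : ℝ) < d n ∧ (0 : ℝ) < ℓ n :=
    (hd.eventually_gt_atTop 0).and (hℓ.eventually_gt_atTop 0)
  have h4_ev : ∀ᶠ n in atTop, labelFourth σs ρ (s n) < ⊤ :=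
    hs_ev.mono fun n hn => labelFourth_one_lt_top hσ hV hV4 hn.1 hn.2
  have hℓi : Tendsto (fun n => 1 / (ℓ n : ℝ)) atTop (𝓝 0) := by
    simpa only [one_div, Function.comp_def] using tendsto_inv_atTop_zero.comp hℓ
  have hdi : Tendsto (fun n => 1 / (d n : ℝ)) atTop (𝓝 0) := by
    simpa only [one_div, Function.comp_def] using tendsto_inv_atTop_zero.comp hd
  -- A uniform bound for the fourth moments at the variances `s n`, all eventually in `[1 / 2, 2]`;
  -- it gives the variance condition of the law of large numbers.
  set B : ℝ := (ENNReal.ofReal √(2 * V) * labelFourth σs ρ V).toReal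
  have hB : ∀ᶠ n in atTop, (labelFourth σs ρ (s n)).toReal ≤ B := by
    filter_upwards [hs_ev] with n hn
    exact ENNReal.toReal_mono (ENNReal.mul_lt_top ENNReal.ofReal_lt_top hV4).ne
      (labelFourth_le hσ hn.1 (hn.2.trans hV))
  have hvar : ∀ (f : ℕ → ℝ) (K : ℝ), (∀ᶠ n in atTop, 0 ≤ f n ∧ f n ≤ K) →
      Tendsto (fun n => f n / ℓ n) atTop (𝓝 0) := by
    intro f K hf
    have hK := hℓi.const_mul K
    rw [mul_zero] at hK
    refine tendsto_of_tendsto_of_tendsto_of_le_of_le' tendsto_const_nhds hK ?_ ?_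
    · filter_upwards [hf] with n hn
      exact div_nonneg hn.1 (Nat.cast_nonneg _)
    · filter_upwards [hf] with n hn
      rw [mul_one_div]
      gcongr
      exact hn.2
  have avg1 := tendstoInProb_average (fun n => labelLaw ρ (s n)) ℓ
    (f := fun w => noisyLabel σs w * w.1) (by fun_prop)
    (h4_ev.mono fun n hn => integrable_label_mixed hσ hn)
    ((continuousAt_labelCorr hσ hV hV4).tendsto.comp hξ)
    (hvar _ (2 * (B + gaussianFourth)) (by
      filter_upwards [h4_ev, hB, hs_ev] with n h4 hBn hsn
      refine ⟨labelMixed_nonneg _, (labelMixed_le hσ h4 (by linarith)).trans ?_⟩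
      have := gaussianFourth_nonneg
      have := ENNReal.toReal_nonneg (a := labelFourth σs ρ (s n))
      gcongr
      exact hsn.2)) hℓ
  have avg2 := tendstoInProb_average (fun n => labelLaw ρ (s n)) ℓ
    (f := fun w => noisyLabel σs w ^ 2) (by fun_prop)
    (h4_ev.mono fun n hn => by
      simpa only [← pow_mul] using integrable_label_four hσ hn)
    ((continuousAt_labelSecond hσ hV hV4).tendsto.comp hξ)
    (hvar _ B (by
      filter_upwards [h4_ev, hB] with n h4 hBn
      refine ⟨integral_nonneg fun w => sq_nonneg _, ?_⟩
      simpa only [← pow_mul, integral_label_four hσ h4] using hBn)) hℓ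
  set κ := fun n => (Measure.pi fun _ : Fin (ℓ n) => labelLaw ρ (s n)).prod (ICL.inputLaw (d n))
    with hκ
  have pfst : ∀ n, (κ n).map Prod.fst = Measure.pi fun _ : Fin (ℓ n) => labelLaw ρ (s n) :=
    fun n => measurePreserving_fst.map_eq
  have psnd : ∀ n, (κ n).map Prod.snd = ICL.inputLaw (d n) :=
    fun n => measurePreserving_snd.map_eq
  have X1 := avg1.comp_map (ν := κ) (fun n => measurable_fst.aemeasurable) pfst
  have X2 := avg2.comp_map (ν := κ) (fun n => measurable_fst.aemeasurable) pfst
  have X3 := (tendstoInProb_normSq_inputLaw hd).comp_map (ν := κ)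
    (fun n => measurable_snd.aemeasurable) psnd
  have X4 := (tendstoInProb_proj_inputLaw hd ξ).comp_map (ν := κ)
    (fun n => measurable_snd.aemeasurable) psnd
  have X5 : TendstoInProb κ (fun n _ => s n) 1 := TendstoInProb.of_tendsto hξ
  have X6 : TendstoInProb κ (fun n _ => (d n : ℝ) / ℓ n) (1 / τ) := by
    refine TendstoInProb.of_tendsto ?_
    simpa only [inv_div, one_div] using hratio.inv₀ hτ.ne'
  have X7 : TendstoInProb κ (fun n _ => 1 / (d n : ℝ)) 0 := TendstoInProb.of_tendsto hdi
  -- With averages `A₁` of `y u` and `A₂` of `y²`, `rowNormSq / d` equals `A₁² / s + (d / ℓ) A₂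
  -- (|x|² - (ξ · x)² / |ξ|²) + A₂² / d`, a function of the seven quantities that is continuous at
  -- their limits.
  have X := ((((((X1.prodMk X2).prodMk X3).prodMk X4).prodMk X5).prodMk X6).prodMk X7).comp
    (g := fun p : ((((((ℝ × ℝ) × ℝ) × ℝ) × ℝ) × ℝ) × ℝ) =>
      p.1.1.1.1.1.1 ^ 2 / p.1.1.2 + p.1.2 * p.1.1.1.1.1.2 * (p.1.1.1.1.2 - p.1.1.1.2) +
        p.1.1.1.1.1.2 ^ 2 * p.2) (by
      refine ContinuousAt.add (ContinuousAt.add (ContinuousAt.div ?_ ?_ one_ne_zero) ?_) ?_ <;>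
        fun_prop)
  have hlim : TendstoInProb κ (fun n p => rowNormSq σs (ξ n) p.1 p.2 / d n) (rowLimit σs ρ τ) := by
    have e : rowLimit σs ρ τ = labelCorr σs ρ 1 ^ 2 / 1 +
        1 / τ * labelSecond σs ρ 1 * (1 - 0) + labelSecond σs ρ 1 ^ 2 * 0 := by
      unfold rowLimit; ring
    rw [e]
    refine X.congr_eventually ?_
    filter_upwards [hpos, hs_ev] with n hn hsn p
    obtain ⟨hd0, hℓ0⟩ := hn
    have hx : ξ n ⬝ᵥ ξ n = s n * d n := by simp only [hs]; field_simp
    have hs0 : s n ≠ 0 := by linarith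
    simp only [rowNormSq, hx]
    field_simp
  refine TendstoInProb.of_map_eq (fun n => (hrow n).div_const _) (fun n => (hnorm n).div_const _)
    ?_ hlim
  filter_upwards [hpos, hs_ev] with n hn hsn
  have hξ0 : ξ n ⬝ᵥ ξ n ≠ 0 := by
    intro h0
    have := hsn.1
    simp only [hs, h0] at this
    norm_num at this
  have := map_rowOfContext_sq (ℓ := ℓ n) (ρ := ρ) hσ (by exact_mod_cast hn.1) hξ0
  have h2 := congrArg (Measure.map (fun x => x / (d n : ℝ))) this
  rw [Measure.map_map (by fun_prop) (hrow n), Measure.map_map (by fun_prop) (hnorm n)] at h2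
  exact h2

/-- The variance of the entries of the weight matrix. -/
noncomputable def weightVar (d ℓ : ℕ) (ρ : ℝ≥0) (σs : ℝ → ℝ) : ℝ≥0 :=
  Real.toNNReal (1 / (ICL.featureCov d ℓ ρ σs).trace)

/-- The squared norm of the context row in the scale of the weights. -/
noncomputable def scaledRowSq {d ℓ : ℕ} (σs : ℝ → ℝ) (ρ : ℝ≥0) (ξ : Fin d → ℝ)
    (c : (Fin ℓ → Fin d → ℝ) × (Fin ℓ → ℝ)) : ℝ :=
  weightVar d ℓ ρ σs * (rowOfContext σs ξ c ⬝ᵥ rowOfContext σs ξ c)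

/-- The squared norm of the row and the trace, both divided by `d`, have the same limit `rowLimit`.
Its positivity, from `ρ > 0`, allows the quotient and makes the trace eventually positive. -/
theorem tendstoInProb_scaledRowSq (hσ : Measurable σs) (hρ : 0 < ρ) {V : ℝ} (hV : 2 ≤ V)
    (hV4 : labelFourth σs ρ V < ⊤) {τ : ℝ} (hτ : 0 < τ)
    (hd : Tendsto (fun n => (d n : ℝ)) atTop atTop)
    (hℓ : Tendsto (fun n => (ℓ n : ℝ)) atTop atTop)
    (hratio : Tendsto (fun n => (ℓ n : ℝ) / d n) atTop (𝓝 τ))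
    (htrace : Tendsto (fun n => (ICL.featureCov (d n) (ℓ n) ρ σs).trace / d n) atTop
      (𝓝 (rowLimit σs ρ τ))) {ξ : ∀ n, Fin (d n) → ℝ}
    (hξ : Tendsto (fun n => ξ n ⬝ᵥ ξ n / d n) atTop (𝓝 1)) :
    TendstoInProb (fun n => contextLaw (d n) (ℓ n) ρ)
      (fun n c => scaledRowSq σs ρ (ξ n) c) 1 := by
  have hA : 0 < rowLimit σs ρ τ :=
    rowLimit_pos hσ hρ hτ (labelFourth_one_lt_top hσ hV hV4 (by norm_num) (by norm_num))
  have h1 := tendstoInProb_rowOfContext_sq hσ hV hV4 hτ hd hℓ hratio hξ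
  have h2 : TendstoInProb (fun n => contextLaw (d n) (ℓ n) ρ)
      (fun n _ => (ICL.featureCov (d n) (ℓ n) ρ σs).trace / d n) (rowLimit σs ρ τ) :=
    TendstoInProb.of_tendsto htrace
  have h3 := (h1.prodMk h2).comp (g := fun p : ℝ × ℝ => p.1 / p.2)
    (ContinuousAt.div continuousAt_fst continuousAt_snd hA.ne')
  simp only [div_self hA.ne'] at h3
  refine h3.congr_eventually ?_
  filter_upwards [hd.eventually_gt_atTop 0, htrace.eventually_const_lt hA] with n hn hT c
  have hT0 : 0 < (ICL.featureCov (d n) (ℓ n) ρ σs).trace := by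
    have := mul_pos hT hn
    rwa [div_mul_cancel₀ _ hn.ne'] at this
  simp only [scaledRowSq, weightVar]
  rw [Real.coe_toNNReal _ (by positivity)]
  field_simp

end RowConcentration

/-! ### Fourth-moment bounds for the contracted weights -/

section WeightedRow

variable {d ℓ m : ℕ} {σs : ℝ → ℝ} {ρ : ℝ≥0}

/-- The contraction of the weights with a direction of the hidden space and with a row. -/
def weightedRow (u : Fin m → ℝ) (F : Fin (d + 1) × Fin d → Fin m → ℝ) (r : Fin (d + 1) → ℝ) :
    Fin d → ℝ := fun i => ∑ j, r j * (u ⬝ᵥ F (j, i))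

theorem measurable_weightedRow (u : Fin m → ℝ) :
    Measurable fun p : (Fin (d + 1) × Fin d → Fin m → ℝ) × (Fin (d + 1) → ℝ) =>
      weightedRow u p.1 p.2 := by
  unfold weightedRow dotProduct; fun_prop

theorem map_weightedRow (u : Fin m → ℝ) (r : Fin (d + 1) → ℝ) {w : ℝ≥0}
    (hw : (w : ℝ) = weightVar d ℓ ρ σs * ((u ⬝ᵥ u) * (r ⬝ᵥ r))) :
    (ICL.weightLaw d ℓ m ρ σs).map (fun F => weightedRow u F r) = isoGaussian (Fin d) w :=
  pi_pi_gaussian_map_contract _ _ r u hw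

/-- The deviation of the Gram matrix of the contracted weights and of the task vector from its
conditional mean, on the event that the two norms are of their typical order. -/
noncomputable def gramDefect (ρ : ℝ≥0) (σs : ℝ → ℝ) (u : Fin m → ℝ) (ξ : Fin d → ℝ)
    (F : Fin (d + 1) × Fin d → Fin m → ℝ) (c : (Fin ℓ → Fin d → ℝ) × (Fin ℓ → ℝ)) : ENNReal :=
  if scaledRowSq σs ρ ξ c ≤ 2 ∧ ξ ⬝ᵥ ξ / d ≤ 2 then
    ENNReal.ofReal ((weightedRow u F (rowOfContext σs ξ c) ⬝ᵥ
      weightedRow u F (rowOfContext σs ξ c) / d - scaledRowSq σs ρ ξ c * (u ⬝ᵥ u)) ^ 4) +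
    ENNReal.ofReal ((ξ ⬝ᵥ weightedRow u F (rowOfContext σs ξ c) / d) ^ 4)
  else 0

theorem measurable_dotProduct_comp {α ι : Type*} [MeasurableSpace α] [Fintype ι]
    {f g : α → ι → ℝ} (hf : Measurable f) (hg : Measurable g) :
    Measurable fun x => f x ⬝ᵥ g x := by
  unfold dotProduct; fun_prop

theorem measurable_weightedRow_comp {α : Type*} [MeasurableSpace α] (u : Fin m → ℝ)
    (hσ : Measurable σs) {ξ : α → Fin d → ℝ} {F : α → Fin (d + 1) × Fin d → Fin m → ℝ}
    {c : α → (Fin ℓ → Fin d → ℝ) × (Fin ℓ → ℝ)} (hξ : Measurable ξ) (hF : Measurable F)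
    (hc : Measurable c) :
    Measurable fun x => weightedRow u (F x) (rowOfContext σs (ξ x) (c x)) :=
  (measurable_weightedRow u).comp
    (hF.prodMk ((measurable_rowOfContext_uncurry hσ).comp (hξ.prodMk hc)))

theorem measurable_scaledRowSq_comp {α : Type*} [MeasurableSpace α] (hσ : Measurable σs)
    {ξ : α → Fin d → ℝ} {c : α → (Fin ℓ → Fin d → ℝ) × (Fin ℓ → ℝ)} (hξ : Measurable ξ)
    (hc : Measurable c) : Measurable fun x => scaledRowSq σs ρ (ξ x) (c x) := by
  have h := (measurable_rowOfContext_uncurry hσ).comp (hξ.prodMk hc)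
  exact (measurable_dotProduct_comp h h).const_mul _

theorem measurable_gramDefect_comp {α : Type*} [MeasurableSpace α] (u : Fin m → ℝ)
    (hσ : Measurable σs) {ξ : α → Fin d → ℝ} {F : α → Fin (d + 1) × Fin d → Fin m → ℝ}
    {c : α → (Fin ℓ → Fin d → ℝ) × (Fin ℓ → ℝ)} (hξ : Measurable ξ) (hF : Measurable F)
    (hc : Measurable c) : Measurable fun x => gramDefect ρ σs u (ξ x) (F x) (c x) := by
  have h1 := measurable_weightedRow_comp u hσ hξ hF hc
  have h2 := measurable_scaledRowSq_comp (ρ := ρ) hσ hξ hc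
  have h3 := measurable_dotProduct_comp h1 h1
  have h4 := measurable_dotProduct_comp hξ h1
  have h5 := (measurable_dotProduct_comp hξ hξ).div_const (d : ℝ)
  refine Measurable.ite ((measurableSet_le h2 measurable_const).inter
    (measurableSet_le h5 measurable_const)) ?_ measurable_const
  fun_prop

theorem scaledRowSq_nonneg (ξ : Fin d → ℝ) (c : (Fin ℓ → Fin d → ℝ) × (Fin ℓ → ℝ)) :
    0 ≤ scaledRowSq σs ρ ξ c :=
  mul_nonneg (NNReal.coe_nonneg _) (Finset.sum_nonneg fun _ _ => mul_self_nonneg _)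

/-- For a fixed row the contracted weights form an isotropic Gaussian vector, so both deviations are
of order `d ^ (-1 / 2)`. Fourth powers are used because they give the summable rate `d⁻²`; the
truncation makes the constant uniform in `ξ` and `c`. -/
theorem exists_lintegral_gramDefect_le (ρ : ℝ≥0) (σs : ℝ → ℝ) : ∃ C : ℝ, 0 ≤ C ∧
    ∀ (d ℓ m : ℕ) (u : Fin m → ℝ) (ξ : Fin d → ℝ) (c : (Fin ℓ → Fin d → ℝ) × (Fin ℓ → ℝ)),
      1 ≤ d → u ⬝ᵥ u ≤ 4 →
      ∫⁻ F, gramDefect ρ σs u ξ F c ∂(ICL.weightLaw d ℓ m ρ σs) ≤ ENNReal.ofReal (C / d ^ 2) := by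
  obtain ⟨C₁, hC₁, h1⟩ := exists_moment_four_chi_sq_le
  obtain ⟨C₂, hC₂, h2⟩ := exists_moment_four_gaussian_le
  -- The truncation and `u ⬝ᵥ u ≤ 4` give the variance bounds `w ≤ 2 * 4 = 8` for the vector and `w'
  -- ≤ 8 * 2 d` for its product with `ξ`.
  refine ⟨C₁ * 8 ^ 4 + C₂ * 16 ^ 2, by positivity, fun d ℓ m u ξ c hd hu => ?_⟩
  have hd0 : (0 : ℝ) < d := by exact_mod_cast hd
  by_cases hA : scaledRowSq σs ρ ξ c ≤ 2 ∧ ξ ⬝ᵥ ξ / d ≤ 2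
  swap
  · simp [gramDefect, hA]
  obtain ⟨hR, hs⟩ := hA
  rw [div_le_iff₀ hd0] at hs
  simp only [gramDefect, hR, true_and, div_le_iff₀ hd0, hs, if_true]
  set R := scaledRowSq σs ρ ξ c with hRdef
  have hR0 : 0 ≤ R := scaledRowSq_nonneg ξ c
  have hu0 : 0 ≤ u ⬝ᵥ u := Finset.sum_nonneg fun _ _ => mul_self_nonneg _
  have hξ0 : 0 ≤ ξ ⬝ᵥ ξ := Finset.sum_nonneg fun _ _ => mul_self_nonneg _
  set r := rowOfContext σs ξ c with hr
  obtain ⟨w, hw⟩ : ∃ w : ℝ≥0, (w : ℝ) = R * (u ⬝ᵥ u) := ⟨⟨_, mul_nonneg hR0 hu0⟩, rfl⟩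
  have hw8 : (w : ℝ) ≤ 8 := by rw [hw]; nlinarith
  obtain ⟨w', hw'⟩ : ∃ w' : ℝ≥0, (w' : ℝ) = w * (ξ ⬝ᵥ ξ) := ⟨⟨_, mul_nonneg w.2 hξ0⟩, rfl⟩
  have hw16 : (w' : ℝ) ≤ 16 * d := by
    rw [hw']
    calc (w : ℝ) * (ξ ⬝ᵥ ξ) ≤ 8 * (2 * d) := by gcongr
      _ = _ := by ring
  have hlaw := map_weightedRow (ℓ := ℓ) (ρ := ρ) (σs := σs) u r (w := w)
    (by rw [hw, hRdef, scaledRowSq]; ring)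
  have hm : Measurable fun F : Fin (d + 1) × Fin d → Fin m → ℝ => weightedRow u F r :=
    (measurable_weightedRow u).comp (measurable_id.prodMk measurable_const)
  have hlaw' := isoGaussian_map_dotProduct w w' ξ hw'
  have hξm : Measurable fun x : Fin d → ℝ => ξ ⬝ᵥ x :=
    measurable_dotProduct_comp measurable_const measurable_id
  have hxx : Measurable fun x : Fin d → ℝ => x ⬝ᵥ x :=
    measurable_dotProduct_comp measurable_id measurable_id
  have g1 : Measurable fun x : Fin d → ℝ => ENNReal.ofReal ((x ⬝ᵥ x / d - w) ^ 4) := by fun_prop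
  have g2 : Measurable fun x : Fin d → ℝ => ENNReal.ofReal ((ξ ⬝ᵥ x / d) ^ 4) := by fun_prop
  rw [← hw]
  calc _ = ∫⁻ x, (ENNReal.ofReal ((x ⬝ᵥ x / d - w) ^ 4) + ENNReal.ofReal ((ξ ⬝ᵥ x / d) ^ 4))
        ∂(isoGaussian (Fin d) w) := by
        rw [← hlaw]
        exact (lintegral_map (g1.add g2) hm).symm
    _ = ENNReal.ofReal (1 / d ^ 4) * ∫⁻ x, ENNReal.ofReal ((x ⬝ᵥ x - d * w) ^ 4)
          ∂(isoGaussian (Fin d) w) +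
        ENNReal.ofReal (1 / d ^ 4) * ∫⁻ y, ENNReal.ofReal (y ^ 4) ∂(gaussianReal 0 w') := by
        rw [lintegral_add_left g1, ← hlaw', lintegral_map (by fun_prop) hξm,
          ← lintegral_const_mul _ (by fun_prop), ← lintegral_const_mul _ (by fun_prop)]
        congr 1 <;> refine lintegral_congr fun x => ?_ <;>
          rw [← ENNReal.ofReal_mul (by positivity)] <;> congr 1 <;> field_simp
    _ ≤ ENNReal.ofReal (1 / d ^ 4) * ENNReal.ofReal (C₁ * d ^ 2 * 8 ^ 4) +
        ENNReal.ofReal (1 / d ^ 4) * ENNReal.ofReal (C₂ * (16 * d) ^ 2) := by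
        rw [h2]
        refine add_le_add (mul_le_mul_right ((h1 d w).trans ?_) _) (mul_le_mul_right ?_ _) <;>
          refine ENNReal.ofReal_le_ofReal ?_ <;> gcongr
    _ = _ := by
        rw [← ENNReal.ofReal_mul (by positivity), ← ENNReal.ofReal_mul (by positivity),
          ← ENNReal.ofReal_add (by positivity) (by positivity)]
        congr 1
        field_simp

end WeightedRow

/-! ### Convergence of the Gram matrix to the identity -/

section GramLimit

variable {σs : ℝ → ℝ} {ρ : ℝ≥0} {d ℓ m : ℕ → ℕ}
  {Θ : ℕ → Type*} [∀ n, MeasurableSpace (Θ n)] {μ : ∀ n, Measure (Θ n)}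
  {F : ∀ n, Θ n → Fin (d n + 1) × Fin (d n) → Fin (m n) → ℝ}
  {c : ∀ n, Θ n → (Fin (ℓ n) → Fin (d n) → ℝ) × (Fin (ℓ n) → ℝ)}
  {ξ : ∀ n, Fin (d n) → ℝ}

theorem tendstoInProb_of_gramDefect (hσ : Measurable σs) (hF : ∀ n, Measurable (F n))
    (hc : ∀ n, Measurable (c n))
    (hR : TendstoInProb μ (fun n θ => scaledRowSq σs ρ (ξ n) (c n θ)) 1)
    (hξ : Tendsto (fun n => ξ n ⬝ᵥ ξ n / d n) atTop (𝓝 1)) (u : ∀ n, Fin (m n) → ℝ) {a : ℝ}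
    (hu : ∀ n, u n ⬝ᵥ u n = a)
    (h : Tendsto (fun n => ∫⁻ θ, gramDefect ρ σs (u n) (ξ n) (F n θ) (c n θ) ∂(μ n)) atTop (𝓝 0)) :
    TendstoInProb μ (fun n θ => weightedRow (u n) (F n θ) (rowOfContext σs (ξ n) (c n θ)) ⬝ᵥ
      weightedRow (u n) (F n θ) (rowOfContext σs (ξ n) (c n θ)) / d n) a ∧
    TendstoInProb μ (fun n θ => ξ n ⬝ᵥ
      weightedRow (u n) (F n θ) (rowOfContext σs (ξ n) (c n θ)) / d n) 0 := by
  have hw : ∀ n, Measurable fun θ =>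
      weightedRow (u n) (F n θ) (rowOfContext σs (ξ n) (c n θ)) := fun n =>
    measurable_weightedRow_comp (u n) hσ measurable_const (hF n) (hc n)
  have hRm : ∀ n, Measurable fun θ => scaledRowSq σs ρ (ξ n) (c n θ) := fun n =>
    measurable_scaledRowSq_comp hσ measurable_const (hc n)
  have key : ∀ D : ∀ n, Θ n → ℝ, (∀ n, Measurable (D n)) →
      (∀ n θ, scaledRowSq σs ρ (ξ n) (c n θ) ≤ 2 ∧ ξ n ⬝ᵥ ξ n / d n ≤ 2 →
        ENNReal.ofReal (D n θ ^ 4) ≤ gramDefect ρ σs (u n) (ξ n) (F n θ) (c n θ)) →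
      TendstoInProb μ D 0 := by
    intro D hD hle
    have hA : ∀ n, MeasurableSet {θ | scaledRowSq σs ρ (ξ n) (c n θ) ≤ 2 ∧ ξ n ⬝ᵥ ξ n / d n ≤ 2} :=
      fun n => (measurableSet_le (hRm n) measurable_const).inter (MeasurableSet.const _)
    have h0 : TendstoInProb μ (fun n => Set.indicator
        {θ | scaledRowSq σs ρ (ξ n) (c n θ) ≤ 2 ∧ ξ n ⬝ᵥ ξ n / d n ≤ 2} (D n)) 0 := by
      refine TendstoInProb.of_lintegral_pow 4 (by decide)
        (fun n => ((hD n).indicator (hA n)).aemeasurable) ?_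
      refine tendsto_of_tendsto_of_tendsto_of_le_of_le tendsto_const_nhds h (fun _ => zero_le)
        fun n => lintegral_mono fun θ => ?_
      by_cases hθ : θ ∈ {θ | scaledRowSq σs ρ (ξ n) (c n θ) ≤ 2 ∧ ξ n ⬝ᵥ ξ n / d n ≤ 2}
      · simp only [Set.indicator_of_mem hθ, sub_zero]
        exact hle n θ hθ
      · simp [Set.indicator_of_notMem hθ]
    -- The truncation is inactive with probability tending to one, since `scaledRowSq` and `|ξ|² /
    -- d` both tend to `1 < 2`.
    refine h0.congr ?_
    refine tendsto_of_tendsto_of_tendsto_of_le_of_le' tendsto_const_nhds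
      (hR (Set.Iio 2) (Iio_mem_nhds (by norm_num))) (Eventually.of_forall fun _ => zero_le) ?_
    filter_upwards [hξ.eventually_le_const (by norm_num : (1 : ℝ) < 2)] with n hn
    refine measure_mono fun θ hθ hlt => hθ ?_
    have hmem : θ ∈ {θ | scaledRowSq σs ρ (ξ n) (c n θ) ≤ 2 ∧ ξ n ⬝ᵥ ξ n / d n ≤ 2} :=
      ⟨le_of_lt hlt, hn⟩
    exact Set.indicator_of_mem hmem _
  have hww := fun n => measurable_dotProduct_comp (hw n) (hw n)
  have hξw := fun n => measurable_dotProduct_comp (measurable_const (a := ξ n)) (hw n)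
  constructor
  · have h1 := key (fun n θ => weightedRow (u n) (F n θ) (rowOfContext σs (ξ n) (c n θ)) ⬝ᵥ
      weightedRow (u n) (F n θ) (rowOfContext σs (ξ n) (c n θ)) / d n -
        scaledRowSq σs ρ (ξ n) (c n θ) * (u n ⬝ᵥ u n))
      (fun n => ((hww n).div_const _).sub ((hRm n).mul_const _)) (fun n θ hA => by
        simp only [gramDefect, hA, and_self, if_true]
        exact le_self_add)
    have h2 := (h1.prodMk hR).comp (g := fun p : ℝ × ℝ => p.1 + p.2 * a) (by fun_prop)
    simp only [hu, sub_add_cancel, zero_add, one_mul] at h2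
    exact h2
  · exact key _ (fun n => (hξw n).div_const _) (fun n θ hA => by
      simp only [gramDefect, hA, and_self, if_true]
      exact le_add_self)

/-- The rows obtained from the selected hidden coordinates, together with the task vector. -/
noncomputable def gramFamily {d ℓ m k : ℕ} (σs : ℝ → ℝ) (e : Fin k ↪ Fin m) (ξ : Fin d → ℝ)
    (F : Fin (d + 1) × Fin d → Fin m → ℝ) (c : (Fin ℓ → Fin d → ℝ) × (Fin ℓ → ℝ)) :
    Fin k ⊕ Unit → Fin d → ℝ :=
  Sum.elim (fun a => weightedRow (Pi.single (e a) 1) F (rowOfContext σs ξ c)) fun _ => ξ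

theorem weightedRow_add {d m : ℕ} (u v : Fin m → ℝ) (F : Fin (d + 1) × Fin d → Fin m → ℝ)
    (r : Fin (d + 1) → ℝ) : weightedRow (u + v) F r = weightedRow u F r + weightedRow v F r := by
  ext i
  simp [weightedRow, add_dotProduct, mul_add, Finset.sum_add_distrib]

/-- Polarization: off-diagonal entries come from the squared norms for `e_a`, `e_b` and `e_a + e_b`.
Distinctness of the selected columns makes `|e_a + e_b|² = 2 + 2 δ_ab`. -/
theorem tendstoInProb_gramFamily (hσ : Measurable σs) (hF : ∀ n, Measurable (F n))
    (hc : ∀ n, Measurable (c n))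
    (hR : TendstoInProb μ (fun n θ => scaledRowSq σs ρ (ξ n) (c n θ)) 1)
    (hξ : Tendsto (fun n => ξ n ⬝ᵥ ξ n / d n) atTop (𝓝 1)) {k : ℕ} (e : ∀ n, Fin k ↪ Fin (m n))
    (h1 : ∀ a, Tendsto (fun n => ∫⁻ θ, gramDefect ρ σs (Pi.single (e n a) 1) (ξ n) (F n θ) (c n θ)
      ∂(μ n)) atTop (𝓝 0))
    (h2 : ∀ a b, Tendsto (fun n => ∫⁻ θ, gramDefect ρ σs (Pi.single (e n a) 1 +
      Pi.single (e n b) 1) (ξ n) (F n θ) (c n θ) ∂(μ n)) atTop (𝓝 0)) (x y : Fin k ⊕ Unit) :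
    TendstoInProb μ (fun n θ => gramFamily σs (e n) (ξ n) (F n θ) (c n θ) x ⬝ᵥ
      gramFamily σs (e n) (ξ n) (F n θ) (c n θ) y / d n) ((1 : Matrix _ _ ℝ) x y) := by
  have s1 := fun a => tendstoInProb_of_gramDefect hσ hF hc hR hξ
    (fun n => Pi.single (e n a) 1) (a := 1) (by simp) (h1 a)
  rcases x with a | a <;> rcases y with b | b
  · have s2 := tendstoInProb_of_gramDefect hσ hF hc hR hξ
      (fun n => Pi.single (e n a) 1 + Pi.single (e n b) 1)
      (a := 2 + 2 * (1 : Matrix (Fin k) (Fin k) ℝ) a b) (fun n => by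
        simp only [add_dotProduct, single_dotProduct, Pi.add_apply, Pi.single_apply,
          Matrix.one_apply, (e n).injective.eq_iff]
        by_cases hab : a = b
        · simp [hab]; norm_num
        · simp [hab, Ne.symm hab]; norm_num) (h2 a b)
    have := ((s2.1.prodMk (s1 a).1).prodMk (s1 b).1).comp
      (g := fun p : (ℝ × ℝ) × ℝ => (p.1.1 - p.1.2 - p.2) / 2) (by fun_prop)
    have hval : (2 + 2 * (1 : Matrix (Fin k) (Fin k) ℝ) a b - 1 - 1) / 2 =
        (1 : Matrix (Fin k ⊕ Unit) (Fin k ⊕ Unit) ℝ) (Sum.inl a) (Sum.inl b) := by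
      simp only [Matrix.one_apply, Sum.inl.injEq]; ring
    rw [hval] at this
    refine this.congr_eventually (Eventually.of_forall fun n θ => ?_)
    simp only [gramFamily, Sum.elim_inl, weightedRow_add, add_dotProduct, dotProduct_add]
    rw [dotProduct_comm (weightedRow (Pi.single (e n b) 1) _ _)
      (weightedRow (Pi.single (e n a) 1) _ _)]
    ring
  · have := (s1 a).2
    simpa only [gramFamily, Sum.elim_inl, Sum.elim_inr, Matrix.one_apply, reduceCtorEq, if_false,
      dotProduct_comm _ (weightedRow _ _ _)] using this
  · have := (s1 b).2
    simpa only [gramFamily, Sum.elim_inl, Sum.elim_inr, Matrix.one_apply, reduceCtorEq, if_false]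
      using this
  · have : TendstoInProb μ (fun n _ => ξ n ⬝ᵥ ξ n / d n) 1 := TendstoInProb.of_tendsto hξ
    simpa [gramFamily] using this

end GramLimit

/-! ### From the Gram matrix to convergence in distribution -/

section GaussianLimit

variable {ι : Type*} [Fintype ι] {d : ℕ → ℕ}
  {Θ : ℕ → Type*} [∀ n, MeasurableSpace (Θ n)] {κ : ∀ n, Measure (Θ n)}
  [∀ n, IsProbabilityMeasure (κ n)]

/-- Given `θ`, the vector is Gaussian with covariance the Gram matrix divided by `d`. The absolute
value does not change this nonnegative quadratic form, but it makes the integrand a function of a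
real variable bounded by `1` everywhere, as bounded convergence requires. -/
theorem charFun_map_dotProduct_inputLaw {d : ℕ} {Θ : Type*} [MeasurableSpace Θ] {κ : Measure Θ}
    [IsProbabilityMeasure κ] {g : Θ → ι → Fin d → ℝ} (hg : Measurable g)
    (t : EuclideanSpace ℝ ι) :
    charFun ((κ.prod (ICL.inputLaw d)).map fun p =>
      WithLp.toLp 2 fun x => g p.1 x ⬝ᵥ p.2) t =
    ∫ θ, Complex.exp (-((|∑ x, ∑ y, t x * t y * (g θ x ⬝ᵥ g θ y / d)| / 2 : ℝ) : ℂ)) ∂κ := by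
  have hm : Measurable fun p : Θ × (Fin d → ℝ) =>
      (WithLp.toLp 2 fun x => g p.1 x ⬝ᵥ p.2 : EuclideanSpace ℝ ι) := by
    unfold dotProduct; fun_prop
  have e : ∀ p : Θ × (Fin d → ℝ),
      inner ℝ (WithLp.toLp 2 fun x => g p.1 x ⬝ᵥ p.2 : EuclideanSpace ℝ ι) t =
      (∑ x, t x • g p.1 x) ⬝ᵥ p.2 := by
    intro p
    simp [EuclideanSpace.inner_eq_star_dotProduct, dotProduct, Finset.sum_mul,
      Finset.mul_sum, mul_assoc]
    rw [Finset.sum_comm]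
  have hm2 : Measurable fun p : Θ × (Fin d → ℝ) => (∑ x, t x • g p.1 x) ⬝ᵥ p.2 := by
    unfold dotProduct; fun_prop
  rw [charFun_apply, integral_map hm.aemeasurable (by fun_prop)]
  simp only [e]
  rw [integral_prod _ ((integrable_const (1 : ℝ)).mono'
    (by fun_prop : Measurable _).aestronglyMeasurable
    (ae_of_all _ fun p => (Complex.norm_exp_ofReal_mul_I _).le))]
  refine integral_congr_ae (ae_of_all _ fun θ => ?_)
  have := integral_cexp_isoGaussian ((d : ℝ≥0)⁻¹) (∑ x, t x • g θ x)
  simp only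
  rw [ICL.inputLaw, this]
  have h0 : 0 ≤ (∑ x, t x • g θ x) ⬝ᵥ (∑ x, t x • g θ x) / d :=
    div_nonneg (Finset.sum_nonneg fun _ _ => mul_self_nonneg _) (Nat.cast_nonneg _)
  have h1 : (∑ x, t x • g θ x) ⬝ᵥ (∑ x, t x • g θ x) / d =
      ∑ x, ∑ y, t x * t y * (g θ x ⬝ᵥ g θ y / d) := by
    simp only [sum_dotProduct, dotProduct_sum, smul_dotProduct, dotProduct_smul, smul_eq_mul,
      Finset.sum_div, Finset.mul_sum]
    refine Finset.sum_congr rfl fun x _ => Finset.sum_congr rfl fun y _ => ?_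
    rw [dotProduct_comm (g θ y)]
    ring
  rw [← h1, abs_of_nonneg h0]
  congr 4
  push_cast
  ring

/-- Linear images of a Gaussian vector with independent random directions are asymptotically
standard Gaussian as soon as the Gram matrix of the directions converges to the identity. -/
theorem tendstoInDistribution_of_gram [DecidableEq ι] {Ω : ℕ → Type*} [∀ n, MeasurableSpace (Ω n)]
    {μ : ∀ n, Measure (Ω n)} [∀ n, IsProbabilityMeasure (μ n)]
    {Z : ∀ n, Ω n → EuclideanSpace ℝ ι} (hZ : ∀ n, AEMeasurable (Z n) (μ n))
    {g : ∀ n, Θ n → ι → Fin (d n) → ℝ} (hg : ∀ n, Measurable (g n))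
    (hlaw : ∀ n, (μ n).map (Z n) = ((κ n).prod (ICL.inputLaw (d n))).map fun p =>
      WithLp.toLp 2 fun x => g n p.1 x ⬝ᵥ p.2)
    (hG : ∀ x y, TendstoInProb κ (fun n θ => g n θ x ⬝ᵥ g n θ y / d n)
      ((1 : Matrix ι ι ℝ) x y)) :
    TendstoInDistribution Z atTop id μ (multivariateGaussian 0 (1 : Matrix ι ι ℝ)) := by
  refine ⟨hZ, by fun_prop, ?_⟩
  refine ProbabilityMeasure.tendsto_of_tendsto_charFun fun t => ?_
  simp only [ProbabilityMeasure.coe_mk, Measure.map_id, hlaw]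
  rw [charFun_multivariateGaussian Matrix.PosSemidef.one]
  simp only [charFun_map_dotProduct_inputLaw (hg _)]
  have hpi := TendstoInProb.pi (ι := ι × ι) fun p => hG p.1 p.2
  have hlim := hpi.comp (g := fun G : ι × ι → ℝ => ∑ x, ∑ y, t x * t y * G (x, y))
    (continuous_finsetSum _ fun x _ => continuous_finsetSum _ fun y _ => by fun_prop).continuousAt
  have hval : ∑ x, ∑ y, t x * t y * (1 : Matrix ι ι ℝ) x y = t.ofLp ⬝ᵥ t.ofLp := by
    simp [Matrix.one_apply, dotProduct]
  simp only [hval] at hlim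
  have h0 : 0 ≤ t.ofLp ⬝ᵥ t.ofLp := Finset.sum_nonneg fun _ _ => mul_self_nonneg _
  have := hlim.tendsto_integral (g := fun q : ℝ => Complex.exp (-((|q| / 2 : ℝ) : ℂ)))
    (by fun_prop) (M := 1) (fun q => by
      rw [← Complex.ofReal_neg, Complex.norm_exp_ofReal, Real.exp_le_one_iff]
      have := abs_nonneg q
      linarith) (fun n => by
      have : Measurable fun θ => ∑ x, ∑ y, t x * t y * (g n θ x ⬝ᵥ g n θ y / d n) := by
        have := hg n
        unfold dotProduct; fun_prop
      fun_prop)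
  rw [abs_of_nonneg h0] at this
  simpa [neg_div] using this

end GaussianLimit

/-! ### The joint vector as a linear image of the query -/

section JointVector

variable {d ℓ m k : ℕ} {σs : ℝ → ℝ} {ρ : ℝ≥0}

/-- Since `H_Z` has rank one, every coordinate is linear in the query, with a coefficient vector
that does not involve the query. -/
theorem jointVector_eq (e : Fin k ↪ Fin m) (F : Fin (d + 1) × Fin d → Fin m → ℝ) (ξ : Fin d → ℝ)
    (z : (Fin (ℓ + 1) → Fin d → ℝ) × (Fin ℓ → ℝ)) :
    ICL.jointVector σs e F ξ z =
      WithLp.toLp 2 fun x => gramFamily σs e ξ F (splitPrompt z).1 x ⬝ᵥ (splitPrompt z).2 := by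
  refine congrArg (WithLp.toLp 2) (funext fun x => ?_)
  rcases x with a | a
  · simp only [Sum.elim_inl, gramFamily, ICL.hidden, Matrix.mulVec, dotProduct,
      Matrix.transpose_apply, Matrix.of_apply, vecH_eq, Fintype.sum_prod_type, weightedRow]
    rw [Finset.sum_comm]
    refine Finset.sum_congr rfl fun i _ => ?_
    rw [Finset.sum_mul]
    refine Finset.sum_congr rfl fun j _ => ?_
    simp [Pi.single_apply]
    ring
  · rfl

theorem measurable_gramFamily_comp {α : Type*} [MeasurableSpace α] (e : Fin k ↪ Fin m)
    (hσ : Measurable σs) {ξ : α → Fin d → ℝ} {F : α → Fin (d + 1) × Fin d → Fin m → ℝ}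
    {c : α → (Fin ℓ → Fin d → ℝ) × (Fin ℓ → ℝ)} (hξ : Measurable ξ) (hF : Measurable F)
    (hc : Measurable c) : Measurable fun x => gramFamily σs e (ξ x) (F x) (c x) := by
  refine measurable_pi_lambda _ fun a => ?_
  rcases a with a | a
  · exact measurable_weightedRow_comp _ hσ hξ hF hc
  · exact hξ

theorem measurable_toLp_dotProduct {α ι κ : Type*} [MeasurableSpace α] [Fintype ι] [Fintype κ]
    {g : α → ι → κ → ℝ} {q : α → κ → ℝ} (hg : Measurable g) (hq : Measurable q) :
    Measurable fun p => (WithLp.toLp 2 fun x => g p x ⬝ᵥ q p : EuclideanSpace ℝ ι) := by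
  unfold dotProduct; fun_prop

theorem measurable_jointVector_comp {α : Type*} [MeasurableSpace α] (e : Fin k ↪ Fin m)
    (hσ : Measurable σs) (ξ : Fin d → ℝ) {F : α → Fin (d + 1) × Fin d → Fin m → ℝ}
    {z : α → (Fin (ℓ + 1) → Fin d → ℝ) × (Fin ℓ → ℝ)} (hF : Measurable F) (hz : Measurable z) :
    Measurable fun x => ICL.jointVector σs e (F x) ξ (z x) := by
  have hs := measurable_splitPrompt.comp hz
  simp only [jointVector_eq]
  exact measurable_toLp_dotProduct
    (measurable_gramFamily_comp e hσ measurable_const hF (measurable_fst.comp hs))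
    (measurable_snd.comp hs)

theorem map_jointVector (e : Fin k ↪ Fin m) (hσ : Measurable σs) (ξ : Fin d → ℝ)
    (F : Fin (d + 1) × Fin d → Fin m → ℝ) :
    (ICL.promptLaw d ℓ ρ).map (fun z => ICL.jointVector σs e F ξ z) =
      ((contextLaw d ℓ ρ).prod (ICL.inputLaw d)).map fun p =>
        WithLp.toLp 2 fun x => gramFamily σs e ξ F p.1 x ⬝ᵥ p.2 := by
  rw [← (measurePreserving_splitPrompt d ℓ ρ).map_eq, Measure.map_map
    (measurable_toLp_dotProduct (measurable_gramFamily_comp e hσ measurable_const measurable_const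
      measurable_fst) measurable_snd) measurable_splitPrompt]
  exact congrArg (fun f => Measure.map f _) (funext fun z => jointVector_eq e F ξ z)

theorem map_jointVector_prod (e : Fin k ↪ Fin m) (hσ : Measurable σs) (ξ : Fin d → ℝ) :
    ((ICL.weightLaw d ℓ m ρ σs).prod (ICL.promptLaw d ℓ ρ)).map
        (fun w => ICL.jointVector σs e w.1 ξ w.2) =
      (((ICL.weightLaw d ℓ m ρ σs).prod (contextLaw d ℓ ρ)).prod (ICL.inputLaw d)).map fun p =>
        WithLp.toLp 2 fun x => gramFamily σs e ξ p.1.1 p.1.2 x ⬝ᵥ p.2 := by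
  have h1 := (MeasurePreserving.id (ICL.weightLaw d ℓ m ρ σs)).prod
    (measurePreserving_splitPrompt d ℓ ρ)
  have h2 := (measurePreserving_prodAssoc (ICL.weightLaw d ℓ m ρ σs) (contextLaw d ℓ ρ)
    (ICL.inputLaw d)).symm.comp h1
  have hm : Measurable fun p : ((Fin (d + 1) × Fin d → Fin m → ℝ) ×
      ((Fin ℓ → Fin d → ℝ) × (Fin ℓ → ℝ))) × (Fin d → ℝ) =>
      (WithLp.toLp 2 fun x => gramFamily σs e ξ p.1.1 p.1.2 x ⬝ᵥ p.2 :
        EuclideanSpace ℝ (Fin k ⊕ Unit)) :=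
    measurable_toLp_dotProduct (measurable_gramFamily_comp e hσ measurable_const
      (measurable_fst.comp measurable_fst) (measurable_snd.comp measurable_fst)) measurable_snd
  rw [← h2.map_eq, Measure.map_map hm h2.measurable]
  exact congrArg (fun f => Measure.map f _) (funext fun w => jointVector_eq e w.1 ξ w.2)

end JointVector

/-! ### Almost sure convergence from summable expectations -/

section AlmostSure

/-- Strict monotonicity gives `d n ≥ n`, so the expectations are summable; by Tonelli the series
converges almost surely and its terms tend to `0`. No independence across `n` enters. -/
theorem ae_tendsto_zero_of_lintegral_le {Ω : Type*} [MeasurableSpace Ω] {P : Measure Ω}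
    {d : ℕ → ℕ} (hd : StrictMono d) {f : ℕ → Ω → ENNReal} (hf : ∀ n, AEMeasurable (f n) P) {C : ℝ}
    (hC : 0 ≤ C) (h : ∀ n, 1 ≤ d n → ∫⁻ ω, f n ω ∂P ≤ ENNReal.ofReal (C / d n ^ 2)) :
    ∀ᵐ ω ∂P, Tendsto (fun n => f n ω) atTop (𝓝 0) := by
  have hsum : ∑' n, ∫⁻ ω, f (n + 1) ω ∂P ≠ ⊤ := by
    have h1 : Summable fun n : ℕ => C / ((n + 1 : ℕ) : ℝ) ^ 2 :=
      ((summable_nat_add_iff 1).2 (Real.summable_one_div_nat_pow.2 one_lt_two)).mul_left C |>.congr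
        fun n => by simp [div_eq_mul_inv]
    refine ne_top_of_le_ne_top (ENNReal.ofReal_tsum_of_nonneg (fun n => by positivity) h1 ▸
      ENNReal.ofReal_ne_top) (ENNReal.tsum_le_tsum fun n => ?_)
    -- The shift by one avoids the index `0`, at which the dimension may be `0`.
    have hn : n + 1 ≤ d (n + 1) := hd.le_apply
    refine (h (n + 1) (by omega)).trans (ENNReal.ofReal_le_ofReal ?_)
    gcongr
  rw [← lintegral_tsum fun n => hf (n + 1)] at hsum
  filter_upwards [ae_lt_top' (AEMeasurable.tsum fun n => hf (n + 1)) hsum] with ω hω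
  exact (tendsto_add_atTop_iff_nat 1).1 (ENNReal.tendsto_atTop_zero_of_tsum_ne_top hω.ne)

theorem ae_tendsto_zero_of_hasLaw {Ω : Type*} [MeasurableSpace Ω] {P : Measure Ω} {d : ℕ → ℕ}
    (hd : StrictMono d) {E : ℕ → Type*} [∀ n, MeasurableSpace (E n)] {ν : ∀ n, Measure (E n)}
    {X : ∀ n, Ω → E n} (hX : ∀ n, HasLaw (X n) (ν n) P) {g : ∀ n, E n → ENNReal}
    (hg : ∀ n, Measurable (g n)) {C : ℝ} (hC : 0 ≤ C)
    (h : ∀ n, 1 ≤ d n → ∫⁻ x, g n x ∂(ν n) ≤ ENNReal.ofReal (C / d n ^ 2)) :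
    ∀ᵐ ω ∂P, Tendsto (fun n => g n (X n ω)) atTop (𝓝 0) := by
  refine ae_tendsto_zero_of_lintegral_le hd
    (fun n => (hg n).comp_aemeasurable (hX n).aemeasurable) hC fun n hn => ?_
  rw [← lintegral_map' (hg n).aemeasurable (hX n).aemeasurable, (hX n).map_eq]
  exact h n hn

/-- Gaussian task vectors have almost surely the right norm, whatever their joint law. -/
theorem ae_tendsto_normSq_div {Ω : Type*} [MeasurableSpace Ω] {P : Measure Ω} {d : ℕ → ℕ}
    (hd : StrictMono d) {ξ : ∀ n, Ω → Fin (d n) → ℝ}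
    (hξ : ∀ n, HasLaw (ξ n) (ICL.taskLaw (d n)) P) :
    ∀ᵐ ω ∂P, Tendsto (fun n => ξ n ω ⬝ᵥ ξ n ω / d n) atTop (𝓝 1) := by
  obtain ⟨C, hC, h⟩ := exists_lintegral_normSq_sub_one_le
  have hmeas : ∀ n, Measurable fun x : Fin (d n) → ℝ =>
      ENNReal.ofReal ((x ⬝ᵥ x / d n - 1) ^ 4) := by
    intro n
    have := measurable_normSq_div (d n)
    fun_prop
  have hae := ae_tendsto_zero_of_hasLaw hd hξ hmeas hC fun n hn => h (d n) hn
  filter_upwards [hae] with ω hω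
  have h1 := (ENNReal.tendsto_toReal ENNReal.zero_ne_top).comp hω
  -- Two square roots turn the fourth power back into the absolute deviation.
  have h2 : Tendsto (fun n => √√((ξ n ω ⬝ᵥ ξ n ω / d n - 1) ^ 4)) atTop (𝓝 0) := by
    have h3 := (Real.continuous_sqrt.comp Real.continuous_sqrt).continuousAt.tendsto.comp h1
    simpa [Function.comp_def, ENNReal.toReal_ofReal, Even.pow_nonneg (by decide : Even 4)]
      using h3
  rw [tendsto_iff_dist_tendsto_zero]
  refine h2.congr fun n => ?_
  rw [show ∀ x : ℝ, x ^ 4 = (x ^ 2) ^ 2 from fun x => by ring, Real.sqrt_sq (sq_nonneg _),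
    Real.sqrt_sq_eq_abs, Real.dist_eq]

end AlmostSure

/-! ### Averaging the defect bound over contexts and task vectors -/

section GramDefect

variable {d ℓ m : ℕ} {σs : ℝ → ℝ} {ρ : ℝ≥0} {B : ENNReal}

theorem lintegral_gramDefect_prod_le (hσ : Measurable σs) {u : Fin m → ℝ} {ξ : Fin d → ℝ}
    (hB : ∀ c : (Fin ℓ → Fin d → ℝ) × (Fin ℓ → ℝ),
      ∫⁻ F, gramDefect ρ σs u ξ F c ∂(ICL.weightLaw d ℓ m ρ σs) ≤ B) :
    ∫⁻ p, gramDefect ρ σs u ξ p.1 p.2 ∂((ICL.weightLaw d ℓ m ρ σs).prod (contextLaw d ℓ ρ)) ≤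
      B := by
  rw [lintegral_prod_symm' _
    (measurable_gramDefect_comp u hσ measurable_const measurable_fst measurable_snd)]
  calc _ ≤ ∫⁻ _, B ∂(contextLaw d ℓ ρ) := lintegral_mono fun c => hB c
    _ = B := by simp

theorem measurable_lintegral_gramDefect (hσ : Measurable σs) (u : Fin m → ℝ) :
    Measurable fun p : (Fin d → ℝ) × (Fin (d + 1) × Fin d → Fin m → ℝ) =>
      ∫⁻ c, gramDefect ρ σs u p.1 p.2 c ∂(contextLaw d ℓ ρ) :=
  Measurable.lintegral_prod_right' (f := fun q : ((Fin d → ℝ) ×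
      (Fin (d + 1) × Fin d → Fin m → ℝ)) × ((Fin ℓ → Fin d → ℝ) × (Fin ℓ → ℝ)) =>
      gramDefect ρ σs u q.1.1 q.1.2 q.2)
    (measurable_gramDefect_comp u hσ (measurable_fst.comp measurable_fst)
      (measurable_snd.comp measurable_fst) measurable_snd)

/-- The defect averaged over the context is a function of `(ξ, F)` alone, the form needed for an
almost sure statement. Tonelli transfers to it the bound known for each fixed `ξ` and `c`. -/
theorem lintegral_lintegral_gramDefect_le (hσ : Measurable σs) {u : Fin m → ℝ}
    (hB : ∀ (ξ : Fin d → ℝ) (c : (Fin ℓ → Fin d → ℝ) × (Fin ℓ → ℝ)),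
      ∫⁻ F, gramDefect ρ σs u ξ F c ∂(ICL.weightLaw d ℓ m ρ σs) ≤ B) :
    ∫⁻ p, ∫⁻ c, gramDefect ρ σs u p.1 p.2 c ∂(contextLaw d ℓ ρ)
      ∂((ICL.taskLaw d).prod (ICL.weightLaw d ℓ m ρ σs)) ≤ B := by
  rw [lintegral_prod _ (measurable_lintegral_gramDefect hσ u).aemeasurable]
  calc _ ≤ ∫⁻ _, B ∂(ICL.taskLaw d) := by
        refine lintegral_mono fun ξ => ?_
        have := lintegral_gramDefect_prod_le hσ (hB ξ)
        rwa [lintegral_prod _ (measurable_gramDefect_comp u hσ measurable_const measurable_fst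
          measurable_snd).aemeasurable] at this
    _ = B := by simp

end GramDefect

/-! ### The main theorem -/

theorem corollary2
    -- the target function, the noise variance and the limiting ratio of `ℓ / d`
    (σs : ℝ → ℝ) (hσs : Measurable σs) (ρ : ℝ≥0) (hρ : 0 < ρ) (τ : ℝ) (hτ : 0 < τ)
    -- the dimensions `d`, the context lengths `ℓ` and the hidden widths `m`
    (d ℓ m : ℕ → ℕ) (hd : StrictMono d)
    (hℓ : Tendsto (fun n => (ℓ n : ℝ) / (d n : ℝ)) atTop (𝓝 τ))
    -- `vec(H_Z)` has finite second moments, so that `Cov(vec(H_Z))` exists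
    (hcov : ∀ n, ∀ p : Fin (d n + 1) × Fin (d n),
      MemLp (fun w : (Fin (d n) → ℝ) × ((Fin (ℓ n + 1) → Fin (d n) → ℝ) × (Fin (ℓ n) → ℝ)) =>
          ICL.vecH σs w.1 w.2 p) 2
        ((ICL.taskLaw (d n)).prod (ICL.promptLaw (d n) (ℓ n) ρ)))
    -- the random task vectors and the random weights, independent of each other for each `n`
    {Ω : Type*} [MeasurableSpace Ω] (P : Measure Ω) [IsProbabilityMeasure P]
    (ξ : ∀ n, Ω → Fin (d n) → ℝ)
    (F : ∀ n, Ω → Fin (d n + 1) × Fin (d n) → Fin (m n) → ℝ)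
    (hlaw : ∀ n, HasLaw (fun ω => (ξ n ω, F n ω))
      ((ICL.taskLaw (d n)).prod (ICL.weightLaw (d n) (ℓ n) (m n) ρ σs)) P)
    -- finitely many hidden coordinates
    (k : ℕ) (c : ∀ n, Fin k ↪ Fin (m n)) :
    ∃ S : Matrix (Fin k ⊕ Unit) (Fin k ⊕ Unit) ℝ, S.PosSemidef ∧ (∀ i, S i i = 1) ∧
      -- given the task vectors: convergence in distribution under the law of the weights and of `Z`
      (∀ᵐ ω ∂P, TendstoInDistribution
        (fun n (w : (Fin (d n + 1) × Fin (d n) → Fin (m n) → ℝ) ×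
            ((Fin (ℓ n + 1) → Fin (d n) → ℝ) × (Fin (ℓ n) → ℝ))) =>
          ICL.jointVector σs (c n) w.1 (ξ n ω) w.2)
        atTop id
        (fun n => (ICL.weightLaw (d n) (ℓ n) (m n) ρ σs).prod (ICL.promptLaw (d n) (ℓ n) ρ))
        (multivariateGaussian 0 S)) ∧
      -- given the task vectors and the weights: convergence in distribution under the law of `Z`
      (∀ᵐ ω ∂P, TendstoInDistribution
        (fun n (z : (Fin (ℓ n + 1) → Fin (d n) → ℝ) × (Fin (ℓ n) → ℝ)) =>
          ICL.jointVector σs (c n) (F n ω) (ξ n ω) z)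
        atTop id
        (fun n => ICL.promptLaw (d n) (ℓ n) ρ)
        (multivariateGaussian 0 S)) := by
  have hd' : Tendsto (fun n => (d n : ℝ)) atTop atTop :=
    tendsto_natCast_atTop_atTop.comp hd.tendsto_atTop
  have hℓ' : Tendsto (fun n => (ℓ n : ℝ)) atTop atTop := by
    refine (hℓ.pos_mul_atTop hτ hd').congr' ?_
    filter_upwards [hd'.eventually_gt_atTop 0] with n hn
    rw [div_mul_cancel₀ _ hn.ne']
  obtain ⟨htrace, V, hV, hV4⟩ := tendsto_trace_div hσs hτ hd' hℓ' hℓ hcov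
  have hnorm := ae_tendsto_normSq_div hd fun n =>
    (⟨measurable_fst.comp_aemeasurable (hlaw n).aemeasurable, by
      have h := AEMeasurable.map_map_of_aemeasurable measurable_fst.aemeasurable
        (hlaw n).aemeasurable
      rw [(hlaw n).map_eq, measurePreserving_fst.map_eq] at h
      exact h.symm⟩ : HasLaw (ξ n) (ICL.taskLaw (d n)) P)
  obtain ⟨C, hC, hdefect⟩ := exists_lintegral_gramDefect_le ρ σs
  have hB : ∀ n, 1 ≤ d n → ∀ u : Fin (m n) → ℝ, u ⬝ᵥ u ≤ 4 →
      ∀ (x : Fin (d n) → ℝ) (p : (Fin (ℓ n) → Fin (d n) → ℝ) × (Fin (ℓ n) → ℝ)),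
        ∫⁻ G, gramDefect ρ σs u x G p ∂(ICL.weightLaw (d n) (ℓ n) (m n) ρ σs) ≤
          ENNReal.ofReal (C / d n ^ 2) :=
    fun n hn u hu x p => hdefect (d n) (ℓ n) (m n) u x p hn hu
  have hBlim : Tendsto (fun n => ENNReal.ofReal (C / d n ^ 2)) atTop (𝓝 0) := by
    have h1 : Tendsto (fun n => C / (d n : ℝ) ^ 2) atTop (𝓝 0) :=
      ((tendsto_pow_atTop two_ne_zero).comp hd').const_div_atTop C
    simpa [Function.comp_def] using (ENNReal.continuous_ofReal.tendsto _).comp h1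
  have hu1 : ∀ a n, (Pi.single (c n a) 1 : Fin (m n) → ℝ) ⬝ᵥ Pi.single (c n a) 1 ≤ 4 := by
    intro a n
    simp
  have hu2 : ∀ a b n, (Pi.single (c n a) 1 + Pi.single (c n b) 1 : Fin (m n) → ℝ) ⬝ᵥ
      (Pi.single (c n a) 1 + Pi.single (c n b) 1) ≤ 4 := by
    intro a b n
    by_cases hab : c n a = c n b
    · simp [hab]; norm_num
    · simp [hab, Ne.symm hab]; norm_num
  refine ⟨1, Matrix.PosSemidef.one, fun i => Matrix.one_apply_eq i, ?_, ?_⟩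
  -- Weights averaged: only the norms of the task vectors have to be typical, and the Gram matrix
  -- converges in probability over weights and contexts together.
  · filter_upwards [hnorm] with ω hω
    have hR := (tendstoInProb_scaledRowSq hσs hρ hV hV4 hτ hd' hℓ' hℓ htrace hω).comp_map
      (ν := fun n => (ICL.weightLaw (d n) (ℓ n) (m n) ρ σs).prod (contextLaw (d n) (ℓ n) ρ))
      (fun n => measurable_snd.aemeasurable) (fun n => measurePreserving_snd.map_eq)
    have hlim : ∀ u : ∀ n, Fin (m n) → ℝ, (∀ n, u n ⬝ᵥ u n ≤ 4) → Tendsto (fun n =>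
        ∫⁻ p, gramDefect ρ σs (u n) (ξ n ω) p.1 p.2
          ∂((ICL.weightLaw (d n) (ℓ n) (m n) ρ σs).prod (contextLaw (d n) (ℓ n) ρ)))
        atTop (𝓝 0) := by
      intro u hu
      refine tendsto_of_tendsto_of_tendsto_of_le_of_le' tendsto_const_nhds hBlim
        (Eventually.of_forall fun _ => zero_le) ?_
      filter_upwards [hd.tendsto_atTop.eventually_ge_atTop 1] with n hn
      exact lintegral_gramDefect_prod_le hσs (hB n hn _ (hu n) _)
    have hG := tendstoInProb_gramFamily hσs (fun n => measurable_fst) (fun n => measurable_snd) hR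
      hω c (fun a => hlim _ (hu1 a)) (fun a b => hlim _ (hu2 a b))
    exact tendstoInDistribution_of_gram
      (fun n => (measurable_jointVector_comp (c n) hσs _ measurable_fst
        measurable_snd).aemeasurable)
      (fun n => measurable_gramFamily_comp (c n) hσs measurable_const measurable_fst
        measurable_snd)
      (fun n => map_jointVector_prod (c n) hσs _) hG
  -- Weights frozen: the defect averaged over the context tends to `0` for almost every `ω`.
  -- Finitely many choices of `u`, the vectors `e_a` and `e_a + e_b`, suffice, so the exceptional
  -- null sets can be united.
  · have hlim : ∀ u : ∀ n, Fin (m n) → ℝ, (∀ n, u n ⬝ᵥ u n ≤ 4) → ∀ᵐ ω ∂P, Tendsto (fun n =>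
        ∫⁻ p, gramDefect ρ σs (u n) (ξ n ω) (F n ω) p ∂(contextLaw (d n) (ℓ n) ρ))
        atTop (𝓝 0) := by
      intro u hu
      exact ae_tendsto_zero_of_hasLaw hd hlaw
        (fun n => measurable_lintegral_gramDefect (d := d n) (ℓ := ℓ n) (ρ := ρ) hσs (u n)) hC
        fun n hn => lintegral_lintegral_gramDefect_le hσs (hB n hn _ (hu n))
    filter_upwards [hnorm, ae_all_iff.2 fun a => hlim _ (hu1 a),
      ae_all_iff.2 fun a => ae_all_iff.2 fun b => hlim _ (hu2 a b)] with ω hω h1 h2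
    have hR := tendstoInProb_scaledRowSq hσs hρ hV hV4 hτ hd' hℓ' hℓ htrace hω
    have hG := tendstoInProb_gramFamily hσs (F := fun n _ => F n ω) (fun n => measurable_const)
      (fun n => measurable_id) hR hω c h1 h2
    exact tendstoInDistribution_of_gram
      (fun n => (measurable_jointVector_comp (c n) hσs _ measurable_const
        measurable_id).aemeasurable)
      (fun n => measurable_gramFamily_comp (c n) hσs measurable_const measurable_const
        measurable_id)
      (fun n => map_jointVector (c n) hσs _ _) hG
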